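/- Let $\alpha_1,\alpha_2,\beta_2,\gamma_2,\delta_2,\tau_2,\kappa_2>0$ and $\ell_1=\ell_2=\pi$. Consider the coupling of an elastic string with a thermoelastic beam obeying Cattaneo's law, $$\begin{cases}u_{1,tt}-\alpha_1u_{1,xx}=0 & \text{in }(0,\ell_1)\times(0,\infty),\\ u_{2,tt}+\alpha_2u_{2,xxxx}-\beta_2\theta_{2,xx}=0,\quad \theta_{2,t}+\gamma_2q_{2,x}+\delta_2u_{2,txx}=0,\quad \tau_2q_{2,t}+q_2+\kappa_2\theta_{2,x}=0 & \text{in }(0,\ell_2)\times(0,\infty),\end{cases}$$ with $u_1(0,t)=u_2(0,t)$, $\theta_2(0,t)=0$, $u_{2,x}(0,t)=0$, $\frac{\delta_2}{\beta_2}(\alpha_2u_{2,xxx}-\beta_2\theta_{2,x})(0,t)=\alpha_1u_{1,x}(0,t)$ and $u_1(\ell_1,t)=u_2(\ell_2,t)=\theta_2(\ell_2,t)=u_{2,xx}(\ell_2,t)=0$. All functions are complex valued. Let $V$ be the space of $(f_1,f_2)\in H^1(0,\ell_1)\times H^2(0,\ell_2)$ with $f_1(\ell_1)=0$, $f_2(\ell_2)=0$,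 $f_1(0)=f_2(0)$, $\partial_xf_2(0)=0$, and let $\mathcal H_2=V\times(L^2(0,\ell_1)\times L^2(0,\ell_2))\times L^2(0,\ell_2)\times L^2(0,\ell_2)$ be normed by $$\|(u,v,\theta_2,q_2)\|^2_{\mathcal H_2}=\alpha_1\|\partial_xu_1\|^2+\|v_1\|^2+\tfrac{\delta_2}{\beta_2}\left(\alpha_2\|\partial_x^2u_2\|^2+\|v_2\|^2\right)+\|\theta_2\|^2+\tfrac{\gamma_2\tau_2}{\kappa_2}\|q_2\|^2 .$$ Let $\mathcal A_2$ be the operator on $\mathcal H_2$ whose domain consists of the $y=(u,v,\theta_2,q_2)\in\mathcal H_2$ with $v\in V$, $u_1\in H^2(0,\ell_1)$, $\theta_2\in H^1_0(0,\ell_2)$, $q_2\in H^1(0,\ell_2)$, $-\alpha_2\partial_x^2u_2+\beta_2\theta_2\in H^2(0,\ell_2)$, $\partial_x^2u_2(\ell_2)=0$ and $\frac{\delta_2}{\beta_2}\partial_x(\alpha_2\partial_x^2u_2-\beta_2\theta_2)(0)=\alpha_1\partial_xu_1(0)$, with $$\mathcal A_2y=\Big(v_1,\;v_2,\;\alpha_1\partial_x^2u_1,\;\partial_x^2(-\alpha_2\partial_x^2u_2+\beta_2\theta_2),\;-\delta_2\partial_x^2v_2-\gamma_2\partial_xq_2,\;-\tfrac1{\tau_2}q_2-\tfrac{\kappa_2}{\tau_2}\partial_x\theta_2\Big).$$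 Then $\mathcal A_2$ generates a $C_0$-semigroup $(S_2(t))_{t\ge0}$ on $\mathcal H_2$, and this semigroup is not exponentially stable: there are no $M,\omega>0$ with $\|S_2(t)y\|_{\mathcal H_2}\le Me^{-\omega t}\|y\|_{\mathcal H_2}$ for all $t\ge0$, $y\in\mathcal H_2$. Moreover $i\mathbb R\subset\rho(\mathcal A_2)$, and for every real $\alpha<1$ $$\limsup_{\lambda\in\mathbb R,\ |\lambda|\to\infty}|\lambda|^{-\alpha}\left\|(i\lambda I-\mathcal A_2)^{-1}\right\|_{\mathcal L(\mathcal H_2)}=\infty .$$ -/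

import Mathlib

open Set Filter Topology MeasureTheory
open scoped ENNReal NNReal ContDiff

noncomputable section

/-! ### Sobolev spaces on a bounded interval -/

/-- `L²(0,ℓ)`, complex valued. -/
abbrev L2 (ℓ : ℝ) : Type := Lp ℂ 2 ((volume : Measure ℝ).restrict (Ioo 0 ℓ))

/-- `g` is the weak derivative of `f` on `(0,ℓ)`. -/
def IsWeakDeriv {ℓ : ℝ} (f g : L2 ℓ) : Prop :=
  ∀ φ : ℝ → ℝ, ContDiff ℝ ∞ φ → HasCompactSupport φ → tsupport φ ⊆ Ioo 0 ℓ →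
    ∫ x in Ioo 0 ℓ, deriv φ x • f x = - ∫ x in Ioo 0 ℓ, φ x • g x

/-- `c` is the value at the point `x ∈ [0,ℓ]` of the representative of `f` that is
continuous on `[0,ℓ]`. -/
def HasTrace {ℓ : ℝ} (f : L2 ℓ) (x : ℝ) (c : ℂ) : Prop :=
  ∃ F : ℝ → ℂ, ContinuousOn F (Icc 0 ℓ) ∧
    (f =ᵐ[(volume : Measure ℝ).restrict (Ioo 0 ℓ)] F) ∧ F x = c

open Classical in
/-- The weak derivative of `f` (and `0` if `f` has no weak derivative in `L²(0,ℓ)`). -/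
def weakDeriv {ℓ : ℝ} (f : L2 ℓ) : L2 ℓ :=
  if h : ∃ g, IsWeakDeriv f g then h.choose else 0

lemma integrable_smul_L2 {ℓ : ℝ} (f : L2 ℓ) {φ : ℝ → ℝ} (hφ : Continuous φ)
    (hc : HasCompactSupport φ) :
    Integrable (fun x => φ x • f x) ((volume : Measure ℝ).restrict (Ioo 0 ℓ)) := by
  have : IsFiniteMeasure ((volume : Measure ℝ).restrict (Ioo 0 ℓ)) :=
    ⟨by rw [Measure.restrict_apply_univ]; exact measure_Ioo_lt_top⟩
  have hf : Integrable f ((volume : Measure ℝ).restrict (Ioo 0 ℓ)) :=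
    (Lp.memLp f).integrable (by norm_num)
  obtain ⟨C, hC⟩ := hφ.bounded_above_of_compact_support hc
  exact hf.bdd_smul C hφ.aestronglyMeasurable (Eventually.of_forall hC)

lemma IsWeakDeriv.add {ℓ : ℝ} {f g f' g' : L2 ℓ} (hf : IsWeakDeriv f f')
    (hg : IsWeakDeriv g g') : IsWeakDeriv (f + g) (f' + g') := by
  intro φ h1 h2 h3
  have hd : Continuous (deriv φ) := h1.continuous_deriv (by simp)
  have e1 : ∫ x in Ioo 0 ℓ, deriv φ x • (f + g : L2 ℓ) x
      = ∫ x in Ioo 0 ℓ, (deriv φ x • f x + deriv φ x • g x) := by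
    refine integral_congr_ae ?_
    filter_upwards [Lp.coeFn_add f g] with x hx
    rw [hx, Pi.add_apply, smul_add]
  have e2 : ∫ x in Ioo 0 ℓ, φ x • (f' + g' : L2 ℓ) x
      = ∫ x in Ioo 0 ℓ, (φ x • f' x + φ x • g' x) := by
    refine integral_congr_ae ?_
    filter_upwards [Lp.coeFn_add f' g'] with x hx
    rw [hx, Pi.add_apply, smul_add]
  rw [e1, e2, integral_add (integrable_smul_L2 f hd h2.deriv) (integrable_smul_L2 g hd h2.deriv),
    integral_add (integrable_smul_L2 f' h1.continuous h2) (integrable_smul_L2 g' h1.continuous h2),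
    hf φ h1 h2 h3, hg φ h1 h2 h3]
  ring

lemma IsWeakDeriv.smul {ℓ : ℝ} {f f' : L2 ℓ} (c : ℂ) (hf : IsWeakDeriv f f') :
    IsWeakDeriv (c • f) (c • f') := by
  intro φ h1 h2 h3
  have e1 : ∫ x in Ioo 0 ℓ, deriv φ x • (c • f : L2 ℓ) x
      = ∫ x in Ioo 0 ℓ, c • (deriv φ x • f x) := by
    refine integral_congr_ae ?_
    filter_upwards [Lp.coeFn_smul c f] with x hx
    rw [hx, Pi.smul_apply, smul_comm]
  have e2 : ∫ x in Ioo 0 ℓ, φ x • (c • f' : L2 ℓ) x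
      = ∫ x in Ioo 0 ℓ, c • (φ x • f' x) := by
    refine integral_congr_ae ?_
    filter_upwards [Lp.coeFn_smul c f'] with x hx
    rw [hx, Pi.smul_apply, smul_comm]
  rw [e1, e2, integral_smul, integral_smul, hf φ h1 h2 h3, smul_neg]

lemma IsWeakDeriv.zero {ℓ : ℝ} : IsWeakDeriv (0 : L2 ℓ) 0 := by
  intro φ _ _ _
  have e (ψ : ℝ → ℝ) : ∫ x in Ioo 0 ℓ, ψ x • (0 : L2 ℓ) x = 0 := by
    refine integral_eq_zero_of_ae ?_
    filter_upwards [Lp.coeFn_zero ℂ 2 ((volume : Measure ℝ).restrict (Ioo 0 ℓ))] with x hx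
    rw [hx]; simp
  rw [e, e, neg_zero]

/-- An `L²` function that integrates to zero against all test functions vanishes. -/
lemma L2_eq_zero_of_test {ℓ : ℝ} (f : L2 ℓ)
    (h : ∀ φ : ℝ → ℝ, ContDiff ℝ ∞ φ → HasCompactSupport φ → tsupport φ ⊆ Ioo 0 ℓ →
      ∫ x in Ioo 0 ℓ, φ x • f x = 0) : f = 0 := by
  have : IsFiniteMeasure ((volume : Measure ℝ).restrict (Ioo 0 ℓ)) :=
    ⟨by rw [Measure.restrict_apply_univ]; exact measure_Ioo_lt_top⟩
  have hf : IntegrableOn f (Ioo 0 ℓ) volume := (Lp.memLp f).integrable (by norm_num)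
  have := isOpen_Ioo.ae_eq_zero_of_integral_contDiff_smul_eq_zero hf.locallyIntegrableOn
    (fun φ h1 h2 h3 => by
      rw [← h φ h1 h2 h3]
      symm
      refine setIntegral_eq_integral_of_forall_compl_eq_zero fun x hx => ?_
      rw [image_eq_zero_of_notMem_tsupport (fun hx' => hx (h3 hx')), zero_smul])
  rw [Lp.eq_zero_iff_ae_eq_zero]
  exact (ae_restrict_iff' measurableSet_Ioo).2 this

lemma IsWeakDeriv.unique {ℓ : ℝ} {f g g' : L2 ℓ} (h : IsWeakDeriv f g) (h' : IsWeakDeriv f g') :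
    g = g' := by
  have hs : IsWeakDeriv (f + (-1 : ℂ) • f) (g + (-1 : ℂ) • g') := h.add (h'.smul (-1))
  have h0 : g + (-1 : ℂ) • g' = 0 := by
    refine L2_eq_zero_of_test _ fun φ h1 h2 h3 => ?_
    have h4 := hs φ h1 h2 h3
    have h5 : f + (-1 : ℂ) • f = 0 := by simp
    have h6 := IsWeakDeriv.zero (ℓ := ℓ) φ h1 h2 h3
    have h7 : ∫ x in Ioo 0 ℓ, φ x • (0 : L2 ℓ) x = 0 := by
      refine integral_eq_zero_of_ae ?_
      filter_upwards [Lp.coeFn_zero ℂ 2 ((volume : Measure ℝ).restrict (Ioo 0 ℓ))] with x hx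
      rw [hx]; simp
    rw [h5, h6, h7] at h4
    simpa using h4.symm
  simpa [add_neg_eq_zero] using h0

lemma IsWeakDeriv.weakDeriv_eq {ℓ : ℝ} {f g : L2 ℓ} (h : IsWeakDeriv f g) : weakDeriv f = g := by
  have hex : ∃ g, IsWeakDeriv f g := ⟨g, h⟩
  rw [weakDeriv, dif_pos hex]
  exact hex.choose_spec.unique h

/-- The Sobolev space `H¹(0,ℓ)`. -/
def H1 (ℓ : ℝ) : Submodule ℂ (L2 ℓ) where
  carrier := {f | ∃ g, IsWeakDeriv f g}
  add_mem' := fun ⟨_, hf⟩ ⟨_, hg⟩ => ⟨_, hf.add hg⟩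
  zero_mem' := ⟨0, IsWeakDeriv.zero⟩
  smul_mem' := fun c _ ⟨_, hf⟩ => ⟨_, hf.smul c⟩

lemma isWeakDeriv_weakDeriv {ℓ : ℝ} {f : L2 ℓ} (hf : f ∈ H1 ℓ) : IsWeakDeriv f (weakDeriv f) := by
  obtain ⟨g, hg⟩ := hf
  rwa [hg.weakDeriv_eq]

lemma weakDeriv_zero {ℓ : ℝ} : weakDeriv (0 : L2 ℓ) = 0 := IsWeakDeriv.zero.weakDeriv_eq

lemma weakDeriv_add {ℓ : ℝ} {f g : L2 ℓ} (hf : f ∈ H1 ℓ) (hg : g ∈ H1 ℓ) :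
    weakDeriv (f + g) = weakDeriv f + weakDeriv g :=
  ((isWeakDeriv_weakDeriv hf).add (isWeakDeriv_weakDeriv hg)).weakDeriv_eq

lemma weakDeriv_smul {ℓ : ℝ} (c : ℂ) {f : L2 ℓ} (hf : f ∈ H1 ℓ) :
    weakDeriv (c • f) = c • weakDeriv f :=
  ((isWeakDeriv_weakDeriv hf).smul c).weakDeriv_eq

/-- The Sobolev space `H²(0,ℓ)`. -/
def H2 (ℓ : ℝ) : Submodule ℂ (L2 ℓ) where
  carrier := {f | f ∈ H1 ℓ ∧ weakDeriv f ∈ H1 ℓ}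
  add_mem' := fun ⟨hf, hf'⟩ ⟨hg, hg'⟩ =>
    ⟨add_mem hf hg, by rw [weakDeriv_add hf hg]; exact add_mem hf' hg'⟩
  zero_mem' := ⟨zero_mem _, by rw [weakDeriv_zero]; exact zero_mem _⟩
  smul_mem' := fun c _ ⟨hf, hf'⟩ =>
    ⟨Submodule.smul_mem _ c hf, by rw [weakDeriv_smul c hf]; exact Submodule.smul_mem _ c hf'⟩

/-- The second weak derivative. -/
def weakDeriv2 {ℓ : ℝ} (f : L2 ℓ) : L2 ℓ := weakDeriv (weakDeriv f)

lemma weakDeriv2_add {ℓ : ℝ} {f g : L2 ℓ} (hf : f ∈ H2 ℓ) (hg : g ∈ H2 ℓ) :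
    weakDeriv2 (f + g) = weakDeriv2 f + weakDeriv2 g := by
  rw [weakDeriv2, weakDeriv_add hf.1 hg.1, weakDeriv_add hf.2 hg.2]; rfl

lemma weakDeriv2_smul {ℓ : ℝ} (c : ℂ) {f : L2 ℓ} (hf : f ∈ H2 ℓ) :
    weakDeriv2 (c • f) = c • weakDeriv2 f := by
  rw [weakDeriv2, weakDeriv_smul c hf.1, weakDeriv_smul c hf.2]; rfl

lemma weakDeriv2_zero {ℓ : ℝ} : weakDeriv2 (0 : L2 ℓ) = 0 := by
  rw [weakDeriv2, weakDeriv_zero, weakDeriv_zero]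

lemma HasTrace.add {ℓ x : ℝ} {f g : L2 ℓ} {c d : ℂ} (hf : HasTrace f x c) (hg : HasTrace g x d) :
    HasTrace (f + g) x (c + d) := by
  obtain ⟨F, h1, h2, h3⟩ := hf
  obtain ⟨G, k1, k2, k3⟩ := hg
  exact ⟨F + G, h1.add k1, (Lp.coeFn_add f g).trans (h2.add k2), by simp [h3, k3]⟩

lemma HasTrace.smul {ℓ x : ℝ} {f : L2 ℓ} {c : ℂ} (a : ℂ) (hf : HasTrace f x c) :
    HasTrace (a • f) x (a * c) := by
  obtain ⟨F, h1, h2, h3⟩ := hf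
  exact ⟨a • F, h1.const_smul a, (Lp.coeFn_smul a f).trans (h2.const_smul a), by simp [h3]⟩

lemma HasTrace.zero {ℓ x : ℝ} : HasTrace (0 : L2 ℓ) x 0 :=
  ⟨0, continuousOn_const, Lp.coeFn_zero _ _ _, rfl⟩

/-- A test function with vanishing integral is the derivative of a test function. -/
lemma exists_test_primitive {ℓ : ℝ} {h : ℝ → ℝ} (h1 : ContDiff ℝ ∞ h) (h2 : HasCompactSupport h)
    (h3 : tsupport h ⊆ Ioo 0 ℓ) (h4 : ∫ x, h x = 0) :
    ∃ φ : ℝ → ℝ, ContDiff ℝ ∞ φ ∧ HasCompactSupport φ ∧ tsupport φ ⊆ Ioo 0 ℓ ∧ deriv φ = h := by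
  rcases (tsupport h).eq_empty_or_nonempty with he | hne
  · have : h = 0 := tsupport_eq_empty_iff.1 he
    exact ⟨0, contDiff_const, HasCompactSupport.zero, by simp [tsupport_eq_empty_iff.2 rfl],
      by rw [this]; simp⟩
  have hK : IsCompact (tsupport h) := h2
  obtain ⟨a, ha, ha'⟩ := hK.exists_isLeast hne
  obtain ⟨b, hb, hb'⟩ := hK.exists_isGreatest hne
  have hd (x : ℝ) : HasDerivAt (fun x => ∫ t in (0)..x, h t) (h x) x :=
    intervalIntegral.integral_hasDerivAt_right (h1.continuous.intervalIntegrable _ _)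
      h1.continuous.aestronglyMeasurable.stronglyMeasurableAtFilter h1.continuous.continuousAt
  have hde : deriv (fun x => ∫ t in (0)..x, h t) = h := funext fun x => (hd x).deriv
  have hzero (x : ℝ) (hx : x ∉ Icc a b) : h x = 0 :=
    image_eq_zero_of_notMem_tsupport fun hx' => hx ⟨ha' hx', hb' hx'⟩
  have hsub : tsupport (fun x => ∫ t in (0)..x, h t) ⊆ Icc a b := by
    refine closure_minimal (fun x hx => ?_) isClosed_Icc
    by_contra hx'
    apply hx
    rcases not_and_or.1 hx' with hlt | hgt
    · refine intervalIntegral.integral_zero_ae (Eventually.of_forall fun t ht => hzero t ?_)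
      intro ht'
      have hle := (uIoc_subset_uIcc ht).2
      have : max 0 x < a := max_lt (h3 ha).1 (not_le.1 hlt)
      exact absurd (hle.trans_lt this) (not_lt.2 ht'.1)
    · have hxb : b < x := not_le.1 hgt
      have h0x : 0 ≤ x := ((h3 hb).1.trans hxb).le
      show ∫ t in (0)..x, h t = 0
      rw [intervalIntegral.integral_of_le h0x,
        setIntegral_eq_integral_of_forall_compl_eq_zero (f := h), h4]
      exact fun t ht => hzero t fun ht' => ht ⟨(h3 ha).1.trans_le ht'.1, ht'.2.trans hxb.le⟩
  refine ⟨fun x => ∫ t in (0)..x, h t, ?_, ?_, ?_, hde⟩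
  · rw [contDiff_infty_iff_deriv, hde]
    exact ⟨fun x => (hd x).differentiableAt, h1⟩
  · exact HasCompactSupport.intro' isCompact_Icc isClosed_Icc
      fun x hx => image_eq_zero_of_notMem_tsupport (f := fun x => ∫ t in (0)..x, h t)
        fun hx' => hx (hsub hx')
  · exact hsub.trans fun x hx => ⟨(h3 ha).1.trans_le hx.1, hx.2.trans_lt (h3 hb).2⟩

/-- A function with vanishing weak derivative is constant. -/
lemma IsWeakDeriv.ae_eq_const {ℓ : ℝ} (hℓ : 0 < ℓ) {f : L2 ℓ} (hf : IsWeakDeriv f 0) :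
    ∃ c : ℂ, f =ᵐ[(volume : Measure ℝ).restrict (Ioo 0 ℓ)] fun _ => c := by
  have : IsFiniteMeasure ((volume : Measure ℝ).restrict (Ioo 0 ℓ)) :=
    ⟨by rw [Measure.restrict_apply_univ]; exact measure_Ioo_lt_top⟩
  let ρ : ContDiffBump (ℓ / 2) := ⟨ℓ / 8, ℓ / 4, by linarith, by linarith⟩
  let ψ : ℝ → ℝ := ρ.normed volume
  have p1 : ContDiff ℝ ∞ ψ := ρ.contDiff_normed
  have p2 : HasCompactSupport ψ := ρ.hasCompactSupport_normed
  have p3 : tsupport ψ ⊆ Ioo 0 ℓ := by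
    rw [show tsupport ψ = Metric.closedBall (ℓ / 2) (ℓ / 4) from ρ.tsupport_normed_eq,
      Real.closedBall_eq_Icc]
    intro x hx
    exact ⟨by linarith [hx.1], by linarith [hx.2]⟩
  have p4 : ∫ x, ψ x = 1 := ρ.integral_normed
  set c : ℂ := ∫ x in Ioo 0 ℓ, ψ x • f x with hc
  let k : L2 ℓ := Lp.const 2 ((volume : Measure ℝ).restrict (Ioo 0 ℓ)) c
  have hk : k =ᵐ[(volume : Measure ℝ).restrict (Ioo 0 ℓ)] fun _ => c := Lp.coeFn_const 2 _ c
  refine ⟨c, ?_⟩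
  have key : f - k = 0 := by
    refine L2_eq_zero_of_test _ fun g g1 g2 g3 => ?_
    have i1 : Integrable g := g1.continuous.integrable_of_hasCompactSupport g2
    have i2 : Integrable ψ := p1.continuous.integrable_of_hasCompactSupport p2
    set m : ℝ := ∫ x, g x with hm
    have ts : tsupport (fun x => g x - m * ψ x) ⊆ tsupport g ∪ tsupport ψ := by
      refine closure_minimal (fun x hx => ?_) ((isClosed_tsupport g).union (isClosed_tsupport ψ))
      by_contra hx'
      rw [mem_union, not_or] at hx'
      exact hx (by simp [image_eq_zero_of_notMem_tsupport hx'.1,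
        image_eq_zero_of_notMem_tsupport hx'.2])
    obtain ⟨φ, f1, f2, f3, f4⟩ := exists_test_primitive (ℓ := ℓ) (h := fun x => g x - m * ψ x)
      (g1.sub (contDiff_const.mul p1))
      (HasCompactSupport.intro' (g2.union p2)
        ((isClosed_tsupport g).union (isClosed_tsupport ψ))
        fun x hx => image_eq_zero_of_notMem_tsupport (f := fun x => g x - m * ψ x)
          fun hx' => hx (ts hx'))
      (ts.trans (union_subset g3 p3))
      (by rw [integral_sub i1 (i2.const_mul m), integral_const_mul, p4, mul_one, ← hm, sub_self])
    have e0 := hf φ f1 f2 f3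
    have e1 : ∫ x in Ioo 0 ℓ, φ x • (0 : L2 ℓ) x = 0 := by
      refine integral_eq_zero_of_ae ?_
      filter_upwards [Lp.coeFn_zero ℂ 2 ((volume : Measure ℝ).restrict (Ioo 0 ℓ))] with x hx
      rw [hx]; simp
    rw [e1, f4, neg_zero] at e0
    have e2 : ∫ x in Ioo 0 ℓ, (g x - m * ψ x) • f x
        = (∫ x in Ioo 0 ℓ, g x • f x) - m • c := by
      have e5 := integral_sub (integrable_smul_L2 f g1.continuous g2)
        ((integrable_smul_L2 f p1.continuous p2).smul m)
      simp only [Pi.smul_apply] at e5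
      rw [hc, ← integral_smul, ← e5]
      refine integral_congr_ae (Eventually.of_forall fun x => ?_)
      simp only [sub_smul, mul_smul]
    have e3 : ∫ x in Ioo 0 ℓ, g x • (f - k : L2 ℓ) x
        = (∫ x in Ioo 0 ℓ, g x • f x) - m • c := by
      have e4 : (∫ x in Ioo 0 ℓ, g x • c) = m • c := by
        rw [integral_smul_const, hm]
        congr 1
        refine setIntegral_eq_integral_of_forall_compl_eq_zero fun x hx => ?_
        exact image_eq_zero_of_notMem_tsupport fun hx' => hx (g3 hx')
      rw [← e4, ← integral_sub (integrable_smul_L2 f g1.continuous g2)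
        (i1.integrableOn.smul_const c)]
      refine integral_congr_ae ?_
      filter_upwards [Lp.coeFn_sub f k, hk] with x hx hx'
      rw [hx, Pi.sub_apply, hx', smul_sub]
    rw [e3, ← e2, e0]
  rw [sub_eq_zero] at key
  rw [key]
  exact hk

/-- A function with vanishing weak derivative and a vanishing trace is zero. -/
lemma eq_zero_of_weakDeriv_eq_zero {ℓ x : ℝ} (hℓ : 0 < ℓ) (hx : x ∈ Icc 0 ℓ) {f : L2 ℓ}
    (hf : f ∈ H1 ℓ) (hd : weakDeriv f = 0) (ht : HasTrace f x 0) : f = 0 := by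
  have hw := isWeakDeriv_weakDeriv hf
  rw [hd] at hw
  obtain ⟨c, hc⟩ := hw.ae_eq_const hℓ
  obtain ⟨F, F1, F2, F3⟩ := ht
  have hFc : F =ᵐ[(volume : Measure ℝ).restrict (Ioo 0 ℓ)] fun _ => c := F2.symm.trans hc
  have h1 : EqOn F (fun _ => c) (Ioo 0 ℓ) :=
    Measure.eqOn_open_of_ae_eq hFc isOpen_Ioo (F1.mono Ioo_subset_Icc_self) continuousOn_const
  have h2 : EqOn F (fun _ => c) (Icc 0 ℓ) :=
    h1.of_subset_closure F1 continuousOn_const Ioo_subset_Icc_self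
      (by rw [closure_Ioo hℓ.ne])
  have h3 : c = 0 := by rw [← F3]; exact (h2 hx).symm
  rw [Lp.eq_zero_iff_ae_eq_zero]
  rw [h3] at hc
  exact hc

/-! ### The energy space -/

/-- The (positive) physical constants of the string/beam system. -/
structure StringBeam where
  /-- length of the string -/
  ℓ₁ : ℝ
  /-- length of the beam -/
  ℓ₂ : ℝ
  α₁ : ℝ
  α₂ : ℝ
  β₂ : ℝ
  γ₂ : ℝ
  δ₂ : ℝ
  τ₂ : ℝ
  κ₂ : ℝ
  ℓ₁_pos : 0 < ℓ₁
  ℓ₂_pos : 0 < ℓ₂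
  α₁_pos : 0 < α₁
  α₂_pos : 0 < α₂
  β₂_pos : 0 < β₂
  γ₂_pos : 0 < γ₂
  δ₂_pos : 0 < δ₂
  τ₂_pos : 0 < τ₂
  κ₂_pos : 0 < κ₂

namespace StringBeam

variable (p : StringBeam)

/-- The space `V` of pairs `(f₁,f₂) ∈ H¹(0,ℓ₁) × H²(0,ℓ₂)` with `f₁(ℓ₁) = 0`, `f₂(ℓ₂) = 0`,
`f₁(0) = f₂(0)` and `f₂'(0) = 0`. -/
def V : Submodule ℂ (L2 p.ℓ₁ × L2 p.ℓ₂) where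
  carrier := {f | f.1 ∈ H1 p.ℓ₁ ∧ f.2 ∈ H2 p.ℓ₂ ∧
    HasTrace f.1 p.ℓ₁ 0 ∧ HasTrace f.2 p.ℓ₂ 0 ∧
    (∃ c, HasTrace f.1 0 c ∧ HasTrace f.2 0 c) ∧ HasTrace (weakDeriv f.2) 0 0}
  add_mem' := by
    rintro f g ⟨f1, f2, f3, f4, ⟨c, f5, f6⟩, f7⟩ ⟨g1, g2, g3, g4, ⟨d, g5, g6⟩, g7⟩
    refine ⟨add_mem f1 g1, add_mem f2 g2, by simpa using f3.add g3, by simpa using f4.add g4,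
      ⟨c + d, f5.add g5, f6.add g6⟩, ?_⟩
    rw [Prod.snd_add, weakDeriv_add f2.1 g2.1]
    simpa using f7.add g7
  zero_mem' := ⟨zero_mem _, zero_mem _, HasTrace.zero, HasTrace.zero,
    ⟨0, HasTrace.zero, HasTrace.zero⟩, by rw [Prod.snd_zero, weakDeriv_zero]; exact HasTrace.zero⟩
  smul_mem' := by
    rintro a f ⟨f1, f2, f3, f4, ⟨c, f5, f6⟩, f7⟩
    refine ⟨Submodule.smul_mem _ a f1, Submodule.smul_mem _ a f2, by simpa using f3.smul a,
      by simpa using f4.smul a, ⟨a * c, f5.smul a, f6.smul a⟩, ?_⟩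
    rw [Prod.smul_snd, weakDeriv_smul a f2.1]
    simpa using f7.smul a

/-- The energy space `V × (L²(0,ℓ₁) × L²(0,ℓ₂)) × L²(0,ℓ₂) × L²(0,ℓ₂)` of the states
`(u, v, θ₂, q₂)`, with the energy inner product below. -/
def EnergySpace : Type := p.V × (L2 p.ℓ₁ × L2 p.ℓ₂) × L2 p.ℓ₂ × L2 p.ℓ₂

instance : AddCommGroup p.EnergySpace :=
  inferInstanceAs (AddCommGroup (p.V × (L2 p.ℓ₁ × L2 p.ℓ₂) × L2 p.ℓ₂ × L2 p.ℓ₂))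

instance : Module ℂ p.EnergySpace :=
  inferInstanceAs (Module ℂ (p.V × (L2 p.ℓ₁ × L2 p.ℓ₂) × L2 p.ℓ₂ × L2 p.ℓ₂))

namespace EnergySpace

variable {p}

/-- displacement of the string -/
def u₁ (y : p.EnergySpace) : L2 p.ℓ₁ := (Prod.fst y).1.1
/-- displacement of the beam -/
def u₂ (y : p.EnergySpace) : L2 p.ℓ₂ := (Prod.fst y).1.2
/-- velocity of the string -/
def v₁ (y : p.EnergySpace) : L2 p.ℓ₁ := (Prod.snd y).1.1
/-- velocity of the beam -/
def v₂ (y : p.EnergySpace) : L2 p.ℓ₂ := (Prod.snd y).1.2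
/-- temperature difference in the beam -/
def θ₂ (y : p.EnergySpace) : L2 p.ℓ₂ := (Prod.snd y).2.1
/-- heat flux in the beam -/
def q₂ (y : p.EnergySpace) : L2 p.ℓ₂ := (Prod.snd y).2.2

lemma mem_V (y : p.EnergySpace) : (y.u₁, y.u₂) ∈ p.V := (Prod.fst y).2
lemma u₁_mem (y : p.EnergySpace) : y.u₁ ∈ H1 p.ℓ₁ := y.mem_V.1
lemma u₂_mem (y : p.EnergySpace) : y.u₂ ∈ H2 p.ℓ₂ := y.mem_V.2.1

@[simp] lemma u₁_add (y z : p.EnergySpace) : (y + z).u₁ = y.u₁ + z.u₁ := rfl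
@[simp] lemma u₂_add (y z : p.EnergySpace) : (y + z).u₂ = y.u₂ + z.u₂ := rfl
@[simp] lemma v₁_add (y z : p.EnergySpace) : (y + z).v₁ = y.v₁ + z.v₁ := rfl
@[simp] lemma v₂_add (y z : p.EnergySpace) : (y + z).v₂ = y.v₂ + z.v₂ := rfl
@[simp] lemma θ₂_add (y z : p.EnergySpace) : (y + z).θ₂ = y.θ₂ + z.θ₂ := rfl
@[simp] lemma q₂_add (y z : p.EnergySpace) : (y + z).q₂ = y.q₂ + z.q₂ := rfl
@[simp] lemma u₁_smul (a : ℂ) (y : p.EnergySpace) : (a • y).u₁ = a • y.u₁ := rfl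
@[simp] lemma u₂_smul (a : ℂ) (y : p.EnergySpace) : (a • y).u₂ = a • y.u₂ := rfl
@[simp] lemma v₁_smul (a : ℂ) (y : p.EnergySpace) : (a • y).v₁ = a • y.v₁ := rfl
@[simp] lemma v₂_smul (a : ℂ) (y : p.EnergySpace) : (a • y).v₂ = a • y.v₂ := rfl
@[simp] lemma θ₂_smul (a : ℂ) (y : p.EnergySpace) : (a • y).θ₂ = a • y.θ₂ := rfl
@[simp] lemma q₂_smul (a : ℂ) (y : p.EnergySpace) : (a • y).q₂ = a • y.q₂ := rfl
@[simp] lemma u₁_zero : (0 : p.EnergySpace).u₁ = 0 := rfl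
@[simp] lemma u₂_zero : (0 : p.EnergySpace).u₂ = 0 := rfl
@[simp] lemma v₁_zero : (0 : p.EnergySpace).v₁ = 0 := rfl
@[simp] lemma v₂_zero : (0 : p.EnergySpace).v₂ = 0 := rfl
@[simp] lemma θ₂_zero : (0 : p.EnergySpace).θ₂ = 0 := rfl
@[simp] lemma q₂_zero : (0 : p.EnergySpace).q₂ = 0 := rfl

lemma ext_components {y z : p.EnergySpace} (h1 : y.u₁ = z.u₁) (h2 : y.u₂ = z.u₂)
    (h3 : y.v₁ = z.v₁) (h4 : y.v₂ = z.v₂) (h5 : y.θ₂ = z.θ₂) (h6 : y.q₂ = z.q₂) : y = z :=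
  Prod.ext (Subtype.ext (Prod.ext h1 h2)) (Prod.ext (Prod.ext h3 h4) (Prod.ext h5 h6))

end EnergySpace

/-- The energy inner product on the energy space; the square of its norm is
`α₁‖u₁'‖² + ‖v₁‖² + (δ₂/β₂)(α₂‖u₂''‖² + ‖v₂‖²) + ‖θ₂‖² + (γ₂τ₂/κ₂)‖q₂‖²`. -/
def energyInner (y z : p.EnergySpace) : ℂ :=
  (p.α₁ : ℂ) * inner ℂ (weakDeriv y.u₁) (weakDeriv z.u₁) + inner ℂ y.v₁ z.v₁ +
  ((p.δ₂ / p.β₂ : ℝ) : ℂ) *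
    ((p.α₂ : ℂ) * inner ℂ (weakDeriv2 y.u₂) (weakDeriv2 z.u₂) + inner ℂ y.v₂ z.v₂) +
  inner ℂ y.θ₂ z.θ₂ + ((p.γ₂ * p.τ₂ / p.κ₂ : ℝ) : ℂ) * inner ℂ y.q₂ z.q₂

lemma re_energyInner_self (y : p.EnergySpace) :
    (p.energyInner y y).re = p.α₁ * ‖weakDeriv y.u₁‖ ^ 2 + ‖y.v₁‖ ^ 2 +
      p.δ₂ / p.β₂ * (p.α₂ * ‖weakDeriv2 y.u₂‖ ^ 2 + ‖y.v₂‖ ^ 2) + ‖y.θ₂‖ ^ 2 +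
      p.γ₂ * p.τ₂ / p.κ₂ * ‖y.q₂‖ ^ 2 := by
  have h {ℓ : ℝ} (f : L2 ℓ) : (inner ℂ f f).re = ‖f‖ ^ 2 :=
    (norm_sq_eq_re_inner (𝕜 := ℂ) f).symm
  simp only [energyInner, Complex.add_re, Complex.re_ofReal_mul, h]

/-- The energy inner product is positive definite. -/
instance energyCore : InnerProductSpace.Core ℂ p.EnergySpace where
  inner := p.energyInner
  conj_inner_symm y z := by
    show (starRingEnd ℂ) (p.energyInner z y) = p.energyInner y z
    simp only [energyInner, map_add, map_mul, Complex.conj_ofReal, inner_conj_symm]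
  re_inner_nonneg y := by
    show 0 ≤ (p.energyInner y y).re
    have := p.α₁_pos; have := p.α₂_pos; have := p.β₂_pos; have := p.γ₂_pos
    have := p.δ₂_pos; have := p.τ₂_pos; have := p.κ₂_pos
    rw [re_energyInner_self]
    positivity
  add_left x y z := by
    show p.energyInner (x + y) z = p.energyInner x z + p.energyInner y z
    simp only [energyInner, EnergySpace.u₁_add, EnergySpace.u₂_add, EnergySpace.v₁_add,
      EnergySpace.v₂_add, EnergySpace.θ₂_add, EnergySpace.q₂_add,
      weakDeriv_add x.u₁_mem y.u₁_mem, weakDeriv2_add x.u₂_mem y.u₂_mem, inner_add_left]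
    ring
  smul_left x y a := by
    show p.energyInner (a • x) y = (starRingEnd ℂ) a * p.energyInner x y
    simp only [energyInner, EnergySpace.u₁_smul, EnergySpace.u₂_smul, EnergySpace.v₁_smul,
      EnergySpace.v₂_smul, EnergySpace.θ₂_smul, EnergySpace.q₂_smul,
      weakDeriv_smul a x.u₁_mem, weakDeriv2_smul a x.u₂_mem, inner_smul_left]
    ring
  definite y h := by
    have h' : (p.energyInner y y).re = 0 := by
      have : p.energyInner y y = 0 := h
      rw [this, Complex.zero_re]
    have a1 := p.α₁_pos; have a2 := p.α₂_pos; have hb := p.β₂_pos; have hg := p.γ₂_pos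
    have hd := p.δ₂_pos; have ht := p.τ₂_pos; have hk := p.κ₂_pos
    rw [re_energyInner_self] at h'
    have t1 : 0 ≤ p.α₁ * ‖weakDeriv y.u₁‖ ^ 2 := by positivity
    have t2 : 0 ≤ ‖y.v₁‖ ^ 2 := by positivity
    have t3 : 0 ≤ p.δ₂ / p.β₂ * (p.α₂ * ‖weakDeriv2 y.u₂‖ ^ 2 + ‖y.v₂‖ ^ 2) := by positivity
    have t4 : 0 ≤ ‖y.θ₂‖ ^ 2 := by positivity
    have t5 : 0 ≤ p.γ₂ * p.τ₂ / p.κ₂ * ‖y.q₂‖ ^ 2 := by positivity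
    have z1 : p.α₁ * ‖weakDeriv y.u₁‖ ^ 2 = 0 := by linarith
    have z2 : ‖y.v₁‖ ^ 2 = 0 := by linarith
    have z3 : p.δ₂ / p.β₂ * (p.α₂ * ‖weakDeriv2 y.u₂‖ ^ 2 + ‖y.v₂‖ ^ 2) = 0 := by linarith
    have z4 : ‖y.θ₂‖ ^ 2 = 0 := by linarith
    have z5 : p.γ₂ * p.τ₂ / p.κ₂ * ‖y.q₂‖ ^ 2 = 0 := by linarith
    have z6 : p.α₂ * ‖weakDeriv2 y.u₂‖ ^ 2 + ‖y.v₂‖ ^ 2 = 0 :=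
      (mul_eq_zero.1 z3).resolve_left (div_pos hd hb).ne'
    have t6 : 0 ≤ p.α₂ * ‖weakDeriv2 y.u₂‖ ^ 2 := by positivity
    have t7 : 0 ≤ ‖y.v₂‖ ^ 2 := by positivity
    have z7 : p.α₂ * ‖weakDeriv2 y.u₂‖ ^ 2 = 0 := by linarith
    have z8 : ‖y.v₂‖ ^ 2 = 0 := by linarith
    have w1 : weakDeriv y.u₁ = 0 := by simpa [a1.ne'] using z1
    have w2 : weakDeriv2 y.u₂ = 0 := by simpa [a2.ne'] using z7
    obtain ⟨m1, m2, m3, m4, -, m6⟩ := y.mem_V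
    have w3 : weakDeriv y.u₂ = 0 :=
      eq_zero_of_weakDeriv_eq_zero p.ℓ₂_pos ⟨le_rfl, p.ℓ₂_pos.le⟩ m2.2 w2 m6
    refine EnergySpace.ext_components ?_ ?_ (by simpa using z2) (by simpa using z8)
      (by simpa using z4) (by simpa [hg.ne', ht.ne', hk.ne'] using z5)
    · exact eq_zero_of_weakDeriv_eq_zero p.ℓ₁_pos ⟨p.ℓ₁_pos.le, le_rfl⟩ m1 w1 m3
    · exact eq_zero_of_weakDeriv_eq_zero p.ℓ₂_pos ⟨p.ℓ₂_pos.le, le_rfl⟩ m2.1 w3 m4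

instance : NormedAddCommGroup p.EnergySpace :=
  InnerProductSpace.Core.toNormedAddCommGroup (𝕜 := ℂ)

instance : InnerProductSpace ℂ p.EnergySpace :=
  InnerProductSpace.ofCore p.energyCore.toCore

/-! ### The operator of the system -/

/-- The bending moment with thermal part, with the sign `-α₂u₂'' + β₂θ₂`. -/
def moment (y : p.EnergySpace) : L2 p.ℓ₂ :=
  (-(p.α₂ : ℂ)) • weakDeriv2 y.u₂ + (p.β₂ : ℂ) • y.θ₂

lemma moment_add (y z : p.EnergySpace) : p.moment (y + z) = p.moment y + p.moment z := by
  simp only [moment, EnergySpace.u₂_add, EnergySpace.θ₂_add, weakDeriv2_add y.u₂_mem z.u₂_mem,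
    smul_add]
  abel

lemma moment_smul (a : ℂ) (y : p.EnergySpace) : p.moment (a • y) = a • p.moment y := by
  simp only [moment, EnergySpace.u₂_smul, EnergySpace.θ₂_smul, weakDeriv2_smul a y.u₂_mem,
    smul_add]
  rw [smul_comm a, smul_comm a]

lemma moment_zero : p.moment 0 = 0 := by
  simp [moment, weakDeriv2_zero]

/-- The domain: `v ∈ V`, `u₁ ∈ H²(0,ℓ₁)`, `θ₂ ∈ H¹₀(0,ℓ₂)`, `q₂ ∈ H¹(0,ℓ₂)`,
`-α₂u₂'' + β₂θ₂ ∈ H²(0,ℓ₂)`, `u₂''(ℓ₂) = 0` and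
`(δ₂/β₂)(α₂u₂'' - β₂θ₂)'(0) = α₁u₁'(0)`. -/
def domain : Submodule ℂ p.EnergySpace where
  carrier := {y | (y.v₁, y.v₂) ∈ p.V ∧ y.u₁ ∈ H2 p.ℓ₁ ∧
    (y.θ₂ ∈ H1 p.ℓ₂ ∧ HasTrace y.θ₂ 0 0 ∧ HasTrace y.θ₂ p.ℓ₂ 0) ∧
    y.q₂ ∈ H1 p.ℓ₂ ∧ p.moment y ∈ H2 p.ℓ₂ ∧
    HasTrace (weakDeriv2 y.u₂) p.ℓ₂ 0 ∧
    ∃ c d : ℂ, HasTrace (weakDeriv (p.moment y)) 0 (-c) ∧ HasTrace (weakDeriv y.u₁) 0 d ∧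
      ((p.δ₂ / p.β₂ : ℝ) : ℂ) * c = (p.α₁ : ℂ) * d}
  add_mem' := by
    rintro y z ⟨y1, y2, ⟨y3, y4, y5⟩, y6, y7, y8, c, d, y9, y10, y11⟩
      ⟨z1, z2, ⟨z3, z4, z5⟩, z6, z7, z8, c', d', z9, z10, z11⟩
    refine ⟨add_mem y1 z1, add_mem y2 z2, ⟨add_mem y3 z3, by simpa using y4.add z4,
      by simpa using y5.add z5⟩, add_mem y6 z6, by rw [moment_add]; exact add_mem y7 z7, ?_,
      c + c', d + d', ?_, ?_, ?_⟩
    · rw [EnergySpace.u₂_add, weakDeriv2_add y.u₂_mem z.u₂_mem]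
      simpa using y8.add z8
    · rw [moment_add, weakDeriv_add y7.1 z7.1, neg_add]
      exact y9.add z9
    · rw [EnergySpace.u₁_add, weakDeriv_add y2.1 z2.1]
      exact y10.add z10
    · rw [mul_add, mul_add, y11, z11]
  zero_mem' := by
    refine ⟨zero_mem p.V, zero_mem _, ⟨zero_mem _, HasTrace.zero, HasTrace.zero⟩, zero_mem _,
      by rw [moment_zero]; exact zero_mem _, ?_, 0, 0, ?_, ?_, by simp⟩
    · rw [EnergySpace.u₂_zero, weakDeriv2_zero]; exact HasTrace.zero
    · rw [moment_zero, weakDeriv_zero, neg_zero]; exact HasTrace.zero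
    · rw [EnergySpace.u₁_zero, weakDeriv_zero]; exact HasTrace.zero
  smul_mem' := by
    rintro a y ⟨y1, y2, ⟨y3, y4, y5⟩, y6, y7, y8, c, d, y9, y10, y11⟩
    refine ⟨Submodule.smul_mem _ a y1, Submodule.smul_mem _ a y2, ⟨Submodule.smul_mem _ a y3,
      by simpa using y4.smul a, by simpa using y5.smul a⟩, Submodule.smul_mem _ a y6,
      by rw [moment_smul]; exact Submodule.smul_mem _ a y7, ?_, a * c, a * d, ?_, ?_, ?_⟩
    · rw [EnergySpace.u₂_smul, weakDeriv2_smul a y.u₂_mem]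
      simpa using y8.smul a
    · rw [moment_smul, weakDeriv_smul a y7.1, ← mul_neg]
      exact y9.smul a
    · rw [EnergySpace.u₁_smul, weakDeriv_smul a y2.1]
      exact y10.smul a
    · rw [mul_left_comm, y11, mul_left_comm]

/-- The value `A₂ y` for `y` in the domain; see `A₂`. -/
def applyA₂ (y : p.domain) : p.EnergySpace :=
  (⟨(y.1.v₁, y.1.v₂), y.2.1⟩,
    ((p.α₁ : ℂ) • weakDeriv2 y.1.u₁, weakDeriv2 (p.moment y.1)),
    (-(p.δ₂ : ℂ)) • weakDeriv2 y.1.v₂ - (p.γ₂ : ℂ) • weakDeriv y.1.q₂,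
    (-((1 / p.τ₂ : ℝ) : ℂ)) • y.1.q₂ - ((p.κ₂ / p.τ₂ : ℝ) : ℂ) • weakDeriv y.1.θ₂)

lemma applyA₂_u₁ (y : p.domain) : (p.applyA₂ y).u₁ = y.1.v₁ := rfl
lemma applyA₂_u₂ (y : p.domain) : (p.applyA₂ y).u₂ = y.1.v₂ := rfl
lemma applyA₂_v₁ (y : p.domain) : (p.applyA₂ y).v₁ = (p.α₁ : ℂ) • weakDeriv2 y.1.u₁ := rfl
lemma applyA₂_v₂ (y : p.domain) : (p.applyA₂ y).v₂ = weakDeriv2 (p.moment y.1) := rfl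
lemma applyA₂_θ₂ (y : p.domain) : (p.applyA₂ y).θ₂ =
    (-(p.δ₂ : ℂ)) • weakDeriv2 y.1.v₂ - (p.γ₂ : ℂ) • weakDeriv y.1.q₂ := rfl
lemma applyA₂_q₂ (y : p.domain) : (p.applyA₂ y).q₂ =
    (-((1 / p.τ₂ : ℝ) : ℂ)) • y.1.q₂ - ((p.κ₂ / p.τ₂ : ℝ) : ℂ) • weakDeriv y.1.θ₂ := rfl

lemma applyA₂_add (y z : p.domain) : p.applyA₂ (y + z) = p.applyA₂ y + p.applyA₂ z := by
  obtain ⟨y, y1, y2, ⟨y3, y4, y5⟩, y6, y7, y8⟩ := y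
  obtain ⟨z, z1, z2, ⟨z3, z4, z5⟩, z6, z7, z8⟩ := z
  apply EnergySpace.ext_components
  · simp only [applyA₂_u₁, EnergySpace.u₁_add, Submodule.coe_add, EnergySpace.v₁_add]
  · simp only [applyA₂_u₂, EnergySpace.u₂_add, Submodule.coe_add, EnergySpace.v₂_add]
  · simp only [applyA₂_v₁, EnergySpace.u₁_add, Submodule.coe_add, EnergySpace.v₁_add,
      weakDeriv2_add y2 z2, smul_add]
  · simp only [applyA₂_v₂, Submodule.coe_add, EnergySpace.v₂_add, moment_add,
      weakDeriv2_add y7 z7]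
  · simp only [applyA₂_θ₂, Submodule.coe_add, EnergySpace.v₂_add, EnergySpace.θ₂_add,
      EnergySpace.q₂_add, weakDeriv2_add y1.2.1 z1.2.1, weakDeriv_add y6 z6, smul_add]
    abel
  · simp only [applyA₂_q₂, Submodule.coe_add, EnergySpace.θ₂_add,
      EnergySpace.q₂_add, weakDeriv_add y3 z3, smul_add]
    abel

lemma applyA₂_smul (a : ℂ) (y : p.domain) : p.applyA₂ (a • y) = a • p.applyA₂ y := by
  obtain ⟨y, y1, y2, ⟨y3, y4, y5⟩, y6, y7, y8⟩ := y
  apply EnergySpace.ext_components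
  · simp only [applyA₂_u₁, EnergySpace.u₁_smul, Submodule.coe_smul, EnergySpace.v₁_smul]
  · simp only [applyA₂_u₂, EnergySpace.u₂_smul, Submodule.coe_smul, EnergySpace.v₂_smul]
  · simp only [applyA₂_v₁, EnergySpace.u₁_smul, Submodule.coe_smul, EnergySpace.v₁_smul,
      weakDeriv2_smul a y2, smul_comm a]
  · simp only [applyA₂_v₂, Submodule.coe_smul, EnergySpace.v₂_smul, moment_smul,
      weakDeriv2_smul a y7]
  · simp only [applyA₂_θ₂, Submodule.coe_smul, EnergySpace.v₂_smul, EnergySpace.θ₂_smul,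
      EnergySpace.q₂_smul, weakDeriv2_smul a y1.2.1, weakDeriv_smul a y6, smul_sub, smul_comm a]
  · simp only [applyA₂_q₂, Submodule.coe_smul, EnergySpace.θ₂_smul,
      EnergySpace.q₂_smul, weakDeriv_smul a y3, smul_sub, smul_comm a]

/-- The operator
`A₂(u₁,u₂,v₁,v₂,θ₂,q₂) = (v₁, v₂, α₁u₁'', (-α₂u₂'' + β₂θ₂)'', -δ₂v₂'' - γ₂q₂',
-(1/τ₂)q₂ - (κ₂/τ₂)θ₂')`. -/
def A₂ : p.EnergySpace →ₗ.[ℂ] p.EnergySpace where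
  domain := p.domain
  toFun :=
    { toFun := p.applyA₂
      map_add' := p.applyA₂_add
      map_smul' := p.applyA₂_smul }

end StringBeam

/-! ### Semigroups and resolvents -/

section Abstract

variable {X : Type*} [NormedAddCommGroup X] [NormedSpace ℂ X]

/-- A `C₀`-semigroup of bounded linear operators on `X`. -/
structure C0Semigroup (X : Type*) [NormedAddCommGroup X] [NormedSpace ℂ X] where
  toFun : ℝ≥0 → X →L[ℂ] X
  map_zero : toFun 0 = ContinuousLinearMap.id ℂ X
  map_add : ∀ s t, toFun (s + t) = (toFun s).comp (toFun t)
  continuous_orbit : ∀ x, Continuous fun t => toFun t x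

/-- `A` is the infinitesimal generator of `S`: `x ∈ D(A)` and `A x = y` if and only if
`(S(t)x - x)/t → y` as `t → 0⁺`. -/
def C0Semigroup.IsGeneratedBy (S : C0Semigroup X) (A : X →ₗ.[ℂ] X) : Prop :=
  ∀ x y : X, (∃ hx : x ∈ A.domain, A ⟨x, hx⟩ = y) ↔
    Tendsto (fun t : ℝ≥0 => ((t : ℝ)⁻¹ : ℂ) • (S.toFun t x - x)) (𝓝[>] 0) (𝓝 y)

/-- Exponential stability of a `C₀`-semigroup. -/
def C0Semigroup.IsExponentiallyStable (S : C0Semigroup X) : Prop :=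
  ∃ M a : ℝ, 0 < M ∧ 0 < a ∧ ∀ (t : ℝ≥0) (x : X),
    ‖S.toFun t x‖ ≤ M * Real.exp (-a * t) * ‖x‖

/-- The bounded operator `R` is the (two-sided) inverse of `z - A : D(A) → X`. -/
def IsResolventAt (A : X →ₗ.[ℂ] X) (z : ℂ) (R : X →L[ℂ] X) : Prop :=
  (∀ x : X, ∃ hx : R x ∈ A.domain, z • R x - A ⟨R x, hx⟩ = x) ∧
  ∀ x : A.domain, R (z • (x : X) - A x) = x

/-- The resolvent set `ρ(A)`. -/
def resolventSetOf (A : X →ₗ.[ℂ] X) : Set ℂ := {z | ∃ R, IsResolventAt A z R}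

open Classical in
/-- The resolvent `(z - A)⁻¹` for `z ∈ ρ(A)` (and `0` otherwise). -/
def resolventOf (A : X →ₗ.[ℂ] X) (z : ℂ) : X →L[ℂ] X :=
  if h : ∃ R, IsResolventAt A z R then h.choose else 0

end Abstract

end

/-!
The three assertions rest on dissipativity, on an a priori estimate at each point of the imaginary
axis, and on approximate eigenvectors at high frequency.

*Generation.* Half the squared norm decreases at the rate `(γ₂/κ₂)‖q₂‖²` (`re_inner_A₂`), so `A₂` is
dissipative. The equation `A₂ y = f` is solved by successive integrations (`exists_A₂_eq`), hence
`0` is in the resolvent set, and the Lumer–Phillips theorem in Hilbert space applies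
(`exists_semigroup_of_dissipative`, proved here through Yosida approximations).

*The imaginary axis.* For a dissipative operator, `ir` is in the resolvent set as soon as `ir - A₂`
is bounded below (`exists_isResolventAt_imaginary`). If it were not, there would be bounded
approximate solutions that do not tend to zero. But dissipation forces `q₂ → 0`, Cattaneo's law
forces `θ₂ → 0`, the temperature equation, combined with an integration by parts, forces
`u₂'' → 0`, and then the string has vanishing Cauchy data at the junction, so that the multiplier
`(ℓ₁ - x) u₁'` forces `u₁' → 0` (`tendsto_zero_of_residual`).

*Growth of the resolvent.* At frequency `λ = √a (k² + c)` with `a = α₂ + β₂δ₂`, the spatial modes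
`exp(ζx)` of the beam have, up to sign, the roots `ζ ≈ ik`, `ζ ≈ k + c/k` and a third root of
order `k²` with bounded real part, which belongs to the temperature waves. The three amplitudes
are adjusted so that `u₂'` and `θ₂` vanish at the junction. There the beam has displacement of
order at most `k`, but its shear force, of order `k⁴`, has to be balanced by the slope of the
string. A sinusoidal string can take up these Cauchy data if and only if one scalar equation
holds. Since the phase of the string moves through many periods while `kℓ₂` changes by a fixed
amount, the leading part of this equation has arbitrarily large solutions `k`
(`frequently_tuned`), and what is left is absorbed by a small residual in the wave equation. The
string then carries an energy of order at least `k⁸`, while the residual has norm `O(k²)`. As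
`λ` is of order `k²`, this gives `‖(iλ - A₂) y‖ ≤ (C/λ) ‖y‖` with `y ≠ 0` along a sequence
`λ → ∞` (`exists_quasimode`). The resolvent therefore grows at least linearly along this sequence,
whereas exponential stability would bound `‖y‖` by a fixed multiple of `‖(iλ - A₂) y‖`
(`exists_bound_of_isExponentiallyStable`).
-/

noncomputable section

/-! ### Calculus in `H¹(0,ℓ)` -/

/-- The class in `L²(0,ℓ)` of a continuous function on the line. -/
def ofCont {ℓ : ℝ} (F : ℝ → ℂ) (hF : Continuous F) : L2 ℓ :=
  MemLp.toLp F (p := 2) (μ := (volume : Measure ℝ).restrict (Ioo 0 ℓ)) (by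
    obtain ⟨C, hC⟩ := (isCompact_Icc (a := (0 : ℝ)) (b := ℓ)).exists_bound_of_continuousOn
      hF.continuousOn
    refine MemLp.of_bound hF.aestronglyMeasurable C ?_
    filter_upwards [ae_restrict_mem measurableSet_Ioo] with x hx
    exact hC x (Ioo_subset_Icc_self hx))

lemma coeFn_ofCont {ℓ : ℝ} (F : ℝ → ℂ) (hF : Continuous F) :
    (ofCont F hF : L2 ℓ) =ᵐ[(volume : Measure ℝ).restrict (Ioo 0 ℓ)] F :=
  MemLp.coeFn_toLp _

lemma eq_ofCont {ℓ : ℝ} {f : L2 ℓ} {F : ℝ → ℂ} (hF : Continuous F)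
    (h : f =ᵐ[(volume : Measure ℝ).restrict (Ioo 0 ℓ)] F) : f = ofCont F hF :=
  Lp.ext (h.trans (coeFn_ofCont F hF).symm)

lemma ofCont_add {ℓ : ℝ} {F G : ℝ → ℂ} (hF : Continuous F) (hG : Continuous G) :
    (ofCont F hF : L2 ℓ) + ofCont G hG = ofCont (fun x => F x + G x) (hF.add hG) :=
  rfl

lemma ofCont_smul {ℓ : ℝ} {F : ℝ → ℂ} (hF : Continuous F) (c : ℂ) :
    c • (ofCont F hF : L2 ℓ) = ofCont (fun x => c * F x) (continuous_const.mul hF) :=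
  rfl

/-- Identities between continuous expressions on `L²(0,ℓ)` need only be checked on continuous
functions. -/
lemma dense_ofCont {ℓ : ℝ} :
    DenseRange (fun F : {F : ℝ → ℂ // Continuous F} => (ofCont F.1 F.2 : L2 ℓ)) := by
  refine (BoundedContinuousFunction.toLp_denseRange (E := ℂ) (p := 2)
    ((volume : Measure ℝ).restrict (Ioo 0 ℓ)) ℂ (by norm_num)).mono ?_
  rintro _ ⟨F, rfl⟩
  exact ⟨⟨F, F.continuous⟩, rfl⟩

lemma norm_ofCont_le {ℓ : ℝ} {F : ℝ → ℂ} (hF : Continuous F) {C : ℝ} (hC : 0 ≤ C)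
    (h : ∀ x ∈ Icc 0 ℓ, ‖F x‖ ≤ C) : ‖(ofCont F hF : L2 ℓ)‖ ≤ √ℓ * C := by
  have := Lp.norm_le_of_ae_bound (f := (ofCont F hF : L2 ℓ)) hC (by
    filter_upwards [ae_restrict_mem measurableSet_Ioo, coeFn_ofCont (ℓ := ℓ) F hF] with x hx hx'
    rw [hx']
    exact h x (Ioo_subset_Icc_self hx))
  have e : √ℓ = √(max ℓ 0) := by
    rcases le_total 0 ℓ with h | h
    · rw [max_eq_left h]
    · rw [max_eq_right h, Real.sqrt_zero, Real.sqrt_eq_zero_of_nonpos h]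
  simpa [measureUnivNNReal, NNReal.coe_rpow, e, Real.sqrt_eq_rpow, Real.coe_toNNReal',
    ENNReal.ofReal] using this

lemma inner_ofCont {ℓ : ℝ} (hℓ : 0 ≤ ℓ) {F G : ℝ → ℂ} (hF : Continuous F) (hG : Continuous G) :
    inner ℂ (ofCont F hF : L2 ℓ) (ofCont G hG) = ∫ x in (0)..ℓ, star (F x) * G x := by
  rw [L2.inner_def, intervalIntegral.integral_of_le hℓ, integral_Ioc_eq_integral_Ioo]
  refine integral_congr_ae ?_
  filter_upwards [coeFn_ofCont (ℓ := ℓ) F hF, coeFn_ofCont (ℓ := ℓ) G hG] with x h1 h2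
  rw [h1, h2, mul_comm]
  rfl

/-- The constant function with value `c`. -/
def cst {ℓ : ℝ} (c : ℂ) : L2 ℓ := ofCont (fun _ => c) continuous_const

lemma cst_eq_smul {ℓ : ℝ} (c : ℂ) : (cst c : L2 ℓ) = c • cst 1 := by
  simp [cst, ofCont_smul]

lemma cst_add {ℓ : ℝ} (c d : ℂ) : (cst (c + d) : L2 ℓ) = cst c + cst d := rfl

lemma norm_cst {ℓ : ℝ} (hℓ : 0 ≤ ℓ) (c : ℂ) : ‖(cst c : L2 ℓ)‖ = √ℓ * ‖c‖ := by
  have h : ‖(cst c : L2 ℓ)‖ ^ 2 = (√ℓ * ‖c‖) ^ 2 := by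
    rw [@norm_sq_eq_re_inner ℂ, cst, inner_ofCont hℓ, mul_pow, Real.sq_sqrt hℓ]
    have : star c * c = ((‖c‖ ^ 2 : ℝ) : ℂ) := by
      rw [Complex.star_def, Complex.conj_mul']; norm_cast
    simp only [this]
    rw [intervalIntegral.integral_const]
    simp only [sub_zero, RCLike.re_to_complex, Complex.real_smul, ← Complex.ofReal_mul,
      Complex.ofReal_re]
  exact (pow_left_inj₀ (norm_nonneg _) (by positivity) two_ne_zero).1 h

/-- The primitive of `g ∈ L²(0,ℓ)` that vanishes at `0`, as a function on the line. -/
def prim {ℓ : ℝ} (g : L2 ℓ) (x : ℝ) : ℂ := ∫ t in (0)..x, (Ioo 0 ℓ).indicator g t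

lemma integrable_indicator_L2 {ℓ : ℝ} (g : L2 ℓ) : Integrable ((Ioo 0 ℓ).indicator g) :=
  (integrable_indicator_iff measurableSet_Ioo).2 ((Lp.memLp g).integrable (by norm_num))

lemma continuous_prim {ℓ : ℝ} (g : L2 ℓ) : Continuous (prim g) :=
  intervalIntegral.continuous_primitive
    (fun _ _ => (integrable_indicator_L2 g).intervalIntegrable) 0

lemma prim_zero {ℓ : ℝ} (g : L2 ℓ) : prim g 0 = 0 := intervalIntegral.integral_same

lemma prim_add {ℓ : ℝ} (g h : L2 ℓ) (x : ℝ) : prim (g + h) x = prim g x + prim h x := by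
  rw [prim, prim, prim, ← intervalIntegral.integral_add
    (integrable_indicator_L2 g).intervalIntegrable (integrable_indicator_L2 h).intervalIntegrable]
  refine intervalIntegral.integral_congr_ae ?_
  filter_upwards [(ae_restrict_iff' measurableSet_Ioo).1 (Lp.coeFn_add g h)] with t ht _
  by_cases htm : t ∈ Ioo 0 ℓ
  · simp only [indicator_of_mem htm, ht htm, Pi.add_apply]
  · simp [htm]

lemma prim_smul {ℓ : ℝ} (c : ℂ) (g : L2 ℓ) (x : ℝ) : prim (c • g) x = c * prim g x := by
  rw [prim, prim, ← intervalIntegral.integral_const_mul]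
  refine intervalIntegral.integral_congr_ae ?_
  filter_upwards [(ae_restrict_iff' measurableSet_Ioo).1 (Lp.coeFn_smul c g)] with t ht _
  by_cases htm : t ∈ Ioo 0 ℓ
  · simp [htm, ht htm]
  · simp [htm]

lemma prim_length {ℓ : ℝ} (hℓ : 0 ≤ ℓ) (g : L2 ℓ) : prim g ℓ = inner ℂ (cst 1) g := by
  rw [prim, intervalIntegral.integral_of_le hℓ, integral_Ioc_eq_integral_Ioo,
    setIntegral_indicator measurableSet_Ioo, inter_self, L2.inner_def]
  refine integral_congr_ae ?_
  filter_upwards [coeFn_ofCont (ℓ := ℓ) (fun _ => 1) continuous_const] with x h1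
  simp [cst, h1]

lemma norm_prim_le {ℓ x : ℝ} (hx : x ∈ Icc 0 ℓ) (g : L2 ℓ) : ‖prim g x‖ ≤ √ℓ * ‖g‖ := by
  have h0 : 0 ≤ ℓ := hx.1.trans hx.2
  have hi := (integrable_indicator_L2 g).norm
  calc ‖prim g x‖ ≤ ∫ t in (0)..x, ‖(Ioo 0 ℓ).indicator g t‖ :=
        intervalIntegral.norm_integral_le_integral_norm hx.1
    _ ≤ ∫ t in (0)..ℓ, ‖(Ioo 0 ℓ).indicator g t‖ :=
        intervalIntegral.integral_mono_interval le_rfl hx.1 hx.2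
          (Eventually.of_forall fun t => norm_nonneg _) hi.intervalIntegrable
    _ = ∫ t in Ioo 0 ℓ, ‖g t‖ := by
        rw [intervalIntegral.integral_of_le h0, integral_Ioc_eq_integral_Ioo]
        refine setIntegral_congr_fun measurableSet_Ioo fun t ht => ?_
        simp only [indicator_of_mem ht]
    _ ≤ √ℓ * ‖g‖ := by
        have hm : MemLp (fun t => ‖g t‖) 2 ((volume : Measure ℝ).restrict (Ioo 0 ℓ)) :=
          (Lp.memLp g).norm
        have e : ∫ t in Ioo 0 ℓ, ‖g t‖ = ∫ t in Ioo 0 ℓ, ‖g t‖ * 1 := by simp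
        rw [e]
        refine (integral_mul_le_Lp_mul_Lq_of_nonneg (p := 2) (q := 2) Real.HolderConjugate.two_two
          (Eventually.of_forall fun t => norm_nonneg _) (Eventually.of_forall fun t => zero_le_one)
          (by simpa using hm) (by simpa using memLp_const (1 : ℝ))).trans ?_
        have e2 : ‖g‖ = (∫ t in Ioo 0 ℓ, ‖g t‖ ^ (2 : ℝ)) ^ (1 / (2 : ℝ)) := by
          rw [Lp.norm_def, (Lp.memLp g).eLpNorm_eq_integral_rpow_norm (by simp) (by simp),
            ENNReal.toReal_ofReal (by positivity)]
          norm_num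
        rw [← e2, mul_comm]
        gcongr
        simp [Real.sqrt_eq_rpow, h0]

/-- The Volterra operator `g ↦ ∫₀ˣ g` on `L²(0,ℓ)`. -/
def volterra (ℓ : ℝ) : L2 ℓ →L[ℂ] L2 ℓ :=
  LinearMap.mkContinuous
    { toFun := fun g => ofCont (prim g) (continuous_prim g)
      map_add' := fun g h => by
        rw [ofCont_add]
        congr 1
        exact funext (prim_add g h)
      map_smul' := fun c g => by
        rw [RingHom.id_apply, ofCont_smul]
        congr 1
        exact funext (prim_smul c g) }
    (√ℓ * √ℓ) fun g => by
      rw [mul_assoc]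
      exact norm_ofCont_le (continuous_prim g) (by positivity) fun x hx => norm_prim_le hx g

lemma volterra_apply {ℓ : ℝ} (g : L2 ℓ) :
    volterra ℓ g = ofCont (prim g) (continuous_prim g) := rfl

lemma prim_ofCont {ℓ x : ℝ} (hx : x ∈ Icc 0 ℓ) {F F' : ℝ → ℂ} (hF' : Continuous F')
    (h : ∀ x, HasDerivAt F (F' x) x) : prim (ofCont F' hF' : L2 ℓ) x = F x - F 0 := by
  rw [← intervalIntegral.integral_eq_sub_of_hasDerivAt (fun x _ => h x)
    (hF'.intervalIntegrable 0 x), prim]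
  refine intervalIntegral.integral_congr_ae ?_
  have hne : ∀ᵐ t : ℝ, t ≠ ℓ := by simp [ae_iff, measure_singleton]
  filter_upwards [(ae_restrict_iff' measurableSet_Ioo).1 (coeFn_ofCont (ℓ := ℓ) F' hF'), hne]
    with t ht htℓ hm
  rw [uIoc_of_le hx.1] at hm
  have hm' : t ∈ Ioo 0 ℓ := ⟨hm.1, lt_of_le_of_ne (hm.2.trans hx.2) htℓ⟩
  rw [indicator_of_mem hm', ht hm']

lemma ofCont_congr {ℓ : ℝ} {F G : ℝ → ℂ} (hF : Continuous F) (hG : Continuous G)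
    (h : ∀ x ∈ Ioo 0 ℓ, F x = G x) : (ofCont F hF : L2 ℓ) = ofCont G hG := by
  refine eq_ofCont _ ((coeFn_ofCont F hF).trans ?_)
  filter_upwards [ae_restrict_mem measurableSet_Ioo] with x hx using h x hx

/-- A continuously differentiable function is its initial value plus a primitive. -/
lemma ofCont_eq_cst_add_volterra {ℓ : ℝ} {F F' : ℝ → ℂ} (hF : Continuous F) (hF' : Continuous F')
    (h : ∀ x, HasDerivAt F (F' x) x) :
    (ofCont F hF : L2 ℓ) = cst (F 0) + volterra ℓ (ofCont F' hF') := by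
  rw [volterra_apply, cst, ofCont_add]
  refine ofCont_congr _ _ fun x hx => ?_
  rw [prim_ofCont (Ioo_subset_Icc_self hx) hF' h]
  ring

/-- Integration by parts for primitives; both sides are continuous in `g` and `h`, so that
continuous `g` and `h` suffice. -/
lemma inner_volterra_add {ℓ : ℝ} (hℓ : 0 ≤ ℓ) (g h : L2 ℓ) :
    inner ℂ g (volterra ℓ h) + inner ℂ (volterra ℓ g) h = star (prim g ℓ) * prim h ℓ := by
  simp only [prim_length hℓ]
  refine isClosed_property2 (p := fun g h : L2 ℓ => inner ℂ g (volterra ℓ h) +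
    inner ℂ (volterra ℓ g) h = star (inner ℂ (cst 1) g) * inner ℂ (cst 1) h)
    dense_ofCont (isClosed_eq (by fun_prop) ?_) ?_ g h
  · exact (continuous_star.comp (continuous_const.inner continuous_fst)).mul
      (continuous_const.inner continuous_snd)
  rintro ⟨F', hF'⟩ ⟨G', hG'⟩
  have hd {H : ℝ → ℂ} (hH : Continuous H) (x : ℝ) :
      HasDerivAt (fun x => ∫ t in (0)..x, H t) (H x) x :=
    intervalIntegral.integral_hasDerivAt_right (hH.intervalIntegrable _ _)
      hH.aestronglyMeasurable.stronglyMeasurableAtFilter hH.continuousAt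
  have hc {H : ℝ → ℂ} (hH : Continuous H) : Continuous (fun x => ∫ t in (0)..x, H t) :=
    continuous_iff_continuousAt.2 fun x => (hd hH x).continuousAt
  have hv {H : ℝ → ℂ} (hH : Continuous H) :
      volterra ℓ (ofCont H hH) = ofCont (fun x => ∫ t in (0)..x, H t) (hc hH) := by
    rw [ofCont_eq_cst_add_volterra (hc hH) hH (hd hH)]
    simp [cst_eq_smul 0]
  simp only [← prim_length hℓ, prim_ofCont (right_mem_Icc.2 hℓ) hF' (hd hF'),
    prim_ofCont (right_mem_Icc.2 hℓ) hG' (hd hG'), hv, inner_ofCont hℓ,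
    intervalIntegral.integral_same, sub_zero]
  have key := intervalIntegral.integral_mul_deriv_eq_deriv_mul (a := 0) (b := ℓ)
    (u := fun x => star (∫ t in (0)..x, F' t)) (v := fun x => ∫ t in (0)..x, G' t)
    (fun x _ => (hd hF' x).star) (fun x _ => hd hG' x)
    ((continuous_star.comp hF').intervalIntegrable _ _) (hG'.intervalIntegrable _ _)
  rw [key]
  simp

/-- `∫₀ˣ g` has weak derivative `g`. -/
lemma isWeakDeriv_volterra {ℓ : ℝ} (g : L2 ℓ) : IsWeakDeriv (volterra ℓ g) g := by
  intro φ h1 h2 h3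
  rcases lt_or_ge ℓ 0 with hℓ | hℓ
  · simp [Ioo_eq_empty (not_lt.2 hℓ.le)]
  have c0 : Continuous fun x => (φ x : ℂ) := Complex.continuous_ofReal.comp h1.continuous
  have c1 : Continuous fun x => ((deriv φ x : ℝ) : ℂ) :=
    Complex.continuous_ofReal.comp (h1.continuous_deriv (n := ∞) (by simp))
  have hd (x : ℝ) : HasDerivAt (fun x => (φ x : ℂ)) ((deriv φ x : ℝ) : ℂ) x :=
    (h1.differentiable (by simp) x).hasDerivAt.ofReal_comp
  have z0 : φ 0 = 0 := image_eq_zero_of_notMem_tsupport fun h => lt_irrefl _ (h3 h).1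
  have zℓ : φ ℓ = 0 := image_eq_zero_of_notMem_tsupport fun h => lt_irrefl _ (h3 h).2
  have e (ψ : ℝ → ℝ) (hψ : Continuous fun x => (ψ x : ℂ)) (f : L2 ℓ) :
      ∫ x in Ioo 0 ℓ, ψ x • f x = inner ℂ (ofCont (fun x => (ψ x : ℂ)) hψ) f := by
    rw [L2.inner_def]
    refine integral_congr_ae ?_
    filter_upwards [coeFn_ofCont (ℓ := ℓ) _ hψ] with x hx
    rw [hx]
    simp [mul_comm]
  have key := inner_volterra_add hℓ (ofCont (fun x => ((deriv φ x : ℝ) : ℂ)) c1) g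
  rw [prim_ofCont (right_mem_Icc.2 hℓ) c1 hd, z0, zℓ] at key
  rw [e _ c1, e _ c0, ofCont_eq_cst_add_volterra c0 c1 hd, z0, cst_eq_smul]
  simpa using eq_neg_of_add_eq_zero_left (by simpa using key)

lemma isWeakDeriv_cst {ℓ : ℝ} (c : ℂ) : IsWeakDeriv (cst c : L2 ℓ) 0 := by
  have h := isWeakDeriv_volterra (ofCont (fun _ => 0) continuous_const : L2 ℓ)
  intro φ h1 h2 h3
  rcases lt_or_ge ℓ 0 with hℓ | hℓ
  · simp [Ioo_eq_empty (not_lt.2 hℓ.le)]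
  have z0 : φ 0 = 0 := image_eq_zero_of_notMem_tsupport fun h => lt_irrefl _ (h3 h).1
  have zℓ : φ ℓ = 0 := image_eq_zero_of_notMem_tsupport fun h => lt_irrefl _ (h3 h).2
  have e0 : ∫ x in Ioo 0 ℓ, φ x • (0 : L2 ℓ) x = 0 := by
    refine integral_eq_zero_of_ae ?_
    filter_upwards [Lp.coeFn_zero ℂ 2 ((volume : Measure ℝ).restrict (Ioo 0 ℓ))] with x hx
    rw [hx]; simp
  have e1 : ∫ x in Ioo 0 ℓ, deriv φ x • (cst c : L2 ℓ) x = ∫ x in Ioo 0 ℓ, deriv φ x • c := by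
    refine integral_congr_ae ?_
    filter_upwards [coeFn_ofCont (ℓ := ℓ) (fun _ => c) continuous_const] with x hx
    rw [cst, hx]
  rw [e0, e1, integral_smul_const, ← integral_Ioc_eq_integral_Ioo,
    ← intervalIntegral.integral_of_le hℓ, intervalIntegral.integral_deriv_eq_sub
      (fun x _ => h1.differentiable (by simp) x)
      ((h1.continuous_deriv (by simp)).intervalIntegrable _ _), z0, zℓ]
  simp

lemma isWeakDeriv_cst_add_volterra {ℓ : ℝ} (c : ℂ) (g : L2 ℓ) :
    IsWeakDeriv (cst c + volterra ℓ g) g := by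
  simpa using (isWeakDeriv_cst c).add (isWeakDeriv_volterra g)

lemma isWeakDeriv_ofCont {ℓ : ℝ} {F F' : ℝ → ℂ} (hF : Continuous F) (hF' : Continuous F')
    (h : ∀ x, HasDerivAt F (F' x) x) : IsWeakDeriv (ofCont F hF : L2 ℓ) (ofCont F' hF') := by
  rw [ofCont_eq_cst_add_volterra hF hF' h]
  exact isWeakDeriv_cst_add_volterra _ _

lemma hasTrace_ofCont {ℓ : ℝ} (x : ℝ) {F : ℝ → ℂ} (hF : Continuous F) :
    HasTrace (ofCont F hF : L2 ℓ) x (F x) :=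
  ⟨F, hF.continuousOn, coeFn_ofCont F hF, rfl⟩

/-- Together with `IsWeakDeriv.exists_eq`, this reads off the traces of an `H¹` function. -/
lemma hasTrace_cst_add_volterra {ℓ : ℝ} (x : ℝ) (c : ℂ) (g : L2 ℓ) :
    HasTrace (cst c + volterra ℓ g) x (c + prim g x) :=
  (hasTrace_ofCont x continuous_const).add (hasTrace_ofCont x (continuous_prim g))

lemma HasTrace.unique {ℓ x : ℝ} (hℓ : 0 < ℓ) (hx : x ∈ Icc 0 ℓ) {f : L2 ℓ} {c d : ℂ}
    (hc : HasTrace f x c) (hd : HasTrace f x d) : c = d := by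
  obtain ⟨F, F1, F2, F3⟩ := hc
  obtain ⟨G, G1, G2, G3⟩ := hd
  have h1 : EqOn F G (Ioo 0 ℓ) := Measure.eqOn_open_of_ae_eq (F2.symm.trans G2) isOpen_Ioo
    (F1.mono Ioo_subset_Icc_self) (G1.mono Ioo_subset_Icc_self)
  have h2 : EqOn F G (Icc 0 ℓ) :=
    h1.of_subset_closure F1 G1 Ioo_subset_Icc_self (by rw [closure_Ioo hℓ.ne])
  rw [← F3, ← G3, h2 hx]

/-- Every `H¹` function is a constant plus the primitive of its weak derivative. -/
lemma IsWeakDeriv.exists_eq {ℓ : ℝ} (hℓ : 0 < ℓ) {f g : L2 ℓ} (h : IsWeakDeriv f g) :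
    ∃ c, f = cst c + volterra ℓ g := by
  have h' : IsWeakDeriv (f + (-1 : ℂ) • volterra ℓ g) 0 := by
    simpa using h.add ((isWeakDeriv_volterra g).smul (-1))
  obtain ⟨c, hc⟩ := h'.ae_eq_const hℓ
  refine ⟨c, ?_⟩
  rw [cst, ← eq_ofCont continuous_const hc]
  simp

lemma IsWeakDeriv.eq_of_hasTrace_zero {ℓ : ℝ} (hℓ : 0 < ℓ) {f g : L2 ℓ} (h : IsWeakDeriv f g)
    {c : ℂ} (hc : HasTrace f 0 c) : f = cst c + volterra ℓ g := by
  obtain ⟨d, rfl⟩ := h.exists_eq hℓ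
  have := hasTrace_cst_add_volterra 0 d g
  rw [prim_zero, add_zero] at this
  rw [hc.unique hℓ ⟨le_rfl, hℓ.le⟩ this]

lemma IsWeakDeriv.exists_hasTrace {ℓ : ℝ} (hℓ : 0 < ℓ) {f g : L2 ℓ} (h : IsWeakDeriv f g)
    (x : ℝ) : ∃ c, HasTrace f x c := by
  obtain ⟨d, rfl⟩ := h.exists_eq hℓ
  exact ⟨_, hasTrace_cst_add_volterra x d g⟩

/-- Integration by parts in `H¹(0,ℓ)`. -/
lemma IsWeakDeriv.inner_add_inner {ℓ : ℝ} (hℓ : 0 < ℓ) {f f' g g' : L2 ℓ} (hf : IsWeakDeriv f f')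
    (hg : IsWeakDeriv g g') {a b c d : ℂ} (ha : HasTrace f 0 a) (hb : HasTrace f ℓ b)
    (hc : HasTrace g 0 c) (hd : HasTrace g ℓ d) :
    inner ℂ f' g + inner ℂ f g' = star b * d - star a * c := by
  have ef := hf.eq_of_hasTrace_zero hℓ ha
  have eg := hg.eq_of_hasTrace_zero hℓ hc
  have m : ℓ ∈ Icc 0 ℓ := ⟨hℓ.le, le_rfl⟩
  rw [ef] at hb
  rw [eg] at hd
  rw [hb.unique hℓ m (hasTrace_cst_add_volterra ℓ a f'),
    hd.unique hℓ m (hasTrace_cst_add_volterra ℓ c g'), ef, eg]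
  have key := inner_volterra_add hℓ.le f' g'
  have k1 : inner ℂ f' (cst c) = star (prim f' ℓ) * c := by
    rw [cst_eq_smul, inner_smul_right, prim_length hℓ.le, ← inner_conj_symm, mul_comm]
    rfl
  have k2 : inner ℂ (cst a) g' = star a * prim g' ℓ := by
    rw [cst_eq_smul, inner_smul_left, prim_length hℓ.le]
    rfl
  rw [inner_add_left, inner_add_right, k1, k2, star_add]
  linear_combination key

/-- Poincaré's inequality for functions that vanish at `0`. -/
lemma IsWeakDeriv.norm_le_of_hasTrace_left {ℓ : ℝ} (hℓ : 0 < ℓ) {f g : L2 ℓ}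
    (h : IsWeakDeriv f g) (h0 : HasTrace f 0 0) : ‖f‖ ≤ ‖volterra ℓ‖ * ‖g‖ := by
  rw [h.eq_of_hasTrace_zero hℓ h0, cst_eq_smul, zero_smul, zero_add]
  exact (volterra ℓ).le_opNorm g

/-- The value of `f` at `0`, bounded by the `H¹` norm. -/
lemma IsWeakDeriv.norm_trace_le {ℓ : ℝ} (hℓ : 0 < ℓ) {f g : L2 ℓ}
    (h : IsWeakDeriv f g) {c : ℂ} (h0 : HasTrace f 0 c) :
    √ℓ * ‖c‖ ≤ ‖f‖ + ‖volterra ℓ‖ * ‖g‖ := by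
  have e := h.eq_of_hasTrace_zero hℓ h0
  rw [← norm_cst hℓ.le, show (cst c : L2 ℓ) = f - volterra ℓ g by rw [e]; abel]
  exact (norm_sub_le _ _).trans (by gcongr; exact (volterra ℓ).le_opNorm g)

lemma IsWeakDeriv.trace_right {ℓ : ℝ} (hℓ : 0 < ℓ) {f g : L2 ℓ} (h : IsWeakDeriv f g) {c d : ℂ}
    (h0 : HasTrace f 0 c) (h1 : HasTrace f ℓ d) : d = c + inner ℂ (cst 1) g := by
  rw [h.eq_of_hasTrace_zero hℓ h0] at h1
  rw [← prim_length hℓ.le]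
  exact h1.unique hℓ ⟨hℓ.le, le_rfl⟩ (hasTrace_cst_add_volterra ℓ c g)

/-- Poincaré's inequality for functions that vanish at `ℓ`. -/
lemma exists_poincare_right {ℓ : ℝ} (hℓ : 0 < ℓ) : ∃ C, 0 ≤ C ∧ ∀ {f g : L2 ℓ},
    IsWeakDeriv f g → HasTrace f ℓ 0 → ‖f‖ ≤ C * ‖g‖ := by
  refine ⟨√ℓ * (√ℓ * 1) + ‖volterra ℓ‖, by positivity, fun {f g} h h1 => ?_⟩
  obtain ⟨c, h0⟩ := h.exists_hasTrace hℓ 0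
  have e := h.trace_right hℓ h0 h1
  have hc : ‖c‖ ≤ √ℓ * 1 * ‖g‖ := by
    rw [eq_neg_of_add_eq_zero_left e.symm, norm_neg]
    refine (norm_inner_le_norm _ _).trans ?_
    rw [norm_cst hℓ.le, norm_one]
  rw [h.eq_of_hasTrace_zero hℓ h0]
  refine (norm_add_le _ _).trans ?_
  rw [norm_cst hℓ.le, add_mul, mul_assoc (√ℓ)]
  gcongr
  exact (volterra ℓ).le_opNorm g


lemma memLp_dist (ℓ : ℝ) : MemLp (fun x : ℝ => ((ℓ - x : ℝ) : ℂ)) ∞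
    ((volume : Measure ℝ).restrict (Ioo 0 ℓ)) := by
  refine memLp_top_of_bound (by fun_prop) ℓ ?_
  filter_upwards [ae_restrict_mem measurableSet_Ioo] with x hx
  rw [Complex.norm_real, Real.norm_eq_abs, abs_of_nonneg (by linarith [hx.2])]
  linarith [hx.1]

/-- Multiplication by `ℓ - x` on `L²(0,ℓ)`. -/
def mulDist (ℓ : ℝ) : L2 ℓ →L[ℂ] L2 ℓ :=
  (ContinuousLinearMap.mul ℂ ℂ).holderL _ ∞ 2 2 (memLp_dist ℓ).toLp

lemma coeFn_mulDist {ℓ : ℝ} (f : L2 ℓ) :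
    mulDist ℓ f =ᵐ[(volume : Measure ℝ).restrict (Ioo 0 ℓ)] fun x => ((ℓ - x : ℝ) : ℂ) * f x := by
  filter_upwards [(ContinuousLinearMap.mul ℂ ℂ).coeFn_holder (memLp_dist ℓ).toLp f (r := 2),
    (memLp_dist ℓ).coeFn_toLp] with x h1 h2
  rw [h2] at h1
  exact h1

lemma hasTrace_mulDist {ℓ x : ℝ} {f : L2 ℓ} {c : ℂ} (h : HasTrace f x c) :
    HasTrace (mulDist ℓ f) x (((ℓ - x : ℝ) : ℂ) * c) := by
  obtain ⟨F, F1, F2, F3⟩ := h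
  refine ⟨fun x => ((ℓ - x : ℝ) : ℂ) * F x, by fun_prop, ?_, by simp only [F3]⟩
  filter_upwards [coeFn_mulDist f, F2] with x h1 h2
  rw [h1, h2]

lemma isWeakDeriv_mulDist {ℓ : ℝ} {f g : L2 ℓ} (h : IsWeakDeriv f g) :
    IsWeakDeriv (mulDist ℓ f) (mulDist ℓ g - f) := by
  intro φ h1 h2 h3
  have d1 : ContDiff ℝ ∞ fun x => (ℓ - x) * φ x := (contDiff_const.sub contDiff_id).mul h1
  have d2 : HasCompactSupport fun x => (ℓ - x) * φ x := h2.mul_left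
  have d3 : tsupport (fun x => (ℓ - x) * φ x) ⊆ Ioo 0 ℓ := (tsupport_mul_subset_right).trans h3
  have key := h _ d1 d2 d3
  have hd (x : ℝ) : deriv (fun x => (ℓ - x) * φ x) x = (ℓ - x) * deriv φ x - φ x := by
    have := ((hasDerivAt_id x).const_sub ℓ).mul (h1.differentiable (by simp) x).hasDerivAt
    exact (this.deriv.trans (by simp; ring))
  have e1 : ∫ x in Ioo 0 ℓ, deriv φ x • (mulDist ℓ f : L2 ℓ) x
      = ∫ x in Ioo 0 ℓ, (deriv (fun x => (ℓ - x) * φ x) x • f x + φ x • f x) := by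
    refine integral_congr_ae ?_
    filter_upwards [coeFn_mulDist f] with x hx
    rw [hx, hd]
    simp only [Complex.real_smul]; push_cast; ring
  have e2 : ∫ x in Ioo 0 ℓ, φ x • (mulDist ℓ g - f : L2 ℓ) x
      = ∫ x in Ioo 0 ℓ, (((ℓ - x) * φ x) • g x - φ x • f x) := by
    refine integral_congr_ae ?_
    filter_upwards [coeFn_mulDist g, Lp.coeFn_sub (mulDist ℓ g) f] with x hx hx'
    rw [hx', Pi.sub_apply, hx]
    simp only [Complex.real_smul]; push_cast; ring
  have i0 := integrable_smul_L2 f h1.continuous h2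
  rw [e1, e2, integral_add (integrable_smul_L2 f (d1.continuous_deriv (by simp)) d2.deriv) i0,
    integral_sub (integrable_smul_L2 g d1.continuous d2) i0, key]
  ring

lemma inner_mulDist_left {ℓ : ℝ} (f g : L2 ℓ) :
    inner ℂ (mulDist ℓ f) g = inner ℂ f (mulDist ℓ g) := by
  rw [L2.inner_def, L2.inner_def]
  refine integral_congr_ae ?_
  filter_upwards [coeFn_mulDist f, coeFn_mulDist g] with x h1 h2
  rw [h1, h2]
  simp only [RCLike.inner_apply, map_mul, Complex.conj_ofReal]
  ring

/-- The multiplier identity behind boundary observability: `ℓ|f(0)|²` in terms of `L²` products. -/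
lemma IsWeakDeriv.mulDist_identity {ℓ : ℝ} (hℓ : 0 < ℓ) {f g : L2 ℓ} (h : IsWeakDeriv f g)
    {c : ℂ} (h0 : HasTrace f 0 c) :
    ‖f‖ ^ 2 = 2 * (inner ℂ (mulDist ℓ f) g).re + ℓ * ‖c‖ ^ 2 := by
  obtain ⟨d, h1⟩ := h.exists_hasTrace hℓ ℓ
  have key := (isWeakDeriv_mulDist h).inner_add_inner hℓ h (hasTrace_mulDist h0)
    (hasTrace_mulDist h1) h0 h1
  rw [inner_sub_left, inner_mulDist_left] at key
  have hre := congrArg Complex.re key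
  have e1 : (inner ℂ f f).re = ‖f‖ ^ 2 := (norm_sq_eq_re_inner (𝕜 := ℂ) f).symm
  have e2 : (inner ℂ g (mulDist ℓ f)).re = (inner ℂ (mulDist ℓ f) g).re :=
    inner_re_symm (𝕜 := ℂ) _ _
  have e3 : (star c * c).re = ‖c‖ ^ 2 := by
    rw [Complex.star_def, Complex.conj_mul']; norm_cast
  have e4 : (star (((ℓ - 0 : ℝ) : ℂ) * c) * c).re = ℓ * ‖c‖ ^ 2 := by
    rw [← e3, ← Complex.re_ofReal_mul]
    congr 1
    simp only [Complex.star_def, map_mul, Complex.conj_ofReal, sub_zero]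
    ring
  simp only [Complex.add_re, Complex.sub_re, e1, e2, e4, sub_self, Complex.ofReal_zero,
    zero_mul, star_zero, Complex.zero_re] at hre
  linarith

/-- The first derivative is controlled by the function and the second derivative. With
`f = d + cx + ∬h`, the coefficient `c` is found by testing against `w = x - ℓ/2`, which is
orthogonal to the constants. -/
lemma exists_norm_deriv_le {ℓ : ℝ} (hℓ : 0 < ℓ) : ∃ C, 0 ≤ C ∧ ∀ {f g h : L2 ℓ},
    IsWeakDeriv f g → IsWeakDeriv g h → ‖g‖ ≤ C * (‖f‖ + ‖h‖) := by
  let w : L2 ℓ := ofCont (fun x => ((x - ℓ / 2 : ℝ) : ℂ)) (by fun_prop)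
  have hw1 : inner ℂ w (cst 1) = 0 := by
    rw [cst, inner_ofCont hℓ.le]
    have : ∀ x : ℝ, star ((x - ℓ / 2 : ℝ) : ℂ) * 1 = ((x - ℓ / 2 : ℝ) : ℂ) := fun x => by
      rw [mul_one]; exact Complex.conj_ofReal _
    simp only [this]
    rw [intervalIntegral.integral_ofReal, intervalIntegral.integral_sub (by simp) (by simp)]
    simp; ring
  have hw2 : inner ℂ w (volterra ℓ (cst 1)) = ((ℓ ^ 3 / 12 : ℝ) : ℂ) := by
    have e : volterra ℓ (cst 1) = ofCont (fun x => (x : ℂ)) Complex.continuous_ofReal := by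
      have := ofCont_eq_cst_add_volterra (ℓ := ℓ) (F := fun x => (x : ℂ)) (F' := fun _ => 1)
        Complex.continuous_ofReal continuous_const (fun x => (hasDerivAt_id x).ofReal_comp)
      rw [this, Complex.ofReal_zero, cst_eq_smul 0, zero_smul, zero_add]
      rfl
    rw [e, inner_ofCont hℓ.le]
    have : ∀ x : ℝ, star ((x - ℓ / 2 : ℝ) : ℂ) * (x : ℂ) = ((x ^ 2 - ℓ / 2 * x : ℝ) : ℂ) :=
      fun x => by
        rw [Complex.star_def, Complex.conj_ofReal, ← Complex.ofReal_mul]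
        congr 1
        ring
    simp only [this]
    rw [intervalIntegral.integral_ofReal]
    rw [intervalIntegral.integral_sub
      (Continuous.intervalIntegrable (by fun_prop) _ _)
      (Continuous.intervalIntegrable (by fun_prop) _ _)]
    rw [integral_pow, intervalIntegral.integral_const_mul, integral_id]
    congr 1
    norm_num
    ring
  refine ⟨√ℓ * (12 / ℓ ^ 3 * (‖w‖ * (1 + ‖volterra ℓ‖ * ‖volterra ℓ‖))) + ‖volterra ℓ‖,
    by positivity, fun {f g h} hf hg => ?_⟩
  obtain ⟨c, rfl⟩ := hg.exists_eq hℓ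
  obtain ⟨d, rfl⟩ := hf.exists_eq hℓ
  set f := cst d + volterra ℓ (cst c + volterra ℓ h) with hfdef
  have e : inner ℂ w (f - volterra ℓ (volterra ℓ h)) = ((ℓ ^ 3 / 12 : ℝ) : ℂ) * c := by
    rw [hfdef, map_add, add_sub_assoc, add_sub_cancel_right, cst_eq_smul d, cst_eq_smul c,
      map_smul, inner_add_right, inner_smul_right, inner_smul_right, hw1, hw2]
    ring
  have b1 : ‖c‖ ≤ 12 / ℓ ^ 3 * (‖w‖ * (1 + ‖volterra ℓ‖ * ‖volterra ℓ‖)) * (‖f‖ + ‖h‖) := by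
    have n1 := congrArg norm e
    rw [norm_mul, Complex.norm_real, Real.norm_of_nonneg (by positivity)] at n1
    have n2 : ‖c‖ = 12 / ℓ ^ 3 * ‖inner ℂ w (f - volterra ℓ (volterra ℓ h))‖ := by
      rw [n1]; field_simp
    rw [n2, mul_assoc]
    gcongr
    refine (norm_inner_le_norm _ _).trans ?_
    rw [mul_assoc]
    gcongr
    refine (norm_sub_le _ _).trans ?_
    have n3 : ‖volterra ℓ (volterra ℓ h)‖ ≤ ‖volterra ℓ‖ * ‖volterra ℓ‖ * ‖h‖ := by
      rw [mul_assoc]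
      exact ((volterra ℓ).le_opNorm _).trans (by gcongr; exact (volterra ℓ).le_opNorm h)
    nlinarith [mul_nonneg (mul_nonneg (norm_nonneg (volterra ℓ)) (norm_nonneg (volterra ℓ)))
      (norm_nonneg f), norm_nonneg h]
  refine (norm_add_le _ _).trans ?_
  rw [norm_cst hℓ.le, add_mul, mul_assoc (√ℓ)]
  gcongr
  exact ((volterra ℓ).le_opNorm h).trans (by gcongr; exact le_add_of_nonneg_left (norm_nonneg _))

/-! ### Resolvents -/

section Resolvent

variable {X : Type*} [NormedAddCommGroup X] [NormedSpace ℂ X] {A : X →ₗ.[ℂ] X}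

lemma IsResolventAt.unique {z : ℂ} {R R' : X →L[ℂ] X} (h : IsResolventAt A z R)
    (h' : IsResolventAt A z R') : R = R' := by
  ext x
  obtain ⟨hx, e⟩ := h'.1 x
  have := h.2 ⟨R' x, hx⟩
  rwa [e] at this

lemma IsResolventAt.resolventOf_eq {z : ℂ} {R : X →L[ℂ] X} (h : IsResolventAt A z R) :
    resolventOf A z = R := by
  have hex : ∃ R, IsResolventAt A z R := ⟨R, h⟩
  rw [resolventOf, dif_pos hex]
  exact hex.choose_spec.unique h

/-- A surjective `z - A` that is bounded below has a bounded inverse. -/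
lemma exists_isResolventAt {z : ℂ} {C : ℝ} (hC0 : 0 ≤ C)
    (hC : ∀ x : A.domain, ‖(x : X)‖ ≤ C * ‖z • (x : X) - A x‖)
    (hs : ∀ f, ∃ x : A.domain, z • (x : X) - A x = f) :
    ∃ R, IsResolventAt A z R ∧ ‖R‖ ≤ C := by
  choose r hr using hs
  have inj (x y : A.domain) (h : z • (x : X) - A x = z • (y : X) - A y) : x = y := by
    have h1 := hC (x - y)
    have h2 : z • ((x - y : A.domain) : X) - A (x - y) = 0 := by
      rw [LinearPMap.map_sub, Submodule.coe_sub, smul_sub, sub_sub_sub_comm, h, sub_self]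
    rw [h2, norm_zero, mul_zero] at h1
    have h3 : ((x - y : A.domain) : X) = 0 := norm_le_zero_iff.1 h1
    exact sub_eq_zero.1 (Subtype.ext h3)
  let L : X →ₗ[ℂ] X :=
    { toFun := fun f => r f
      map_add' := fun f g => by
        have : r (f + g) = r f + r g := inj _ _ (by
          rw [hr, LinearPMap.map_add, Submodule.coe_add, smul_add, add_sub_add_comm, hr, hr])
        rw [this, Submodule.coe_add]
      map_smul' := fun c f => by
        have : r (c • f) = c • r f := inj _ _ (by
          rw [hr, LinearPMap.map_smul, Submodule.coe_smul, smul_comm, ← smul_sub, hr])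
        rw [this, Submodule.coe_smul, RingHom.id_apply] }
  have hL (f : X) : ‖L f‖ ≤ C * ‖f‖ := by
    have := hC (r f)
    rwa [hr] at this
  refine ⟨L.mkContinuous C hL, ⟨fun f => ⟨(r f).2, hr f⟩, fun x => ?_⟩,
    L.mkContinuous_norm_le hC0 hL⟩
  exact congrArg Subtype.val (inj (r _) x (hr _))

/-- The resolvent set is open, quantitatively. -/
lemma IsResolventAt.exists_of_near [CompleteSpace X] {z w : ℂ} {R : X →L[ℂ] X}
    (h : IsResolventAt A z R) (hw : ‖z - w‖ * ‖R‖ < 1) : ∃ R', IsResolventAt A w R' := by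
  have ht : ‖(z - w) • R‖ < 1 := by rwa [norm_smul]
  have hpos : 0 < 1 - ‖z - w‖ * ‖R‖ := by linarith
  refine (exists_isResolventAt (A := A) (z := w) (C := (1 - ‖z - w‖ * ‖R‖)⁻¹ * ‖R‖) (by positivity)
    (fun x => ?_) (fun f => ?_)).imp fun _ h => h.1
  · have e : (x : X) = R (w • (x : X) - A x) + (z - w) • R x := by
      have h1 := h.2 x
      rw [← map_smul, ← map_add, sub_smul]
      rw [show w • (x : X) - A x + (z • (x : X) - w • (x : X)) = z • (x : X) - A x by abel, h1]
    have n : ‖(x : X)‖ ≤ ‖R‖ * ‖w • (x : X) - A x‖ + ‖z - w‖ * ‖R‖ * ‖(x : X)‖ := by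
      conv_lhs => rw [e]
      refine (norm_add_le _ _).trans ?_
      rw [norm_smul, mul_assoc]
      gcongr <;> exact R.le_opNorm _
    rw [mul_assoc, ← div_eq_inv_mul, le_div_iff₀ hpos]
    linarith
  · obtain ⟨g, hg⟩ : ∃ g, g - (z - w) • R g = f := by
      refine ⟨((Units.oneSub _ ht)⁻¹ : (X →L[ℂ] X)ˣ).1 f, ?_⟩
      have := congrArg (fun T : X →L[ℂ] X => T f) (Units.oneSub _ ht).mul_inv
      simpa [sub_smul] using this
    obtain ⟨hx, e⟩ := h.1 g
    refine ⟨⟨R g, hx⟩, ?_⟩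
    rw [← hg, sub_smul]
    have e' : A ⟨R g, hx⟩ = z • R g - g := by
      rw [eq_sub_iff_add_eq, add_comm, ← sub_eq_iff_eq_add.1 e]
    rw [e']
    abel

end Resolvent

/-! ### Dissipative operators in Hilbert space -/

section Dissipative

variable {X : Type*} [NormedAddCommGroup X] [InnerProductSpace ℂ X] {A : X →ₗ.[ℂ] X}

lemma re_mul_norm_le_of_dissipative (hA : ∀ x : A.domain, (inner ℂ (x : X) (A x)).re ≤ 0) (z : ℂ)
    (x : A.domain) : z.re * ‖(x : X)‖ ≤ ‖z • (x : X) - A x‖ := by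
  rcases (norm_nonneg (x : X)).eq_or_lt with h0 | h0
  · rw [← h0, mul_zero]; exact norm_nonneg _
  refine le_of_mul_le_mul_right ?_ h0
  have h1 : (inner ℂ (x : X) (z • (x : X) - A x)).re ≤ ‖(x : X)‖ * ‖z • (x : X) - A x‖ :=
    (Complex.re_le_norm _).trans (norm_inner_le_norm _ _)
  have h2 : inner ℂ (x : X) (x : X) = ((‖(x : X)‖ ^ 2 : ℝ) : ℂ) := by
    rw [inner_self_eq_norm_sq_to_K]; norm_cast
  rw [inner_sub_right, inner_smul_right, h2, Complex.sub_re, Complex.re_mul_ofReal] at h1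
  nlinarith [hA x]

/-- A dissipative operator with `0` in its resolvent set has the open right half-plane in it: the
estimate `‖(z - A)⁻¹‖ ≤ 1 / Re z` lets a small positive point be moved outwards. -/
lemma exists_isResolventAt_of_dissipative [CompleteSpace X]
    (hA : ∀ x : A.domain, (inner ℂ (x : X) (A x)).re ≤ 0) (h0 : ∃ R, IsResolventAt A 0 R) {z : ℂ}
    (hz : 0 < z.re) : ∃ R, IsResolventAt A z R ∧ ‖R‖ ≤ 1 / z.re := by
  have bound {z : ℂ} (hz : 0 < z.re) {R : X →L[ℂ] X} (hR : IsResolventAt A z R) :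
      ‖R‖ ≤ 1 / z.re := by
    refine R.opNorm_le_bound (by positivity) fun f => ?_
    obtain ⟨hx, e⟩ := hR.1 f
    have := re_mul_norm_le_of_dissipative hA z ⟨R f, hx⟩
    rw [e] at this
    rw [one_div, ← div_eq_inv_mul, le_div_iff₀ hz, mul_comm]
    exact this
  have step {z w : ℂ} (hz : 0 < z.re) (h : ∃ R, IsResolventAt A z R) (hw : ‖z - w‖ < z.re) :
      ∃ R, IsResolventAt A w R := by
    obtain ⟨R, hR⟩ := h
    refine hR.exists_of_near ?_
    calc ‖z - w‖ * ‖R‖ ≤ ‖z - w‖ * (1 / z.re) := by gcongr; exact bound hz hR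
      _ < 1 := by rw [mul_one_div, div_lt_one hz]; exact hw
  suffices ∃ R, IsResolventAt A z R by
    obtain ⟨R, hR⟩ := this
    exact ⟨R, hR, bound hz hR⟩
  obtain ⟨R₀, hR₀⟩ := h0
  set r : ℝ := 1 / (‖R₀‖ + 1) with hr
  have hr0 : 0 < r := by positivity
  have h1 : ∃ R, IsResolventAt A ((r : ℝ) : ℂ) R := by
    refine hR₀.exists_of_near ?_
    rw [zero_sub, norm_neg, Complex.norm_real, Real.norm_of_nonneg hr0.le, hr, one_div,
      ← div_eq_inv_mul, div_lt_one (by positivity)]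
    linarith
  -- a real point `s` of the resolvent set has all of `(0, 2s)` in it, so `s` may grow by `3/2`
  have h2 (n : ℕ) : ∃ R, IsResolventAt A ((r * (3 / 2) ^ n : ℝ) : ℂ) R := by
    induction n with
    | zero => simpa using h1
    | succ n ih =>
      refine step ?_ ih ?_
      · rw [Complex.ofReal_re]; positivity
      · rw [← Complex.ofReal_sub, Complex.norm_real, Complex.ofReal_re, Real.norm_eq_abs,
          abs_lt]
        have : 0 < r * (3 / 2) ^ n := by positivity
        constructor <;> rw [pow_succ] <;> linarith
  -- `z` is in the disc of radius `s` around `s` as soon as `‖z‖² < 2 s Re z`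
  obtain ⟨n, hn⟩ := pow_unbounded_of_one_lt ((‖z‖ ^ 2 + 1) / (2 * z.re) / r)
    (by norm_num : (1 : ℝ) < 3 / 2)
  rw [div_lt_iff₀ hr0, mul_comm, div_lt_iff₀ (by positivity)] at hn
  have hs : 0 < r * (3 / 2) ^ n := by positivity
  refine step ?_ (h2 n) ?_
  · rwa [Complex.ofReal_re]
  · rw [Complex.ofReal_re]
    refine lt_of_pow_lt_pow_left₀ 2 hs.le ?_
    rw [← Complex.normSq_eq_norm_sq] at hn ⊢
    rw [Complex.normSq_apply] at hn ⊢
    simp only [Complex.sub_re, Complex.sub_im, Complex.ofReal_re, Complex.ofReal_im]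
    nlinarith

/-- A point of the imaginary axis is in the resolvent set as soon as `z - A` is bounded below
there: the lower bound persists at `z + ε`, which is in the resolvent set, with a bound on the
resolvent that does not depend on `ε`. -/
lemma exists_isResolventAt_imaginary [CompleteSpace X]
    (hA : ∀ x : A.domain, (inner ℂ (x : X) (A x)).re ≤ 0) (h0 : ∃ R, IsResolventAt A 0 R) {z : ℂ}
    (hz : z.re = 0) {C : ℝ} (hC : ∀ x : A.domain, ‖(x : X)‖ ≤ C * ‖z • (x : X) - A x‖) :
    ∃ R, IsResolventAt A z R := by
  set D := |C| + 1 with hD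
  have hD0 : 0 < D := by positivity
  have hCD : C ≤ D := (le_abs_self C).trans (by linarith)
  set ε : ℝ := 1 / (4 * D) with hε
  have hε0 : 0 < ε := by positivity
  have hεD : ε * D = 1 / 4 := by rw [hε]; field_simp
  obtain ⟨R, hR, -⟩ := exists_isResolventAt_of_dissipative hA h0 (z := z + (ε : ℝ))
    (by simp [hz, hε0])
  have hRn : ‖R‖ ≤ 2 * D := by
    refine R.opNorm_le_bound (by positivity) fun f => ?_
    obtain ⟨hx, e⟩ := hR.1 f
    have h1 := hC ⟨R f, hx⟩
    have h2 : z • R f - A ⟨R f, hx⟩ = f - (ε : ℂ) • R f := by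
      rw [eq_sub_iff_add_eq, sub_add_eq_add_sub, ← add_smul]
      exact e
    have h3 : ‖f - (ε : ℂ) • R f‖ ≤ ‖f‖ + ε * ‖R f‖ := by
      refine (norm_sub_le _ _).trans ?_
      rw [norm_smul, Complex.norm_real, Real.norm_of_nonneg hε0.le]
    have h4 : ‖R f‖ ≤ D * (‖f‖ + ε * ‖R f‖) := by
      refine h1.trans ?_
      rw [h2]
      exact mul_le_mul hCD h3 (norm_nonneg _) hD0.le
    nlinarith [norm_nonneg (R f), norm_nonneg f]
  refine hR.exists_of_near ?_
  rw [add_sub_cancel_left, Complex.norm_real, Real.norm_of_nonneg hε0.le]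
  nlinarith

/-- The domain of a dissipative operator with `1` in its resolvent set is dense. -/
lemma dense_domain_of_dissipative [CompleteSpace X]
    (hA : ∀ x : A.domain, (inner ℂ (x : X) (A x)).re ≤ 0)
    (h1 : ∃ R, IsResolventAt A 1 R) : Dense (A.domain : Set X) := by
  rw [Submodule.dense_iff_topologicalClosure_eq_top, Submodule.topologicalClosure_eq_top_iff,
    Submodule.eq_bot_iff]
  intro x hx
  obtain ⟨R, hR⟩ := h1
  obtain ⟨hy, e⟩ := hR.1 x
  have h2 : inner ℂ (R x) x = 0 := (Submodule.mem_orthogonal _ _).1 hx _ hy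
  have h3 : (inner ℂ (R x) (R x)).re = ‖R x‖ ^ 2 := (norm_sq_eq_re_inner (𝕜 := ℂ) _).symm
  nth_rewrite 2 [← e] at h2
  have h4 := congrArg Complex.re h2
  rw [one_smul, inner_sub_right, Complex.sub_re, h3, Complex.zero_re] at h4
  have h5 := hA ⟨R x, hy⟩
  have h6 : R x = 0 := by
    have : ‖R x‖ ^ 2 = 0 := le_antisymm (by linarith) (sq_nonneg _)
    simpa using this
  rw [← e]
  have h7 : (⟨R x, hy⟩ : A.domain) = 0 := Subtype.ext h6
  rw [h7, LinearPMap.map_zero, h6, smul_zero, sub_zero]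

end Dissipative

/-! ### Generation of contraction semigroups -/

section Generation

variable {X : Type*} [NormedAddCommGroup X] [InnerProductSpace ℂ X]

/-- The semigroup generated by a bounded operator. -/
def expSemigroup (B : X →L[ℂ] X) (t : ℝ) : X →L[ℂ] X := NormedSpace.exp (t • B)

lemma expSemigroup_zero (B : X →L[ℂ] X) : expSemigroup B 0 = 1 := by
  rw [expSemigroup, zero_smul, NormedSpace.exp_zero]

lemma expSemigroup_add [CompleteSpace X] (B : X →L[ℂ] X) (s t : ℝ) :
    expSemigroup B (s + t) = expSemigroup B s * expSemigroup B t := by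
  let _ : NormedAlgebra ℚ (X →L[ℂ] X) := NormedAlgebra.restrictScalars ℚ ℂ _
  rw [expSemigroup, add_smul, NormedSpace.exp_add_of_commute
    (((Commute.refl B).smul_left s).smul_right t)]
  rfl

lemma expSemigroup_commute [CompleteSpace X] {B C : X →L[ℂ] X} (h : Commute B C) (t : ℝ) :
    Commute (expSemigroup B t) C :=
  (h.smul_left t).exp_left

lemma hasDerivAt_expSemigroup [CompleteSpace X] (B : X →L[ℂ] X) (x : X) (t : ℝ) :
    HasDerivAt (fun t => expSemigroup B t x) (expSemigroup B t (B x)) t := by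
  have h : HasDerivAt (fun t : ℝ => expSemigroup B t) (expSemigroup B t * B) t :=
    hasDerivAt_exp_smul_const B t
  have := ((ContinuousLinearMap.apply ℂ X x).restrictScalars ℝ).hasFDerivAt.comp_hasDerivAt t h
  exact this

/-- A bounded dissipative operator generates contractions. -/
lemma norm_expSemigroup_le [CompleteSpace X] {B : X →L[ℂ] X}
    (hB : ∀ x, (inner ℂ x (B x)).re ≤ 0) {t : ℝ}
    (ht : 0 ≤ t) (x : X) : ‖expSemigroup B t x‖ ≤ ‖x‖ := by
  let _ : InnerProductSpace ℝ X := InnerProductSpace.rclikeToReal ℂ X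
  have hd (s : ℝ) : HasDerivAt (fun s => ‖expSemigroup B s x‖ ^ 2)
      (2 * inner ℝ (expSemigroup B s x) (expSemigroup B s (B x))) s :=
    (hasDerivAt_expSemigroup B x s).norm_sq
  have hanti : Antitone fun s => ‖expSemigroup B s x‖ ^ 2 := by
    refine antitone_of_deriv_nonpos (fun s => (hd s).differentiableAt) fun s => ?_
    rw [(hd s).deriv]
    have h1 : expSemigroup B s (B x) = B (expSemigroup B s x) :=
      congrArg (fun T : X →L[ℂ] X => T x) (expSemigroup_commute (Commute.refl B) s).eq
    have h2 : inner ℝ (expSemigroup B s x) (B (expSemigroup B s x))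
      = (inner ℂ (expSemigroup B s x) (B (expSemigroup B s x))).re := rfl
    rw [h1, h2]
    linarith [hB (expSemigroup B s x)]
  have := hanti ht
  simp only [expSemigroup_zero] at this
  exact le_of_sq_le_sq this (norm_nonneg _)

lemma norm_expSemigroup_sub_self_le [CompleteSpace X] {B : X →L[ℂ] X}
    (hB : ∀ x, (inner ℂ x (B x)).re ≤ 0) {t : ℝ}
    (ht : 0 ≤ t) (x : X) : ‖expSemigroup B t x - x‖ ≤ t * ‖B x‖ := by
  have := norm_image_sub_le_of_norm_deriv_le_segment' (a := 0) (b := t) (C := ‖B x‖)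
    (fun s _ => (hasDerivAt_expSemigroup B x s).hasDerivWithinAt)
    (fun s hs => norm_expSemigroup_le hB hs.1 (B x)) t ⟨ht, le_rfl⟩
  rw [expSemigroup_zero, sub_zero, mul_comm] at this
  exact this

/-- First order expansion at `t = 0`, where `B x` is replaced by an arbitrary `y`. -/
lemma norm_expSemigroup_expansion_le [CompleteSpace X] {B : X →L[ℂ] X}
    (hB : ∀ x, (inner ℂ x (B x)).re ≤ 0) {t : ℝ}
    (ht : 0 ≤ t) (x y : X) :
    ‖expSemigroup B t x - x - t • B x‖ ≤ (2 * ‖B x - y‖ + t * ‖B y‖) * t := by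
  have hd (s : ℝ) : HasDerivAt (fun s => expSemigroup B s x - s • B x)
      (expSemigroup B s (B x) - B x) s := by
    have := (hasDerivAt_expSemigroup B x s).sub ((hasDerivAt_id s).smul_const (B x))
    rw [one_smul] at this
    exact this
  have := norm_image_sub_le_of_norm_deriv_le_segment' (a := 0) (b := t)
    (C := 2 * ‖B x - y‖ + t * ‖B y‖) (fun s _ => (hd s).hasDerivWithinAt) (fun s hs => ?_) t
    ⟨ht, le_rfl⟩
  · simp only [expSemigroup_zero, zero_smul, sub_zero] at this
    rw [show expSemigroup B t x - x - t • B x = expSemigroup B t x - t • B x - x by abel]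
    exact this
  · have e : expSemigroup B s (B x) - B x
        = expSemigroup B s (B x - y) - (B x - y) + (expSemigroup B s y - y) := by
      rw [map_sub]; abel
    rw [e]
    have n1 := norm_expSemigroup_le hB hs.1 (B x - y)
    have n2 := norm_expSemigroup_sub_self_le hB hs.1 y
    have n3 : s * ‖B y‖ ≤ t * ‖B y‖ := by
      have := hs.2.le
      gcongr
    have n4 := norm_add_le (expSemigroup B s (B x - y) - (B x - y)) (expSemigroup B s y - y)
    have n5 := norm_sub_le (expSemigroup B s (B x - y)) (B x - y)
    linarith

/-- Commuting dissipative generators: the semigroups differ by the integral of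
`exp((t-s)C) exp(sB) (B - C) x` over `[0,t]`. -/
lemma norm_expSemigroup_sub_le [CompleteSpace X] {B C : X →L[ℂ] X}
    (hB : ∀ x, (inner ℂ x (B x)).re ≤ 0)
    (hC : ∀ x, (inner ℂ x (C x)).re ≤ 0) (h : Commute B C) {t : ℝ} (ht : 0 ≤ t) (x : X) :
    ‖expSemigroup B t x - expSemigroup C t x‖ ≤ t * ‖B x - C x‖ := by
  have hd (s : ℝ) : HasDerivAt (fun s => expSemigroup C (t - s) (expSemigroup B s x))
      (expSemigroup C (t - s) (expSemigroup B s (B x - C x))) s := by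
    have h1 : HasDerivAt (fun s : ℝ => expSemigroup C (t - s))
        (-(expSemigroup C (t - s) * C)) s := by
      have := (hasDerivAt_exp_smul_const C (t - s)).scomp s ((hasDerivAt_id s).const_sub t)
      simpa [expSemigroup, Function.comp_def] using this
    have h2 := (hasDerivAt_expSemigroup B x s)
    have h3 : HasDerivAt (fun s => (expSemigroup C (t - s)).restrictScalars ℝ)
        ((-(expSemigroup C (t - s) * C)).restrictScalars ℝ) s :=
      (ContinuousLinearMap.restrictScalarsL ℂ X X ℝ ℝ).hasFDerivAt.comp_hasDerivAt s h1
    have h4 := h3.clm_apply h2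
    have h5 : C (expSemigroup B s x) = expSemigroup B s (C x) :=
      (congrArg (fun T : X →L[ℂ] X => T x) (expSemigroup_commute h s).eq).symm
    have e : expSemigroup C (t - s) (expSemigroup B s (B x - C x))
        = -(expSemigroup C (t - s) (C (expSemigroup B s x)))
          + expSemigroup C (t - s) (expSemigroup B s (B x)) := by
      rw [h5, map_sub, map_sub]; abel
    rw [e]
    exact h4
  have := norm_image_sub_le_of_norm_deriv_le_segment' (a := 0) (b := t) (C := ‖B x - C x‖)
    (fun s _ => (hd s).hasDerivWithinAt)
    (fun s hs => (norm_expSemigroup_le hC (by linarith [hs.2]) _).trans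
      (norm_expSemigroup_le hB hs.1 _)) t ⟨ht, le_rfl⟩
  simp only [expSemigroup_zero, sub_zero, sub_self] at this
  rw [mul_comm]
  exact this

variable {A : X →ₗ.[ℂ] X}

lemma IsResolventAt.commute {z w : ℂ} {R Q : X →L[ℂ] X} (hR : IsResolventAt A z R)
    (hQ : IsResolventAt A w Q) : Commute R Q := by
  have identity {z w : ℂ} {R Q : X →L[ℂ] X} (hR : IsResolventAt A z R)
      (hQ : IsResolventAt A w Q) (f : X) : R f + (z - w) • R (Q f) = Q f := by
    obtain ⟨hx, e⟩ := hQ.1 f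
    have h := hR.2 ⟨Q f, hx⟩
    have e2 : z • Q f - A ⟨Q f, hx⟩ = f + (z - w) • Q f := by
      generalize A ⟨Q f, hx⟩ = a at e
      have ea : a = w • Q f - f := by rw [eq_sub_iff_add_eq, add_comm, ← sub_eq_iff_eq_add.1 e]
      rw [ea, sub_smul]
      abel
    rw [← map_smul, ← map_add, ← e2]
    exact h
  by_cases hzw : z = w
  · subst hzw
    rw [hR.unique hQ]
  refine ContinuousLinearMap.ext fun f => ?_
  have h1 := identity hR hQ f
  have h2 := identity hQ hR f
  have h3 : (z - w) • (R (Q f) - Q (R f)) = 0 := by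
    have e1 : (z - w) • R (Q f) = Q f - R f := eq_sub_of_add_eq' h1
    have e2 : (w - z) • Q (R f) = R f - Q f := eq_sub_of_add_eq' h2
    rw [smul_sub, e1, ← neg_sub w z, neg_smul, e2]
    abel
  exact sub_eq_zero.1 ((smul_eq_zero.1 h3).resolve_left (sub_ne_zero.2 hzw))

/-- The Yosida approximation `n A (n - A)⁻¹ = n² (n - A)⁻¹ - n`. -/
def yosida (n : ℝ) (R : X →L[ℂ] X) : X →L[ℂ] X := ((n : ℂ) ^ 2) • R - (n : ℂ) • 1

lemma yosida_apply (n : ℝ) (R : X →L[ℂ] X) (x : X) :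
    yosida n R x = ((n : ℂ) ^ 2) • R x - (n : ℂ) • x := rfl

lemma yosida_commute {n m : ℝ} {R Q : X →L[ℂ] X} (h : Commute R Q) :
    Commute (yosida n R) (yosida m Q) := by
  have h1 : Commute (yosida n R) Q :=
    (h.smul_left _).sub_left ((Commute.one_left Q).smul_left _)
  exact (h1.smul_right _).sub_right ((Commute.one_right _).smul_right _)

lemma yosida_dissipative {n : ℝ} (hn : 0 < n) {R : X →L[ℂ] X} (hR : ‖R‖ ≤ 1 / n) (x : X) :
    (inner ℂ x (yosida n R x)).re ≤ 0 := by
  have h1 : (inner ℂ x (R x)).re ≤ ‖x‖ * (1 / n * ‖x‖) :=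
    (Complex.re_le_norm _).trans ((norm_inner_le_norm _ _).trans
      (by gcongr; exact R.le_of_opNorm_le hR x))
  have h2 : (inner ℂ x x).re = ‖x‖ ^ 2 := (norm_sq_eq_re_inner (𝕜 := ℂ) _).symm
  rw [yosida_apply, inner_sub_right, inner_smul_right, inner_smul_right, Complex.sub_re,
    ← Complex.ofReal_pow, Complex.re_ofReal_mul, Complex.re_ofReal_mul, h2]
  have h3 : n ^ 2 * (‖x‖ * (1 / n * ‖x‖)) = n * ‖x‖ ^ 2 := by field_simp
  nlinarith [mul_le_mul_of_nonneg_left h1 (sq_nonneg n)]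

lemma yosida_apply_domain {n : ℝ} {R : X →L[ℂ] X} (hR : IsResolventAt A n R) (x : A.domain) :
    yosida n R x = ((n : ℂ) • R) (A x) := by
  have h := hR.2 x
  rw [map_sub, map_smul, sub_eq_iff_eq_add] at h
  rw [yosida_apply, sq, mul_smul, h, smul_add, add_sub_cancel_left]
  rfl

lemma cauchySeq_of_dense {T : ℕ → X →L[ℂ] X} (hT : ∀ n x, ‖T n x‖ ≤ ‖x‖) {D : Set X}
    (hD : Dense D) (h : ∀ x ∈ D, CauchySeq fun n => T n x) (x : X) : CauchySeq fun n => T n x := by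
  rw [Metric.cauchySeq_iff]
  intro ε hε
  obtain ⟨y, hy, hxy⟩ := hD.exists_dist_lt x (show 0 < ε / 3 by positivity)
  obtain ⟨N, hN⟩ := Metric.cauchySeq_iff.1 (h y hy) (ε / 3) (by positivity)
  refine ⟨N, fun m hm n hn => ?_⟩
  have key (k : ℕ) : dist (T k x) (T k y) < ε / 3 := by
    rw [dist_eq_norm, ← map_sub]
    exact (hT k _).trans_lt (by rwa [← dist_eq_norm])
  have h1 := hN m hm n hn
  have h2 := dist_triangle4 (T m x) (T m y) (T n y) (T n x)
  rw [dist_comm (T n y)] at h2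
  linarith [key m, key n]

lemma tendsto_of_dense {T : ℕ → X →L[ℂ] X} (hT : ∀ n x, ‖T n x‖ ≤ ‖x‖) {D : Set X}
    (hD : Dense D) (h : ∀ x ∈ D, Tendsto (fun n => T n x) atTop (𝓝 x)) (x : X) :
    Tendsto (fun n => T n x) atTop (𝓝 x) := by
  rw [Metric.tendsto_atTop]
  intro ε hε
  obtain ⟨y, hy, hxy⟩ := hD.exists_dist_lt x (show 0 < ε / 3 by positivity)
  obtain ⟨N, hN⟩ := Metric.tendsto_atTop.1 (h y hy) (ε / 3) (by positivity)
  refine ⟨N, fun n hn => ?_⟩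
  have h1 : dist (T n x) (T n y) < ε / 3 := by
    rw [dist_eq_norm, ← map_sub]
    exact (hT n _).trans_lt (by rwa [← dist_eq_norm])
  have h2 := dist_triangle4 (T n x) (T n y) y x
  rw [dist_comm y] at h2
  linarith [hN n hn]

/-- The Yosida approximations converge to `A` on its domain. -/
lemma tendsto_yosida {R : ℕ → X →L[ℂ] X} (hR : ∀ n : ℕ, IsResolventAt A ((n + 1 : ℝ) : ℂ) (R n))
    (hRn : ∀ n : ℕ, ‖R n‖ ≤ 1 / (n + 1 : ℝ)) (hD : Dense (A.domain : Set X)) (x : A.domain) :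
    Tendsto (fun n : ℕ => yosida (n + 1) (R n) x) atTop (𝓝 (A x)) := by
  simp only [yosida_apply_domain (hR _)]
  have hpos (n : ℕ) : (0 : ℝ) < n + 1 := by positivity
  have hT (n : ℕ) (x : X) : ‖(((n + 1 : ℝ) : ℂ) • R n) x‖ ≤ ‖x‖ := by
    rw [smul_apply, norm_smul, Complex.norm_real,
      Real.norm_of_nonneg (hpos n).le]
    calc (n + 1 : ℝ) * ‖R n x‖ ≤ (n + 1) * (1 / (n + 1 : ℝ) * ‖x‖) := by
          gcongr; exact (R n).le_of_opNorm_le (hRn n) x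
      _ = ‖x‖ := by field_simp
  refine tendsto_of_dense hT hD (fun y hy => ?_) (A x)
  have e (n : ℕ) : (((n + 1 : ℝ) : ℂ) • R n) y - y = R n (A ⟨y, hy⟩) := by
    have h := (hR n).2 ⟨y, hy⟩
    rw [map_sub, map_smul, sub_eq_iff_eq_add] at h
    rw [smul_apply, h, add_sub_cancel_left]
  rw [tendsto_iff_norm_sub_tendsto_zero]
  simp only [e]
  refine squeeze_zero (fun _ => norm_nonneg _)
    (fun n => (R n).le_of_opNorm_le (hRn n) (A ⟨y, hy⟩)) ?_
  simpa using tendsto_one_div_add_atTop_nhds_zero_nat.mul_const ‖A ⟨y, hy⟩‖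

/-- **Lumer–Phillips theorem** in Hilbert space: a dissipative operator with `0` in its resolvent
set generates a semigroup, obtained as the strong limit of the exponentials of the Yosida
approximations. -/
theorem exists_semigroup_of_dissipative [CompleteSpace X]
    (hA : ∀ x : A.domain, (inner ℂ (x : X) (A x)).re ≤ 0)
    (h0 : ∃ R, IsResolventAt A 0 R) : ∃ S : C0Semigroup X, S.IsGeneratedBy A := by
  have hres (r : ℝ) (hr : 0 < r) : ∃ R, IsResolventAt A (r : ℂ) R ∧ ‖R‖ ≤ 1 / r := by
    have := exists_isResolventAt_of_dissipative hA h0 (z := (r : ℂ)) (by rwa [Complex.ofReal_re])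
    rwa [Complex.ofReal_re] at this
  choose R hR hRn using fun n : ℕ => hres (n + 1) (by positivity)
  have h1 : ∃ R, IsResolventAt A 1 R := by
    obtain ⟨R, hR, -⟩ := hres 1 one_pos
    exact ⟨R, by simpa using hR⟩
  have hD := dense_domain_of_dissipative hA h1
  set B : ℕ → X →L[ℂ] X := fun n => yosida (n + 1) (R n) with hBdef
  have hB (n : ℕ) (x : X) : (inner ℂ x (B n x)).re ≤ 0 :=
    yosida_dissipative (by positivity) (hRn n) x
  have hlim (x : A.domain) : Tendsto (fun n => B n x) atTop (𝓝 (A x)) :=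
    tendsto_yosida hR hRn hD x
  have hcauchy (t : ℝ≥0) (x : X) : CauchySeq fun n => expSemigroup (B n) t x := by
    refine cauchySeq_of_dense (fun n x => norm_expSemigroup_le (hB n) t.2 x) hD
      (fun x hx => ?_) x
    have hc := (hlim ⟨x, hx⟩).cauchySeq
    rw [Metric.cauchySeq_iff] at hc ⊢
    intro ε hε
    obtain ⟨N, hN⟩ := hc (ε / (t + 1)) (by positivity)
    refine ⟨N, fun m hm n hn => ?_⟩
    rw [dist_eq_norm]
    refine (norm_expSemigroup_sub_le (hB m) (hB n) (yosida_commute ((hR m).commute (hR n)))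
      t.2 x).trans_lt ?_
    have h3 := hN m hm n hn
    rw [dist_eq_norm, lt_div_iff₀ (by positivity)] at h3
    have h4 : 0 ≤ ‖B m x - B n x‖ := norm_nonneg _
    have h5 : ‖B m x - B n x‖ * (t + 1) < ε := h3
    change (t : ℝ) * _ < _
    nlinarith
  choose s hs using fun (t : ℝ≥0) (x : X) => cauchySeq_tendsto_of_complete (hcauchy t x)
  have hsn (t : ℝ≥0) (x : X) : ‖s t x‖ ≤ ‖x‖ :=
    le_of_tendsto (hs t x).norm
      (Eventually.of_forall fun n => norm_expSemigroup_le (hB n) t.2 x)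
  let T (t : ℝ≥0) : X →L[ℂ] X :=
    LinearMap.mkContinuous
      { toFun := s t
        map_add' := fun x y => tendsto_nhds_unique (hs t (x + y))
          (by simpa only [map_add] using (hs t x).add (hs t y))
        map_smul' := fun c x => tendsto_nhds_unique (hs t (c • x))
          (by simpa only [map_smul, RingHom.id_apply] using (hs t x).const_smul c) } 1
      fun x => by rw [one_mul]; exact hsn t x
  have hT (t : ℝ≥0) (x : X) : Tendsto (fun n => expSemigroup (B n) t x) atTop (𝓝 (T t x)) :=
    hs t x
  have hTn (t : ℝ≥0) (x : X) : ‖T t x‖ ≤ ‖x‖ := hsn t x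
  have hTadd (t u : ℝ≥0) (x : X) : T (t + u) x = T t (T u x) := by
    refine tendsto_nhds_unique (hT (t + u) x) ?_
    rw [tendsto_iff_norm_sub_tendsto_zero]
    have a1 := tendsto_iff_norm_sub_tendsto_zero.1 (hT u x)
    have a2 := tendsto_iff_norm_sub_tendsto_zero.1 (hT t (T u x))
    refine squeeze_zero (fun _ => norm_nonneg _) (fun n => ?_) (by simpa using a1.add a2)
    rw [NNReal.coe_add, expSemigroup_add]
    have e : (expSemigroup (B n) t * expSemigroup (B n) u) x - T t (T u x)
        = expSemigroup (B n) t (expSemigroup (B n) u x - T u x)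
          + (expSemigroup (B n) t (T u x) - T t (T u x)) := by
      rw [map_sub, sub_add_sub_cancel]
      rfl
    rw [e]
    exact (norm_add_le _ _).trans (by gcongr; exact norm_expSemigroup_le (hB n) t.2 _)
  have hTzero (x : X) : T 0 x = x := by
    refine tendsto_nhds_unique (hT 0 x) ?_
    simp [expSemigroup_zero]
  have hTlip (t : ℝ≥0) (x : A.domain) : ‖T t x - x‖ ≤ t * ‖A x‖ :=
    le_of_tendsto_of_tendsto ((hT t x).sub_const _).norm ((hlim x).norm.const_mul (t : ℝ))
      (Eventually.of_forall fun n => norm_expSemigroup_sub_self_le (hB n) t.2 _)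
  have hTlip2 (t u : ℝ≥0) (x : A.domain) : dist (T t x) (T u x) ≤ ‖A x‖ * dist t u := by
    wlog h : u ≤ t generalizing t u
    · rw [dist_comm, dist_comm t]; exact this u t (le_of_not_ge h)
    obtain ⟨r, rfl⟩ := exists_add_of_le h
    rw [hTadd, dist_eq_norm, ← map_sub]
    refine (hTn _ _).trans ((hTlip r x).trans_eq ?_)
    rw [NNReal.dist_eq, NNReal.coe_add, add_sub_cancel_left, NNReal.abs_eq, mul_comm]
  have hcont (x : X) : Continuous fun t => T t x := by
    rw [Metric.continuous_iff]
    intro t ε hε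
    obtain ⟨y, hy, hxy⟩ := hD.exists_dist_lt x (show 0 < ε / 3 by positivity)
    refine ⟨ε / 3 / (‖A ⟨y, hy⟩‖ + 1), by positivity, fun u hu => ?_⟩
    have key (u : ℝ≥0) : dist (T u x) (T u y) < ε / 3 := by
      rw [dist_eq_norm, ← map_sub]
      exact (hTn u _).trans_lt (by rwa [← dist_eq_norm])
    have h2 := dist_triangle4 (T u x) (T u y) (T t y) (T t x)
    have h3 := hTlip2 u t ⟨y, hy⟩
    rw [lt_div_iff₀ (by positivity)] at hu
    rw [dist_comm (T t y)] at h2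
    have h4 : 0 ≤ dist u t := dist_nonneg
    have h5 : dist (T u y) (T t y) ≤ ‖A ⟨y, hy⟩‖ * dist u t := h3
    nlinarith [key u, key t]
  let S : C0Semigroup X :=
    { toFun := T
      map_zero := ContinuousLinearMap.ext hTzero
      map_add := fun t u => ContinuousLinearMap.ext (hTadd t u)
      continuous_orbit := hcont }
  -- `A x` need not lie in the domain; it is approximated by `y` there, on which the orbits are
  -- Lipschitz continuous
  have hexp (t : ℝ≥0) (x y : A.domain) :
      ‖T t x - x - (t : ℝ) • A x‖ ≤ (2 * ‖A x - y‖ + t * ‖A y‖) * t :=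
    le_of_tendsto_of_tendsto (((hT t x).sub_const _).sub ((hlim x).const_smul (t : ℝ))).norm
      ((((((hlim x).sub_const _).norm).const_mul 2).add
        ((hlim y).norm.const_mul (t : ℝ))).mul_const (t : ℝ))
      (Eventually.of_forall fun n => norm_expSemigroup_expansion_le (hB n) t.2 _ _)
  have hgen (x : A.domain) :
      Tendsto (fun t : ℝ≥0 => ((t : ℝ)⁻¹ : ℂ) • (T t x - x)) (𝓝[>] 0) (𝓝 (A x)) := by
    rw [Metric.tendsto_nhds]
    intro ε hε
    obtain ⟨y, hy, hxy⟩ := hD.exists_dist_lt (A x) (show 0 < ε / 4 by positivity)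
    have hδ : (0 : ℝ) < ε / 2 / (‖A ⟨y, hy⟩‖ + 1) := by positivity
    have hnear : ∀ᶠ t : ℝ≥0 in 𝓝[>] 0, (t : ℝ) < ε / 2 / (‖A ⟨y, hy⟩‖ + 1) :=
      nhdsWithin_le_nhds ((NNReal.continuous_coe.tendsto 0).eventually (gt_mem_nhds hδ))
    filter_upwards [hnear, self_mem_nhdsWithin] with t ht ht0
    have ht0' : (0 : ℝ) < t := ht0
    have h2 := hexp t x ⟨y, hy⟩
    have e : ((t : ℝ)⁻¹ : ℂ) • (T t x - x) - A x
        = ((t : ℝ)⁻¹ : ℂ) • (T t x - x - (t : ℝ) • A x) := by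
      rw [smul_sub (_ : ℂ) (T t x - x)]
      congr 1
      rw [← Complex.coe_smul (t : ℝ), smul_smul, inv_mul_cancel₀ (by exact_mod_cast ht0'.ne'),
        one_smul]
    rw [dist_eq_norm, e, norm_smul, norm_inv, Complex.norm_real, Real.norm_of_nonneg ht0'.le,
      ← div_eq_inv_mul, div_lt_iff₀ ht0']
    refine h2.trans_lt ?_
    gcongr
    rw [lt_div_iff₀ (by positivity)] at ht
    rw [dist_eq_norm] at hxy
    change 2 * ‖A x - y‖ + _ < _
    nlinarith
  refine ⟨S, fun x y => ⟨?_, fun h => ?_⟩⟩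
  · rintro ⟨hx, rfl⟩
    exact hgen ⟨x, hx⟩
  -- the generator of `S` is dissipative and extends `A`, while `1 - A` is onto
  · obtain ⟨R₁, hR₁⟩ := h1
    obtain ⟨hw, e⟩ := hR₁.1 (x - y)
    set w := R₁ (x - y) with hwdef
    have hz : Tendsto (fun t : ℝ≥0 => ((t : ℝ)⁻¹ : ℂ) • (T t (x - w) - (x - w))) (𝓝[>] 0)
        (𝓝 (x - w)) := by
      have h3 := h.sub (hgen ⟨w, hw⟩)
      have e2 : y - A ⟨w, hw⟩ = x - w := by
        generalize A ⟨w, hw⟩ = a at e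
        rw [one_smul, sub_eq_iff_eq_add] at e
        have e' : w = x - y + a := e
        rw [e']; abel
      rw [e2] at h3
      refine h3.congr fun t => ?_
      rw [← smul_sub, map_sub]
      congr 1
      change T t x - x - (T t w - w) = _
      abel
    have hle : (inner ℂ (x - w) (x - w)).re ≤ 0 := by
      refine le_of_tendsto ((Complex.continuous_re.tendsto _).comp
        ((continuous_const.inner continuous_id).tendsto (x - w) |>.comp hz)) ?_
      filter_upwards [self_mem_nhdsWithin] with t ht
      have ht0' : (0 : ℝ) < t := ht
      simp only [Function.comp_apply, id_eq]
      rw [inner_smul_right, ← Complex.ofReal_inv, Complex.re_ofReal_mul, inner_sub_right,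
        Complex.sub_re]
      refine mul_nonpos_of_nonneg_of_nonpos (by positivity) ?_
      have h4 : (inner ℂ (x - w) (T t (x - w))).re ≤ ‖x - w‖ * ‖x - w‖ :=
        (Complex.re_le_norm _).trans ((norm_inner_le_norm _ _).trans
          (by gcongr; exact hTn t _))
      have h5 : (inner ℂ (x - w) (x - w)).re = ‖x - w‖ ^ 2 :=
        (norm_sq_eq_re_inner (𝕜 := ℂ) _).symm
      nlinarith
    have h5 : (inner ℂ (x - w) (x - w)).re = ‖x - w‖ ^ 2 :=
      (norm_sq_eq_re_inner (𝕜 := ℂ) _).symm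
    have h6 : x = w := by
      have : ‖x - w‖ ^ 2 = 0 := le_antisymm (h5 ▸ hle) (sq_nonneg _)
      simpa [sub_eq_zero] using this
    have hx : x ∈ A.domain := h6 ▸ hw
    exact ⟨hx, tendsto_nhds_unique (hgen ⟨x, hx⟩) h⟩


/-- Along an exponentially stable semigroup `e^{-irt} S(t) x` moves `x` by at most
`(M / a) ‖(ir - A) x‖`, and it tends to `0`. -/
lemma exists_bound_of_isExponentiallyStable {S : C0Semigroup X} (hS : S.IsGeneratedBy A)
    (hst : S.IsExponentiallyStable) :
    ∃ C : ℝ, ∀ (r : ℝ) (x : A.domain), ‖(x : X)‖ ≤ C * ‖(Complex.I * r) • (x : X) - A x‖ := by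
  obtain ⟨M, a, hM, ha, hb⟩ := hst
  refine ⟨M / a, fun r x => ?_⟩
  set y : X := A x - (Complex.I * r) • (x : X) with hy
  set g : ℝ → X := fun t => Complex.exp (-(Complex.I * r) * t) • S.toFun t.toNNReal x with hg
  have hexp (t : ℝ) : ‖Complex.exp (-(Complex.I * r) * t)‖ = 1 := by
    rw [Complex.norm_exp]
    simp
  have hSd (t : ℝ) (ht : 0 ≤ t) : HasDerivWithinAt (fun t : ℝ => S.toFun t.toNNReal x)
      (S.toFun t.toNNReal (A x)) (Ici t) t := by
    have h0 := (hS x (A x)).1 ⟨x.2, rfl⟩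
    have h1 := ((S.toFun t.toNNReal).continuous.tendsto _).comp h0
    rw [hasDerivWithinAt_iff_tendsto_slope]
    have hmap : Tendsto (fun u : ℝ => (u - t).toNNReal) (𝓝[Ici t \ {t}] t) (𝓝[>] 0) := by
      refine tendsto_nhdsWithin_iff.2 ⟨?_, ?_⟩
      · have hc : Continuous fun u : ℝ => (u - t).toNNReal := by fun_prop
        have := hc.tendsto t
        rw [sub_self, Real.toNNReal_zero] at this
        exact this.mono_left nhdsWithin_le_nhds
      · filter_upwards [self_mem_nhdsWithin] with u hu
        exact Real.toNNReal_pos.2 (sub_pos.2 (lt_of_le_of_ne hu.1 (Ne.symm hu.2)))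
    refine (h1.comp hmap).congr' ?_
    filter_upwards [self_mem_nhdsWithin] with u hu
    have hut : 0 ≤ u - t := sub_nonneg.2 hu.1
    have e : S.toFun u.toNNReal x = S.toFun t.toNNReal (S.toFun (u - t).toNNReal x) := by
      rw [← ContinuousLinearMap.comp_apply, ← S.map_add, ← Real.toNNReal_add ht hut,
        add_sub_cancel]
    simp only [Function.comp_apply, slope_def_module, e, map_smul, map_sub,
      Real.coe_toNNReal _ hut]
    rw [← Complex.ofReal_inv, Complex.coe_smul]
  have hgd (t : ℝ) (ht : 0 ≤ t) : HasDerivWithinAt g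
      (Complex.exp (-(Complex.I * r) * t) • S.toFun t.toNNReal y) (Ici t) t := by
    have h1 : HasDerivWithinAt (fun t : ℝ => Complex.exp (-(Complex.I * r) * t))
        (Complex.exp (-(Complex.I * r) * t) * (-(Complex.I * r))) (Ici t) t := by
      have := ((hasDerivAt_id t).ofReal_comp.const_mul (-(Complex.I * r))).cexp
      simpa using this.hasDerivWithinAt
    have h2 := h1.smul (hSd t ht)
    have e : Complex.exp (-(Complex.I * r) * t) • S.toFun t.toNNReal y
        = Complex.exp (-(Complex.I * r) * t) • S.toFun t.toNNReal (A x)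
          + (Complex.exp (-(Complex.I * r) * t) * (-(Complex.I * r))) • S.toFun t.toNNReal x := by
      rw [hy, map_sub, map_smul, smul_sub, smul_smul, mul_neg, neg_smul, sub_eq_add_neg]
    rw [e]
    exact h2
  have hmain (T : ℝ) (hT : 0 ≤ T) : ‖g T - x‖ ≤ M / a * ‖y‖ := by
    have hBd (t : ℝ) : HasDerivAt (fun t : ℝ => M / a * ‖y‖ * (1 - Real.exp (-a * t)))
        (M * Real.exp (-a * t) * ‖y‖) t := by
      have h1 : HasDerivAt (fun t : ℝ => -a * t) (-a) t := by
        simpa using (hasDerivAt_id t).const_mul (-a)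
      have h2 := (h1.exp.const_sub 1).const_mul (M / a * ‖y‖)
      refine h2.congr_deriv ?_
      field_simp
    have hgc : ContinuousOn (fun t => g t - x) (Icc 0 T) := by
      refine Continuous.continuousOn (Continuous.sub (Continuous.smul (by fun_prop) ?_)
        continuous_const)
      exact (S.continuous_orbit x).comp continuous_real_toNNReal
    have h0 : g 0 - x = 0 := by
      simp [hg, S.map_zero]
    have := image_norm_le_of_norm_deriv_right_le_deriv_boundary hgc
      (fun t ht => (hgd t ht.1).sub_const (x : X)) (by rw [h0]; simp) hBd
      (fun t ht => by
        rw [norm_smul, hexp, one_mul]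
        have := hb t.toNNReal y
        rwa [Real.coe_toNNReal _ ht.1] at this) (x := T) ⟨hT, le_rfl⟩
    refine this.trans ?_
    have h3 : 0 ≤ M / a * ‖y‖ := by positivity
    nlinarith [Real.exp_pos (-a * T)]
  have hlim : Tendsto (fun T : ℝ => M / a * ‖y‖ + M * Real.exp (-a * T) * ‖(x : X)‖) atTop
      (𝓝 (M / a * ‖y‖ + M * 0 * ‖(x : X)‖)) := by
    refine tendsto_const_nhds.add ((Tendsto.const_mul M ?_).mul_const _)
    refine Real.tendsto_exp_atBot.comp ?_
    exact tendsto_id.const_mul_atTop_of_neg (neg_lt_zero.2 ha)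
  have hy' : ‖(Complex.I * r) • (x : X) - A x‖ = ‖y‖ := by rw [hy, norm_sub_rev]
  rw [hy']
  simp only [mul_zero, zero_mul, add_zero] at hlim
  refine ge_of_tendsto hlim ?_
  filter_upwards [eventually_ge_atTop 0] with T hT
  have h1 : ‖g T‖ ≤ M * Real.exp (-a * T) * ‖(x : X)‖ := by
    rw [hg]
    simp only [norm_smul, hexp, one_mul]
    have := hb T.toNNReal x
    rwa [Real.coe_toNNReal _ hT] at this
  have h2 := norm_sub_norm_le (x : X) (g T)
  rw [norm_sub_rev] at h2
  linarith [hmain T hT]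

end Generation

/-! ### The energy space -/

lemma IsWeakDeriv.mem_H1 {ℓ : ℝ} {f g : L2 ℓ} (h : IsWeakDeriv f g) : f ∈ H1 ℓ := ⟨g, h⟩

lemma mem_H2_of_isWeakDeriv {ℓ : ℝ} {f g h : L2 ℓ} (hf : IsWeakDeriv f g) (hg : IsWeakDeriv g h) :
    f ∈ H2 ℓ :=
  ⟨hf.mem_H1, by rw [hf.weakDeriv_eq]; exact hg.mem_H1⟩

lemma weakDeriv2_eq {ℓ : ℝ} {f g h : L2 ℓ} (hf : IsWeakDeriv f g) (hg : IsWeakDeriv g h) :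
    weakDeriv2 f = h := by
  rw [weakDeriv2, hf.weakDeriv_eq, hg.weakDeriv_eq]

lemma isWeakDeriv_weakDeriv2 {ℓ : ℝ} {f : L2 ℓ} (hf : f ∈ H2 ℓ) :
    IsWeakDeriv (weakDeriv f) (weakDeriv2 f) := isWeakDeriv_weakDeriv hf.2

/-- The primitive of `g` that vanishes at `ℓ`. -/
def volterraRight {ℓ : ℝ} (g : L2 ℓ) : L2 ℓ := cst (-prim g ℓ) + volterra ℓ g

lemma isWeakDeriv_volterraRight {ℓ : ℝ} (g : L2 ℓ) : IsWeakDeriv (volterraRight g) g :=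
  isWeakDeriv_cst_add_volterra _ _

lemma hasTrace_volterra_zero {ℓ : ℝ} (g : L2 ℓ) : HasTrace (volterra ℓ g) 0 0 := by
  simpa [prim_zero, volterra_apply] using hasTrace_ofCont (ℓ := ℓ) 0 (continuous_prim g)

lemma hasTrace_volterraRight {ℓ : ℝ} (g : L2 ℓ) : HasTrace (volterraRight g) ℓ 0 := by
  simpa [volterraRight] using hasTrace_cst_add_volterra ℓ (-prim g ℓ) g

lemma hasTrace_volterraRight_zero {ℓ : ℝ} (g : L2 ℓ) :
    HasTrace (volterraRight g) 0 (-prim g ℓ) := by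
  simpa [prim_zero, volterraRight] using hasTrace_cst_add_volterra 0 (-prim g ℓ) g

lemma IsWeakDeriv.eq_volterraRight {ℓ : ℝ} (hℓ : 0 < ℓ) {f g : L2 ℓ} (h : IsWeakDeriv f g)
    (h1 : HasTrace f ℓ 0) : f = volterraRight g := by
  obtain ⟨c, rfl⟩ := h.exists_eq hℓ
  have := h1.unique hℓ ⟨hℓ.le, le_rfl⟩ (hasTrace_cst_add_volterra ℓ c g)
  rw [volterraRight, eq_neg_of_add_eq_zero_left this.symm]

namespace StringBeam

variable (p : StringBeam)

lemma norm_sq (y : p.EnergySpace) : ‖y‖ ^ 2 = p.α₁ * ‖weakDeriv y.u₁‖ ^ 2 + ‖y.v₁‖ ^ 2 +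
      p.δ₂ / p.β₂ * (p.α₂ * ‖weakDeriv2 y.u₂‖ ^ 2 + ‖y.v₂‖ ^ 2) + ‖y.θ₂‖ ^ 2 +
      p.γ₂ * p.τ₂ / p.κ₂ * ‖y.q₂‖ ^ 2 := by
  rw [← re_energyInner_self]
  exact norm_sq_eq_re_inner (𝕜 := ℂ) y

lemma exists_component_bound : ∃ C, 0 < C ∧ ∀ y : p.EnergySpace,
    ‖weakDeriv y.u₁‖ ≤ C * ‖y‖ ∧ ‖weakDeriv2 y.u₂‖ ≤ C * ‖y‖ ∧ ‖y.v₁‖ ≤ C * ‖y‖ ∧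
    ‖y.v₂‖ ≤ C * ‖y‖ ∧ ‖y.θ₂‖ ≤ C * ‖y‖ ∧ ‖y.q₂‖ ≤ C * ‖y‖ := by
  have a1 := p.α₁_pos; have a2 := p.α₂_pos; have hb := p.β₂_pos; have hg := p.γ₂_pos
  have hd := p.δ₂_pos; have ht := p.τ₂_pos; have hk := p.κ₂_pos
  have key {c x E : ℝ} (hc : 0 < c) (hx : 0 ≤ x) (hE : 0 ≤ E) (h : c * x ^ 2 ≤ E ^ 2) :
      x ≤ (√c)⁻¹ * E := by
    rw [← div_eq_inv_mul, le_div_iff₀ (Real.sqrt_pos.2 hc)]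
    refine le_of_sq_le_sq ?_ hE
    rw [mul_pow, Real.sq_sqrt hc.le]
    linarith
  set C := (√p.α₁)⁻¹ + (√(p.δ₂ / p.β₂ * p.α₂))⁻¹ + (√1)⁻¹ + (√(p.δ₂ / p.β₂))⁻¹
    + (√(p.γ₂ * p.τ₂ / p.κ₂))⁻¹ with hC
  have c1 : 0 ≤ (√p.α₁)⁻¹ := by positivity
  have c2 : 0 ≤ (√(p.δ₂ / p.β₂ * p.α₂))⁻¹ := by positivity
  have c3 : 0 < (√(1 : ℝ))⁻¹ := by positivity
  have c4 : 0 ≤ (√(p.δ₂ / p.β₂))⁻¹ := by positivity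
  have c5 : 0 ≤ (√(p.γ₂ * p.τ₂ / p.κ₂))⁻¹ := by positivity
  refine ⟨C, by linarith, fun y => ?_⟩
  have hn := p.norm_sq y
  have t1 : 0 ≤ p.α₁ * ‖weakDeriv y.u₁‖ ^ 2 := by positivity
  have t2 : 0 ≤ ‖y.v₁‖ ^ 2 := by positivity
  have t3 : 0 ≤ p.δ₂ / p.β₂ * p.α₂ * ‖weakDeriv2 y.u₂‖ ^ 2 := by positivity
  have t4 : 0 ≤ p.δ₂ / p.β₂ * ‖y.v₂‖ ^ 2 := by positivity
  have t5 : 0 ≤ ‖y.θ₂‖ ^ 2 := by positivity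
  have t6 : 0 ≤ p.γ₂ * p.τ₂ / p.κ₂ * ‖y.q₂‖ ^ 2 := by positivity
  have hE := norm_nonneg y
  rw [mul_add, ← mul_assoc] at hn
  have fin {x c : ℝ} (h : x ≤ c * ‖y‖) (hc : c ≤ C) : x ≤ C * ‖y‖ :=
    h.trans (mul_le_mul_of_nonneg_right hc hE)
  refine ⟨fin (key a1 (norm_nonneg _) hE ?_) ?_,
    fin (key (show 0 < p.δ₂ / p.β₂ * p.α₂ by positivity) (norm_nonneg _) hE ?_) ?_,
    fin (key one_pos (norm_nonneg _) hE ?_) ?_,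
    fin (key (show 0 < p.δ₂ / p.β₂ by positivity) (norm_nonneg _) hE ?_) ?_,
    fin (key one_pos (norm_nonneg _) hE ?_) ?_,
    fin (key (show 0 < p.γ₂ * p.τ₂ / p.κ₂ by positivity) (norm_nonneg _) hE ?_) ?_⟩ <;> linarith

lemma tendsto_zero_of_components {y : ℕ → p.EnergySpace}
    (h1 : Tendsto (fun n => weakDeriv (y n).u₁) atTop (𝓝 0))
    (h2 : Tendsto (fun n => weakDeriv2 (y n).u₂) atTop (𝓝 0))
    (h3 : Tendsto (fun n => (y n).v₁) atTop (𝓝 0)) (h4 : Tendsto (fun n => (y n).v₂) atTop (𝓝 0))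
    (h5 : Tendsto (fun n => (y n).θ₂) atTop (𝓝 0)) (h6 : Tendsto (fun n => (y n).q₂) atTop (𝓝 0)) :
    Tendsto y atTop (𝓝 0) := by
  have h : Tendsto (fun n => ‖y n‖ ^ 2) atTop (𝓝 0) := by
    simp only [norm_sq]
    have := (((((h1.norm.pow 2).const_mul p.α₁).add (h3.norm.pow 2)).add
      ((((h2.norm.pow 2).const_mul p.α₂).add (h4.norm.pow 2)).const_mul (p.δ₂ / p.β₂))).add
      (h5.norm.pow 2)).add ((h6.norm.pow 2).const_mul (p.γ₂ * p.τ₂ / p.κ₂))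
    simpa using this
  rw [tendsto_zero_iff_norm_tendsto_zero]
  have h' := (Real.continuous_sqrt.tendsto 0).comp h
  simpa [Function.comp_def] using h'

/-- A pair in `V` is determined by `(f₁', f₂'')`; the coupling at `0` is one linear condition. -/
lemma eq_of_mem_V {f : L2 p.ℓ₁ × L2 p.ℓ₂} (hf : f ∈ p.V) :
    f.1 = volterraRight (weakDeriv f.1) ∧
    f.2 = volterraRight (volterra p.ℓ₂ (weakDeriv2 f.2)) ∧
    weakDeriv f.2 = volterra p.ℓ₂ (weakDeriv2 f.2) ∧
    prim (weakDeriv f.1) p.ℓ₁ = prim (volterra p.ℓ₂ (weakDeriv2 f.2)) p.ℓ₂ := by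
  obtain ⟨h1, h2, h3, h4, ⟨c, h5, h6⟩, h7⟩ := hf
  have e1 := (isWeakDeriv_weakDeriv h1).eq_volterraRight p.ℓ₁_pos h3
  have e2 : weakDeriv f.2 = volterra p.ℓ₂ (weakDeriv2 f.2) := by
    have := (isWeakDeriv_weakDeriv2 h2).eq_of_hasTrace_zero p.ℓ₂_pos h7
    rwa [cst_eq_smul, zero_smul, zero_add] at this
  have e3 := (isWeakDeriv_weakDeriv h2.1).eq_volterraRight p.ℓ₂_pos h4
  rw [e2] at e3
  refine ⟨e1, e3, e2, ?_⟩
  rw [e1] at h5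
  rw [e3] at h6
  have n1 := h5.unique p.ℓ₁_pos ⟨le_rfl, p.ℓ₁_pos.le⟩ (hasTrace_volterraRight_zero _)
  have n2 := h6.unique p.ℓ₂_pos ⟨le_rfl, p.ℓ₂_pos.le⟩ (hasTrace_volterraRight_zero _)
  exact neg_injective (n1.symm.trans n2)

lemma volterraRight_mem_V {a : L2 p.ℓ₁} {b : L2 p.ℓ₂}
    (h : prim a p.ℓ₁ = prim (volterra p.ℓ₂ b) p.ℓ₂) :
    (volterraRight a, volterraRight (volterra p.ℓ₂ b)) ∈ p.V := by
  refine ⟨(isWeakDeriv_volterraRight a).mem_H1, mem_H2_of_isWeakDeriv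
    (isWeakDeriv_volterraRight _) (isWeakDeriv_volterra b), hasTrace_volterraRight _,
    hasTrace_volterraRight _, ⟨_, hasTrace_volterraRight_zero _, ?_⟩, ?_⟩
  · rw [h]; exact hasTrace_volterraRight_zero _
  · rw [(isWeakDeriv_volterraRight _).weakDeriv_eq]
    exact hasTrace_volterra_zero b

variable {p} in
/-- The state with the given components. -/
def mkState {f : L2 p.ℓ₁ × L2 p.ℓ₂} (hf : f ∈ p.V) (v₁ : L2 p.ℓ₁) (v₂ θ q : L2 p.ℓ₂) :
    p.EnergySpace := (⟨f, hf⟩, (v₁, v₂), θ, q)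

instance : CompleteSpace p.EnergySpace := by
  refine Metric.complete_of_cauchySeq_tendsto fun y hy => ?_
  obtain ⟨C, hC, hb⟩ := p.exists_component_bound
  have cau {ℓ : ℝ} (g : p.EnergySpace → L2 ℓ) (hg : ∀ x z, ‖g x - g z‖ ≤ C * ‖x - z‖) :
      ∃ a, Tendsto (fun n => g (y n)) atTop (𝓝 a) := by
    refine cauchySeq_tendsto_of_complete ?_
    refine (LipschitzWith.of_dist_le_mul (K := ⟨C, hC.le⟩)
      fun x z => ?_).uniformContinuous.comp_cauchySeq hy
    rw [dist_eq_norm, dist_eq_norm]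
    exact hg x z
  have sub (x z : p.EnergySpace) : x - z = x + (-1 : ℂ) • z := by simp [sub_eq_add_neg]
  have s1 (x z : p.EnergySpace) : weakDeriv (x - z).u₁ = weakDeriv x.u₁ - weakDeriv z.u₁ := by
    rw [sub, EnergySpace.u₁_add, EnergySpace.u₁_smul,
      weakDeriv_add x.u₁_mem (Submodule.smul_mem _ _ z.u₁_mem), weakDeriv_smul _ z.u₁_mem]
    simp [sub_eq_add_neg]
  have s2 (x z : p.EnergySpace) : weakDeriv2 (x - z).u₂ = weakDeriv2 x.u₂ - weakDeriv2 z.u₂ := by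
    rw [sub, EnergySpace.u₂_add, EnergySpace.u₂_smul,
      weakDeriv2_add x.u₂_mem (Submodule.smul_mem _ _ z.u₂_mem), weakDeriv2_smul _ z.u₂_mem]
    simp [sub_eq_add_neg]
  obtain ⟨a, ha⟩ := cau (fun y => weakDeriv y.u₁) fun x z => by
    rw [← s1]; exact (hb _).1
  obtain ⟨b, hb'⟩ := cau (fun y => weakDeriv2 y.u₂) fun x z => by
    rw [← s2]; exact (hb _).2.1
  obtain ⟨v₁, hv₁⟩ := cau (fun y => y.v₁) fun x z => (hb (x - z)).2.2.1
  obtain ⟨v₂, hv₂⟩ := cau (fun y => y.v₂) fun x z => (hb (x - z)).2.2.2.1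
  obtain ⟨θ, hθ⟩ := cau (fun y => y.θ₂) fun x z => (hb (x - z)).2.2.2.2.1
  obtain ⟨q, hq⟩ := cau (fun y => y.q₂) fun x z => (hb (x - z)).2.2.2.2.2
  have hab : prim a p.ℓ₁ = prim (volterra p.ℓ₂ b) p.ℓ₂ := by
    rw [prim_length p.ℓ₁_pos.le, prim_length p.ℓ₂_pos.le]
    have t1 := tendsto_const_nhds (x := (cst 1 : L2 p.ℓ₁)).inner ha (𝕜 := ℂ)
    have t2 := tendsto_const_nhds (x := (cst 1 : L2 p.ℓ₂)).inner
      (((volterra p.ℓ₂).continuous.tendsto b).comp hb') (𝕜 := ℂ)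
    refine tendsto_nhds_unique t1 (t2.congr fun n => ?_)
    have := (p.eq_of_mem_V (y n).mem_V).2.2.2
    rw [prim_length p.ℓ₁_pos.le, prim_length p.ℓ₂_pos.le] at this
    exact this.symm
  refine ⟨mkState (p.volterraRight_mem_V hab) v₁ v₂ θ q, ?_⟩
  rw [← tendsto_sub_nhds_zero_iff]
  have c0 {ℓ : ℝ} {g : ℕ → L2 ℓ} {a : L2 ℓ} (h : Tendsto g atTop (𝓝 a)) :
      Tendsto (fun n => g n - a) atTop (𝓝 0) := tendsto_sub_nhds_zero_iff.2 h
  refine p.tendsto_zero_of_components ?_ ?_ (c0 hv₁) (c0 hv₂) (c0 hθ) (c0 hq)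
  · have e : weakDeriv (mkState (p.volterraRight_mem_V hab) v₁ v₂ θ q).u₁ = a :=
      (isWeakDeriv_volterraRight a).weakDeriv_eq
    simp only [s1, e]
    exact c0 ha
  · have e : weakDeriv2 (mkState (p.volterraRight_mem_V hab) v₁ v₂ θ q).u₂ = b :=
      weakDeriv2_eq (isWeakDeriv_volterraRight _) (isWeakDeriv_volterra b)
    simp only [s2, e]
    exact c0 hb'

/-! ### Dissipativity -/

variable {p}

/-- The weak form of the momentum balance: the transmission conditions at `0` and the boundary
conditions at the far ends remove all boundary terms. -/
lemma inner_momentum {y : p.EnergySpace} (hy : y ∈ p.domain) {w : L2 p.ℓ₁ × L2 p.ℓ₂}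
    (hw : w ∈ p.V) :
    (p.α₁ : ℂ) * inner ℂ (weakDeriv2 y.u₁) w.1
      + ((p.δ₂ / p.β₂ : ℝ) : ℂ) * inner ℂ (weakDeriv2 (p.moment y)) w.2
    = -((p.α₁ : ℂ) * inner ℂ (weakDeriv y.u₁) (weakDeriv w.1))
      + ((p.δ₂ / p.β₂ : ℝ) : ℂ) * inner ℂ (p.moment y) (weakDeriv2 w.2) := by
  obtain ⟨-, y2, ⟨-, -, y5⟩, -, y7, y8, c, d, y9, y10, y11⟩ := hy
  obtain ⟨w1, w2, w3, w4, ⟨e, w5, w6⟩, w7⟩ := hw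
  have hM : HasTrace (p.moment y) p.ℓ₂ 0 := by
    simpa [moment] using (y8.smul (-(p.α₂ : ℂ))).add (y5.smul (p.β₂ : ℂ))
  obtain ⟨a1, ha1⟩ := (isWeakDeriv_weakDeriv2 y2).exists_hasTrace p.ℓ₁_pos p.ℓ₁
  obtain ⟨a2, ha2⟩ := (isWeakDeriv_weakDeriv2 y7).exists_hasTrace p.ℓ₂_pos p.ℓ₂
  obtain ⟨a3, ha3⟩ := (isWeakDeriv_weakDeriv y7.1).exists_hasTrace p.ℓ₂_pos 0
  obtain ⟨a4, ha4⟩ := (isWeakDeriv_weakDeriv2 w2).exists_hasTrace p.ℓ₂_pos p.ℓ₂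
  have i1 := (isWeakDeriv_weakDeriv2 y2).inner_add_inner p.ℓ₁_pos (isWeakDeriv_weakDeriv w1)
    y10 ha1 w5 w3
  have i2 := (isWeakDeriv_weakDeriv2 y7).inner_add_inner p.ℓ₂_pos (isWeakDeriv_weakDeriv w2.1)
    y9 ha2 w6 w4
  have i3 := (isWeakDeriv_weakDeriv y7.1).inner_add_inner p.ℓ₂_pos (isWeakDeriv_weakDeriv2 w2)
    ha3 hM w7 ha4
  have y11' := congrArg star y11
  simp only [star_mul, Complex.star_def, Complex.conj_ofReal] at y11'
  simp only [star_neg, Complex.star_def, map_zero] at i1 i2 i3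
  linear_combination (p.α₁ : ℂ) * i1 + ((p.δ₂ / p.β₂ : ℝ) : ℂ) * (i2 - i3) + e * y11'

/-- Energy is dissipated by the heat flux only. -/
lemma re_inner_A₂ (y : p.A₂.domain) :
    (inner ℂ (y : p.EnergySpace) (p.A₂ y)).re = -(p.γ₂ / p.κ₂ * ‖(y : p.EnergySpace).q₂‖ ^ 2) := by
  obtain ⟨y, hy⟩ := y
  have hi := inner_momentum hy hy.1
  obtain ⟨y1, y2, ⟨y3, y4, y5⟩, y6, y7, -⟩ := id hy
  obtain ⟨b0, hb0⟩ := (isWeakDeriv_weakDeriv y6).exists_hasTrace p.ℓ₂_pos 0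
  obtain ⟨b1, hb1⟩ := (isWeakDeriv_weakDeriv y6).exists_hasTrace p.ℓ₂_pos p.ℓ₂
  have hq := (isWeakDeriv_weakDeriv y3).inner_add_inner p.ℓ₂_pos (isWeakDeriv_weakDeriv y6)
    y4 y5 hb0 hb1
  have hb := p.β₂_pos; have hk := p.κ₂_pos; have ht := p.τ₂_pos
  have e : inner ℂ y (p.A₂ ⟨y, hy⟩) = (p.α₁ : ℂ) * inner ℂ (weakDeriv y.u₁) (weakDeriv y.v₁) +
      inner ℂ y.v₁ ((p.α₁ : ℂ) • weakDeriv2 y.u₁) + ((p.δ₂ / p.β₂ : ℝ) : ℂ) *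
        ((p.α₂ : ℂ) * inner ℂ (weakDeriv2 y.u₂) (weakDeriv2 y.v₂) +
          inner ℂ y.v₂ (weakDeriv2 (p.moment y))) +
      inner ℂ y.θ₂ ((-(p.δ₂ : ℂ)) • weakDeriv2 y.v₂ - (p.γ₂ : ℂ) • weakDeriv y.q₂) +
      ((p.γ₂ * p.τ₂ / p.κ₂ : ℝ) : ℂ) * inner ℂ y.q₂ ((-((1 / p.τ₂ : ℝ) : ℂ)) • y.q₂
        - ((p.κ₂ / p.τ₂ : ℝ) : ℂ) • weakDeriv y.θ₂) := rfl
  have hm : inner ℂ (p.moment y) (weakDeriv2 y.v₂)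
      = -(p.α₂ : ℂ) * inner ℂ (weakDeriv2 y.u₂) (weakDeriv2 y.v₂)
        + (p.β₂ : ℂ) * inner ℂ y.θ₂ (weakDeriv2 y.v₂) := by
    rw [moment, inner_add_left, inner_smul_left, inner_smul_left, map_neg, Complex.conj_ofReal,
      Complex.conj_ofReal]
  have hi' := congrArg Complex.re hi
  have hq' := congrArg Complex.re hq
  have n1 : (inner ℂ y.q₂ y.q₂).re = ‖y.q₂‖ ^ 2 := (norm_sq_eq_re_inner (𝕜 := ℂ) _).symm
  have n2 : (inner ℂ y.v₁ (weakDeriv2 y.u₁)).re = (inner ℂ (weakDeriv2 y.u₁) y.v₁).re :=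
    inner_re_symm (𝕜 := ℂ) _ _
  have n3 : (inner ℂ y.v₂ (weakDeriv2 (p.moment y))).re
      = (inner ℂ (weakDeriv2 (p.moment y)) y.v₂).re := inner_re_symm (𝕜 := ℂ) _ _
  have n4 : (inner ℂ y.q₂ (weakDeriv y.θ₂)).re = (inner ℂ (weakDeriv y.θ₂) y.q₂).re :=
    inner_re_symm (𝕜 := ℂ) _ _
  change (inner ℂ y (p.A₂ ⟨y, hy⟩)).re = _
  rw [e]
  simp only [hm, ← Complex.ofReal_neg] at hi'
  simp only [inner_sub_right, inner_smul_right, ← Complex.ofReal_neg, Complex.add_re,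
    Complex.sub_re, Complex.neg_re, Complex.re_ofReal_mul, n1, n2, n3, n4] at hi' hq' ⊢
  simp only [star_zero, zero_mul, sub_self, Complex.zero_re] at hq'
  have c1 : p.δ₂ / p.β₂ * p.β₂ = p.δ₂ := by field_simp
  have c2 : p.γ₂ * p.τ₂ / p.κ₂ * (1 / p.τ₂) = p.γ₂ / p.κ₂ := by field_simp
  have c3 : p.γ₂ * p.τ₂ / p.κ₂ * (p.κ₂ / p.τ₂) = p.γ₂ := by field_simp
  linear_combination hi' - p.γ₂ * hq' + (inner ℂ y.θ₂ (weakDeriv2 y.v₂)).re * c1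
    - ‖y.q₂‖ ^ 2 * c2 - (inner ℂ (weakDeriv y.θ₂) y.q₂).re * c3

lemma re_inner_A₂_nonpos (y : p.A₂.domain) :
    (inner ℂ (y : p.EnergySpace) (p.A₂ y)).re ≤ 0 := by
  have := p.γ₂_pos; have := p.κ₂_pos
  rw [re_inner_A₂, neg_nonpos]
  positivity

end StringBeam

/-! ### The stationary problem -/

lemma volterraRight_add {ℓ : ℝ} (g h : L2 ℓ) :
    volterraRight (g + h) = volterraRight g + volterraRight h := by
  rw [volterraRight, prim_add, neg_add, cst_add, map_add, volterraRight, volterraRight]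
  abel

lemma volterraRight_smul {ℓ : ℝ} (c : ℂ) (g : L2 ℓ) :
    volterraRight (c • g) = c • volterraRight g := by
  rw [volterraRight, prim_smul, map_smul, volterraRight, smul_add, cst_eq_smul,
    cst_eq_smul (-prim g ℓ), smul_smul, mul_neg]

lemma prim_cst_one {ℓ : ℝ} (hℓ : 0 ≤ ℓ) : prim (cst 1 : L2 ℓ) ℓ = ℓ := by
  have := prim_ofCont (ℓ := ℓ) (right_mem_Icc.2 hℓ) (F := fun x => (x : ℂ)) (F' := fun _ => 1)
    continuous_const (fun x => (hasDerivAt_id x).ofReal_comp)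
  simpa [cst] using this

/-- `∫₀^ℓ ∫₀ˣ (s - ℓ) ds dx = -ℓ³/3`. -/
lemma prim_volterra_volterraRight_one {ℓ : ℝ} (hℓ : 0 ≤ ℓ) :
    prim (volterra ℓ (volterraRight (cst 1))) ℓ = -((ℓ ^ 3 / 3 : ℝ) : ℂ) := by
  have c0 : Continuous fun x : ℝ => ((x - ℓ : ℝ) : ℂ) := by fun_prop
  have c1 : Continuous fun x : ℝ => ((x ^ 2 / 2 - ℓ * x : ℝ) : ℂ) := by fun_prop
  have c2 : Continuous fun x : ℝ => ((x ^ 3 / 6 - ℓ * x ^ 2 / 2 : ℝ) : ℂ) := by fun_prop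
  have d0 (x : ℝ) : HasDerivAt (fun x : ℝ => ((x - ℓ : ℝ) : ℂ)) 1 x := by
    simpa using ((hasDerivAt_id x).sub_const ℓ).ofReal_comp
  have d1 (x : ℝ) : HasDerivAt (fun x : ℝ => ((x ^ 2 / 2 - ℓ * x : ℝ) : ℂ))
      ((x - ℓ : ℝ) : ℂ) x := by
    refine HasDerivAt.ofReal_comp (f := fun x : ℝ => x ^ 2 / 2 - ℓ * x) ?_
    have := (((hasDerivAt_id x).pow 2).div_const 2).sub ((hasDerivAt_id x).const_mul ℓ)
    refine this.congr_deriv ?_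
    simp
  have d2 (x : ℝ) : HasDerivAt (fun x : ℝ => ((x ^ 3 / 6 - ℓ * x ^ 2 / 2 : ℝ) : ℂ))
      ((x ^ 2 / 2 - ℓ * x : ℝ) : ℂ) x := by
    refine HasDerivAt.ofReal_comp (f := fun x : ℝ => x ^ 3 / 6 - ℓ * x ^ 2 / 2) ?_
    have := (((hasDerivAt_id x).pow 3).div_const 6).sub
      ((((hasDerivAt_id x).pow 2).const_mul ℓ).div_const 2)
    refine this.congr_deriv ?_
    simp
    ring
  have e0 : volterraRight (cst 1) = (ofCont _ c0 : L2 ℓ) := by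
    rw [ofCont_eq_cst_add_volterra c0 continuous_const d0, volterraRight, prim_cst_one hℓ]
    simp [cst]
  have e1 : volterra ℓ (ofCont _ c0) = ofCont _ c1 := by
    rw [ofCont_eq_cst_add_volterra c1 c0 d1]
    simp [cst_eq_smul 0]
  rw [e0, e1, prim_ofCont (right_mem_Icc.2 hℓ) c1 d2]
  push_cast
  ring

namespace StringBeam

variable {p : StringBeam}

/-- Solving `A₂ y = f` by successive integrations. The integration constants are determined by
the boundary conditions, the last of them being the shear force at the junction. -/
lemma exists_A₂_eq (f : p.EnergySpace) : ∃ y : p.A₂.domain, p.A₂ y = f := by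
  have a1 := p.α₁_pos; have a2 := p.α₂_pos; have hb := p.β₂_pos; have hg := p.γ₂_pos
  have hd := p.δ₂_pos; have ht := p.τ₂_pos; have hk := p.κ₂_pos
  have l1 := p.ℓ₁_pos; have l2 := p.ℓ₂_pos
  have l2' : (p.ℓ₂ : ℂ) ≠ 0 := by exact_mod_cast l2.ne'
  have hg' : (p.γ₂ : ℂ) ≠ 0 := by exact_mod_cast hg.ne'
  have hk' : (p.κ₂ : ℂ) ≠ 0 := by exact_mod_cast hk.ne'
  have ht' : (p.τ₂ : ℂ) ≠ 0 := by exact_mod_cast ht.ne'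
  have a1' : (p.α₁ : ℂ) ≠ 0 := by exact_mod_cast a1.ne'
  have a2' : (p.α₂ : ℂ) ≠ 0 := by exact_mod_cast a2.ne'
  have hb' : (p.β₂ : ℂ) ≠ 0 := by exact_mod_cast hb.ne'
  have hd' : (p.δ₂ : ℂ) ≠ 0 := by exact_mod_cast hd.ne'
  -- heat flux and temperature
  set Q : L2 p.ℓ₂ := (-(p.γ₂ : ℂ)⁻¹) • (f.θ₂ + (p.δ₂ : ℂ) • weakDeriv2 f.u₂) with hQ
  set q₀ : ℂ := -(prim (volterra p.ℓ₂ Q) p.ℓ₂ + (p.τ₂ : ℂ) * prim f.q₂ p.ℓ₂) / p.ℓ₂ with hq₀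
  set q : L2 p.ℓ₂ := cst q₀ + volterra p.ℓ₂ Q with hq
  set Θ : L2 p.ℓ₂ := (-(p.κ₂ : ℂ)⁻¹) • (q + (p.τ₂ : ℂ) • f.q₂) with hΘ
  set θ : L2 p.ℓ₂ := volterra p.ℓ₂ Θ with hθ
  have wq : IsWeakDeriv q Q := isWeakDeriv_cst_add_volterra _ _
  have wθ : IsWeakDeriv θ Θ := isWeakDeriv_volterra _
  have hΘ0 : prim Θ p.ℓ₂ = 0 := by
    rw [hΘ, prim_smul, prim_add, hq, prim_add, prim_smul, cst_eq_smul, prim_smul,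
      prim_cst_one l2.le, hq₀]
    field_simp
    ring
  have hθℓ : HasTrace θ p.ℓ₂ 0 := by
    have := hasTrace_ofCont (ℓ := p.ℓ₂) p.ℓ₂ (continuous_prim Θ)
    rwa [hΘ0] at this
  -- displacements, with the shear force `m` at the junction as a parameter
  set K : ℂ := ((p.δ₂ / (p.β₂ * p.α₁) * p.ℓ₁ + p.ℓ₂ ^ 3 / (3 * p.α₂) : ℝ) : ℂ) with hK
  have hK0 : K ≠ 0 := by
    rw [hK, Complex.ofReal_ne_zero]
    positivity
  set g₁ : L2 p.ℓ₁ := (p.α₁ : ℂ)⁻¹ • f.v₁ with hg₁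
  set b₀ : L2 p.ℓ₂ := (p.α₂ : ℂ)⁻¹ • ((p.β₂ : ℂ) • θ
    + (-1 : ℂ) • volterraRight (volterra p.ℓ₂ f.v₂)) with hb₀
  set m : ℂ := (prim (volterra p.ℓ₁ g₁) p.ℓ₁ - prim (volterra p.ℓ₂ b₀) p.ℓ₂) / K with hm
  set d : ℂ := -((p.δ₂ / (p.β₂ * p.α₁) : ℝ) : ℂ) * m with hd₀
  set a : L2 p.ℓ₁ := cst d + volterra p.ℓ₁ g₁ with ha
  set M' : L2 p.ℓ₂ := cst m + volterra p.ℓ₂ f.v₂ with hM'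
  set M : L2 p.ℓ₂ := volterraRight M' with hM
  set b : L2 p.ℓ₂ := (p.α₂ : ℂ)⁻¹ • ((p.β₂ : ℂ) • θ + (-1 : ℂ) • M) with hb₁
  have hbb : b = b₀ + (-(p.α₂ : ℂ)⁻¹ * m) • volterraRight (cst 1) := by
    rw [hb₁, hb₀, hM, hM', volterraRight_add, cst_eq_smul, volterraRight_smul]
    module
  have hab : prim a p.ℓ₁ = prim (volterra p.ℓ₂ b) p.ℓ₂ := by
    rw [ha, prim_add, cst_eq_smul, prim_smul, prim_cst_one l1.le, hbb, map_add, prim_add,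
      map_smul (volterra p.ℓ₂) (-(p.α₂ : ℂ)⁻¹ * m), prim_smul (-(p.α₂ : ℂ)⁻¹ * m),
      prim_volterra_volterraRight_one l2.le]
    have hmK : m * K = prim (volterra p.ℓ₁ g₁) p.ℓ₁ - prim (volterra p.ℓ₂ b₀) p.ℓ₂ := by
      rw [hm, div_mul_cancel₀ _ hK0]
    have hKe : K = (p.δ₂ : ℂ) / (p.β₂ * p.α₁) * p.ℓ₁ + (p.ℓ₂ : ℂ) ^ 3 / (3 * p.α₂) := by
      rw [hK]; push_cast; ring
    rw [hKe] at hmK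
    rw [hd₀]
    push_cast
    linear_combination -hmK
  set y : p.EnergySpace := mkState (p.volterraRight_mem_V hab) f.u₁ f.u₂ θ q with hy
  have wa : IsWeakDeriv y.u₁ a := isWeakDeriv_volterraRight a
  have wa' : IsWeakDeriv a g₁ := isWeakDeriv_cst_add_volterra _ _
  have wb : weakDeriv2 y.u₂ = b :=
    weakDeriv2_eq (isWeakDeriv_volterraRight _) (isWeakDeriv_volterra b)
  have hmom : p.moment y = M := by
    rw [moment, wb, hb₁, show y.θ₂ = θ from rfl, smul_smul, neg_mul, mul_inv_cancel₀ a2']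
    module
  have wM : IsWeakDeriv M M' := isWeakDeriv_volterraRight _
  have wM' : IsWeakDeriv M' f.v₂ := isWeakDeriv_cst_add_volterra _ _
  have hdom : y ∈ p.domain := by
    refine ⟨f.mem_V, mem_H2_of_isWeakDeriv wa wa',
      ⟨wθ.mem_H1, hasTrace_volterra_zero _, hθℓ⟩, wq.mem_H1, ?_, ?_, -m, d, ?_, ?_, ?_⟩
    · rw [hmom]; exact mem_H2_of_isWeakDeriv wM wM'
    · rw [wb]
      have := ((hθℓ.smul (p.β₂ : ℂ)).add ((hasTrace_volterraRight M').smul (-1))).smul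
        (p.α₂ : ℂ)⁻¹
      simpa only [mul_zero, add_zero] using this
    · rw [hmom, wM.weakDeriv_eq, neg_neg]
      simpa [prim_zero] using hasTrace_cst_add_volterra 0 m f.v₂
    · rw [wa.weakDeriv_eq]
      simpa [prim_zero] using hasTrace_cst_add_volterra 0 d g₁
    · rw [hd₀]
      push_cast
      field_simp
  refine ⟨⟨y, hdom⟩, EnergySpace.ext_components rfl rfl ?_ ?_ ?_ ?_⟩
  · change (p.α₁ : ℂ) • weakDeriv2 y.u₁ = f.v₁
    rw [weakDeriv2_eq wa wa', hg₁, smul_smul, mul_inv_cancel₀ a1', one_smul]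
  · change weakDeriv2 (p.moment y) = f.v₂
    rw [hmom, weakDeriv2_eq wM wM']
  · change (-(p.δ₂ : ℂ)) • weakDeriv2 f.u₂ - (p.γ₂ : ℂ) • weakDeriv q = f.θ₂
    rw [wq.weakDeriv_eq, hQ, smul_smul, mul_neg, mul_inv_cancel₀ hg']
    module
  · change (-((1 / p.τ₂ : ℝ) : ℂ)) • q - ((p.κ₂ / p.τ₂ : ℝ) : ℂ) • weakDeriv θ = f.q₂
    rw [wθ.weakDeriv_eq, hΘ, smul_smul]
    have e : ((p.κ₂ / p.τ₂ : ℝ) : ℂ) * -(p.κ₂ : ℂ)⁻¹ = -(p.τ₂ : ℂ)⁻¹ := by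
      push_cast; field_simp
    have e2 : -((1 / p.τ₂ : ℝ) : ℂ) = -(p.τ₂ : ℂ)⁻¹ := by push_cast; rw [one_div]
    rw [e, e2]
    generalize q = q'
    match_scalars
    · ring
    · field_simp

/-! ### A priori estimate on the imaginary axis -/

lemma tendsto_inner_zero {ℓ : ℝ} {f g : ℕ → L2 ℓ} (hf : Tendsto f atTop (𝓝 0))
    (hg : ∃ C, ∀ n, ‖g n‖ ≤ C) : Tendsto (fun n => inner ℂ (f n) (g n)) atTop (𝓝 0) := by
  obtain ⟨C, hC⟩ := hg
  refine squeeze_zero_norm (fun n => (norm_inner_le_norm _ _).trans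
    (mul_le_mul_of_nonneg_left (hC n) (norm_nonneg _))) ?_
  simpa using hf.norm.mul_const C

lemma tendsto_zero_of_norm_le {ι : Type*} {E F : Type*} [NormedAddCommGroup E]
    [NormedAddCommGroup F] {l : Filter ι} {f : ι → E} {g : ι → F} (C : ℝ)
    (h : ∀ n, ‖f n‖ ≤ C * ‖g n‖) (hg : Tendsto g l (𝓝 0)) : Tendsto f l (𝓝 0) :=
  squeeze_zero_norm h (by simpa using hg.norm.const_mul C)

end StringBeam

/-- If bounded sequences of approximate solutions of `A x = z x` tend to zero, then `z - A` is
bounded below. -/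
lemma exists_bound_of_seq {X : Type*} [NormedAddCommGroup X] [NormedSpace ℂ X] {A : X →ₗ.[ℂ] X}
    {z : ℂ} (h : ∀ x : ℕ → A.domain, (∀ n, ‖(x n : X)‖ ≤ 1) →
      Tendsto (fun n => z • (x n : X) - A (x n)) atTop (𝓝 0) →
      Tendsto (fun n => (x n : X)) atTop (𝓝 0)) :
    ∃ C, 0 ≤ C ∧ ∀ x : A.domain, ‖(x : X)‖ ≤ C * ‖z • (x : X) - A x‖ := by
  by_contra! hc
  choose x hx using fun n : ℕ => hc n n.cast_nonneg
  have hpos (n : ℕ) : 0 < ‖(x n : X)‖ := lt_of_le_of_lt (by positivity) (hx n)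
  set w : ℕ → A.domain := fun n => ((‖(x n : X)‖⁻¹ : ℝ) : ℂ) • x n with hw
  have hn (n : ℕ) : ‖(w n : X)‖ = 1 := by
    rw [hw, Submodule.coe_smul, norm_smul, Complex.norm_real, Real.norm_of_nonneg (by positivity),
      inv_mul_cancel₀ (hpos n).ne']
  have hAw (n : ℕ) : z • (w n : X) - A (w n)
      = ((‖(x n : X)‖⁻¹ : ℝ) : ℂ) • (z • (x n : X) - A (x n)) := by
    rw [hw, LinearPMap.map_smul, Submodule.coe_smul, smul_comm, smul_sub]
  have h0 : Tendsto (fun n => z • (w n : X) - A (w n)) atTop (𝓝 0) := by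
    refine squeeze_zero_norm' ?_ tendsto_inv_atTop_nhds_zero_nat
    filter_upwards [eventually_gt_atTop 0] with n hn0
    rw [hAw, norm_smul, Complex.norm_real, Real.norm_of_nonneg (by positivity),
      ← div_eq_inv_mul, div_le_iff₀ (hpos n), ← div_eq_inv_mul, le_div_iff₀ (by exact_mod_cast hn0),
      mul_comm]
    exact (hx n).le
  have h1 := (h w (fun n => (hn n).le) h0).norm
  simp only [hn, norm_zero] at h1
  exact one_ne_zero (tendsto_nhds_unique tendsto_const_nhds h1)

lemma exists_norm_le_of_tendsto {E : Type*} [NormedAddCommGroup E] {f : ℕ → E} {a : E}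
    (hf : Tendsto f atTop (𝓝 a)) : ∃ C, ∀ n, ‖f n‖ ≤ C := by
  obtain ⟨C, hC⟩ := hf.norm.bddAbove_range
  exact ⟨C, fun n => hC ⟨n, rfl⟩⟩

lemma tendsto_zero_of_norm_sq {E : Type*} [NormedAddCommGroup E] {f : ℕ → E}
    (hf : Tendsto (fun n => ‖f n‖ ^ 2) atTop (𝓝 0)) : Tendsto f atTop (𝓝 0) := by
  rw [tendsto_zero_iff_norm_tendsto_zero]
  have h' := (Real.continuous_sqrt.tendsto 0).comp hf
  simpa [Function.comp_def] using h'

namespace StringBeam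

variable {p : StringBeam}

lemma weakDeriv2_residual (z : ℂ) (y : p.A₂.domain) :
    weakDeriv2 (z • (y : p.EnergySpace) - p.A₂ y).u₂
      = z • weakDeriv2 (y : p.EnergySpace).u₂ - weakDeriv2 (y : p.EnergySpace).v₂ := by
  have h1 : (z • (y : p.EnergySpace) - p.A₂ y).u₂
      = z • (y : p.EnergySpace).u₂ + (-1 : ℂ) • (y : p.EnergySpace).v₂ := by
    rw [neg_one_smul, ← sub_eq_add_neg]; rfl
  have hv : (y : p.EnergySpace).v₂ ∈ H2 p.ℓ₂ := y.2.1.2.1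
  rw [h1, weakDeriv2_add (Submodule.smul_mem _ _ (EnergySpace.u₂_mem _))
    (Submodule.smul_mem _ _ hv), weakDeriv2_smul _ (EnergySpace.u₂_mem _),
    weakDeriv2_smul _ hv, neg_one_smul, sub_eq_add_neg]

/-- In `V`, convergence of `u₁'` and `u₂''` to zero entails that of the lower derivatives. -/
lemma poincare_V {f : ℕ → p.EnergySpace} (h1 : Tendsto (fun n => weakDeriv (f n).u₁) atTop (𝓝 0))
    (h2 : Tendsto (fun n => weakDeriv2 (f n).u₂) atTop (𝓝 0)) :
    Tendsto (fun n => (f n).u₁) atTop (𝓝 0) ∧ Tendsto (fun n => weakDeriv (f n).u₂) atTop (𝓝 0) ∧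
      Tendsto (fun n => (f n).u₂) atTop (𝓝 0) := by
  obtain ⟨C₁, -, hC₁⟩ := exists_poincare_right p.ℓ₁_pos
  obtain ⟨C₂, -, hC₂⟩ := exists_poincare_right p.ℓ₂_pos
  have hd : Tendsto (fun n => weakDeriv (f n).u₂) atTop (𝓝 0) :=
    tendsto_zero_of_norm_le _ (fun n => (isWeakDeriv_weakDeriv2
      (f n).u₂_mem).norm_le_of_hasTrace_left p.ℓ₂_pos (f n).mem_V.2.2.2.2.2) h2
  exact ⟨tendsto_zero_of_norm_le C₁ (fun n => hC₁ (isWeakDeriv_weakDeriv (f n).u₁_mem)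
      (f n).mem_V.2.2.1) h1, hd,
    tendsto_zero_of_norm_le C₂ (fun n => hC₂ (isWeakDeriv_weakDeriv (f n).u₂_mem.1)
      (f n).mem_V.2.2.2.1) hd⟩

/-- The value at the left endpoint is small when the function is small in `L²` and its derivative
stays bounded. -/
lemma tendsto_trace_zero {ℓ : ℝ} (hℓ : 0 < ℓ) {f g : ℕ → L2 ℓ} {c : ℕ → ℂ}
    (h : ∀ n, IsWeakDeriv (f n) (g n)) (hc : ∀ n, HasTrace (f n) 0 (c n))
    (hf : Tendsto f atTop (𝓝 0)) (hg : ∃ C, ∀ n, ‖g n‖ ≤ C) : Tendsto c atTop (𝓝 0) := by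
  refine tendsto_zero_of_norm_sq ?_
  have h1 : Tendsto (fun n => mulDist ℓ (f n)) atTop (𝓝 0) := by
    simpa [Function.comp_def] using ((mulDist ℓ).continuous.tendsto 0).comp hf
  have h2 := (Complex.continuous_re.tendsto 0).comp (tendsto_inner_zero h1 hg)
  have h3 : Tendsto (fun n => ℓ⁻¹ * (‖f n‖ ^ 2 - 2 * (inner ℂ (mulDist ℓ (f n)) (g n)).re)) atTop
      (𝓝 0) := by
    simpa [Function.comp_def] using ((hf.norm.pow 2).sub (h2.const_mul 2)).const_mul ℓ⁻¹
  refine h3.congr fun n => ?_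
  rw [(h n).mulDist_identity hℓ (hc n)]
  field_simp
  ring

/-- Multiplier estimate for the string: an approximate solution of `u'' + b u = 0` with small
Cauchy data at `0` is small. -/
lemma tendsto_deriv_zero_of_cauchy {ℓ b : ℝ} (hℓ : 0 < ℓ) (hb : 0 < b) {f g h : ℕ → L2 ℓ}
    {c d : ℕ → ℂ} (hf : ∀ n, IsWeakDeriv (f n) (g n)) (hg : ∀ n, IsWeakDeriv (g n) (h n))
    (hc : ∀ n, HasTrace (f n) 0 (c n)) (hd : ∀ n, HasTrace (g n) 0 (d n))
    (hgb : ∃ C, ∀ n, ‖g n‖ ≤ C) (hc0 : Tendsto c atTop (𝓝 0)) (hd0 : Tendsto d atTop (𝓝 0))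
    (hr : Tendsto (fun n => h n + (b : ℂ) • f n) atTop (𝓝 0)) : Tendsto g atTop (𝓝 0) := by
  obtain ⟨C, hC⟩ := hgb
  have h1 := (Complex.continuous_re.tendsto 0).comp (tendsto_inner_zero hr
    ⟨‖mulDist ℓ‖ * C, fun n => ((mulDist ℓ).le_opNorm (g n)).trans
      (mul_le_mul_of_nonneg_left (hC n) (norm_nonneg _))⟩)
  have h2 : Tendsto (fun n => 2 * (inner ℂ (h n + (b : ℂ) • f n) (mulDist ℓ (g n))).re
      + ℓ * (‖d n‖ ^ 2 + b * ‖c n‖ ^ 2)) atTop (𝓝 0) := by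
    simpa [Function.comp_def] using (h1.const_mul 2).add
      (((hd0.norm.pow 2).add ((hc0.norm.pow 2).const_mul b)).const_mul ℓ)
  refine tendsto_zero_of_norm_sq (squeeze_zero (fun n => sq_nonneg _) (fun n => ?_) h2)
  have i1 := (hg n).mulDist_identity hℓ (hd n)
  have i2 := (hf n).mulDist_identity hℓ (hc n)
  have e : (inner ℂ (h n + (b : ℂ) • f n) (mulDist ℓ (g n))).re
      = (inner ℂ (mulDist ℓ (g n)) (h n)).re + b * (inner ℂ (mulDist ℓ (f n)) (g n)).re := by
    rw [inner_add_left, inner_smul_left, Complex.add_re, Complex.conj_ofReal,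
      Complex.re_ofReal_mul, inner_mulDist_left (f n), ← inner_conj_symm, Complex.conj_re]
  rw [e]
  nlinarith [mul_nonneg hb.le (sq_nonneg ‖f n‖)]

/-- A bounded sequence of approximate solutions of `A₂ y = i r y` tends to zero. The dissipation
controls the heat flux, Cattaneo's law the temperature. For `r ≠ 0` the temperature equation then
turns `‖u₂''‖²` into a multiple of `⟨q₂', u₂''⟩`, which tends to zero after an integration by
parts, and the string has small Cauchy data at the junction. -/
lemma tendsto_zero_of_residual (r : ℝ) (y : ℕ → p.A₂.domain)
    (hy : ∀ n, ‖(y n : p.EnergySpace)‖ ≤ 1)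
    (hF : Tendsto (fun n => (Complex.I * r) • (y n : p.EnergySpace) - p.A₂ (y n)) atTop (𝓝 0)) :
    Tendsto (fun n => (y n : p.EnergySpace)) atTop (𝓝 0) := by
  have a1 := p.α₁_pos; have a2 := p.α₂_pos; have hb := p.β₂_pos; have hg := p.γ₂_pos
  have hd := p.δ₂_pos; have ht := p.τ₂_pos; have hk := p.κ₂_pos
  have l1 := p.ℓ₁_pos; have l2 := p.ℓ₂_pos
  have hg' : (p.γ₂ : ℂ) ≠ 0 := by exact_mod_cast hg.ne'
  have hk' : (p.κ₂ : ℂ) ≠ 0 := by exact_mod_cast hk.ne'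
  have ht' : (p.τ₂ : ℂ) ≠ 0 := by exact_mod_cast ht.ne'
  have a1' : (p.α₁ : ℂ) ≠ 0 := by exact_mod_cast a1.ne'
  have a2' : (p.α₂ : ℂ) ≠ 0 := by exact_mod_cast a2.ne'
  set z : ℂ := Complex.I * r with hz
  have hzre : z.re = 0 := by simp [hz]
  set Y : ℕ → p.EnergySpace := fun n => (y n : p.EnergySpace) with hY
  set F : ℕ → p.EnergySpace := fun n => z • (y n : p.EnergySpace) - p.A₂ (y n) with hFdef
  have hdom (n : ℕ) : Y n ∈ p.domain := (y n).2
  obtain ⟨C, hC, hcomp⟩ := p.exists_component_bound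
  have f1 := tendsto_zero_of_norm_le C (fun n => (hcomp (F n)).1) hF
  have f2 := tendsto_zero_of_norm_le C (fun n => (hcomp (F n)).2.1) hF
  have f3 := tendsto_zero_of_norm_le C (fun n => (hcomp (F n)).2.2.1) hF
  have f4 := tendsto_zero_of_norm_le C (fun n => (hcomp (F n)).2.2.2.1) hF
  have f5 := tendsto_zero_of_norm_le C (fun n => (hcomp (F n)).2.2.2.2.1) hF
  have f6 := tendsto_zero_of_norm_le C (fun n => (hcomp (F n)).2.2.2.2.2) hF
  have hC1 {x : ℝ} {n : ℕ} (h : x ≤ C * ‖Y n‖) : x ≤ C :=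
    h.trans (mul_le_of_le_one_right hC.le (hy n))
  obtain ⟨fu1, -, fu2⟩ := poincare_V f1 f2
  -- the heat flux is controlled by the dissipation
  have q0 : Tendsto (fun n => (Y n).q₂) atTop (𝓝 0) := by
    have hc : 0 < p.γ₂ / p.κ₂ := by positivity
    have e (n : ℕ) : p.γ₂ / p.κ₂ * ‖(Y n).q₂‖ ^ 2 = (inner ℂ (Y n) (F n)).re := by
      have h1 := re_inner_A₂ (y n)
      have h2 : inner ℂ (Y n) (Y n) = ((‖Y n‖ ^ 2 : ℝ) : ℂ) := by
        rw [inner_self_eq_norm_sq_to_K]; norm_cast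
      rw [hFdef]
      simp only
      rw [inner_sub_right, inner_smul_right, Complex.sub_re, h1, h2, Complex.re_mul_ofReal, hzre]
      ring
    refine tendsto_zero_of_norm_sq ?_
    refine squeeze_zero (fun n => sq_nonneg _) (g := fun n => (p.γ₂ / p.κ₂)⁻¹ * ‖F n‖)
      (fun n => ?_) (by simpa using hF.norm.const_mul (p.γ₂ / p.κ₂)⁻¹)
    rw [← div_eq_inv_mul, le_div_iff₀ hc, mul_comm, e]
    refine (Complex.re_le_norm _).trans ((norm_inner_le_norm _ _).trans ?_)
    exact mul_le_of_le_one_left (norm_nonneg _) (hy n)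
  -- Cattaneo's law controls the temperature
  have dθ0 : Tendsto (fun n => weakDeriv (Y n).θ₂) atTop (𝓝 0) := by
    have e (n : ℕ) : weakDeriv (Y n).θ₂ = ((p.τ₂ : ℂ) / p.κ₂) • (F n).q₂
        + (-((p.τ₂ : ℂ) / p.κ₂ * (z + 1 / p.τ₂))) • (Y n).q₂ := by
      have h : (F n).q₂ = z • (Y n).q₂ - ((-((1 / p.τ₂ : ℝ) : ℂ)) • (Y n).q₂
        - ((p.κ₂ / p.τ₂ : ℝ) : ℂ) • weakDeriv (Y n).θ₂) := rfl
      rw [h]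
      push_cast
      match_scalars
      · field_simp
      · field_simp; ring
    simp only [e]
    simpa using (f6.const_smul ((p.τ₂ : ℂ) / p.κ₂)).add
      (q0.const_smul (-((p.τ₂ : ℂ) / p.κ₂ * (z + 1 / p.τ₂))))
  have θ0 : Tendsto (fun n => (Y n).θ₂) atTop (𝓝 0) :=
    tendsto_zero_of_norm_le _ (fun n => (isWeakDeriv_weakDeriv
      (hdom n).2.2.1.1).norm_le_of_hasTrace_left l2 (hdom n).2.2.1.2.1) dθ0
  have f2' : Tendsto (fun n => z • weakDeriv2 (Y n).u₂ - weakDeriv2 (Y n).v₂) atTop (𝓝 0) :=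
    f2.congr fun n => weakDeriv2_residual z (y n)
  have bu1 (n : ℕ) : ‖weakDeriv (Y n).u₁‖ ≤ C := hC1 (hcomp (Y n)).1
  have bu2 (n : ℕ) : ‖weakDeriv2 (Y n).u₂‖ ≤ C := hC1 (hcomp (Y n)).2.1
  have bv2 (n : ℕ) : ‖(Y n).v₂‖ ≤ C := hC1 (hcomp (Y n)).2.2.2.1
  have ev1 (n : ℕ) : z • (Y n).u₁ - (F n).u₁ = (Y n).v₁ := sub_sub_cancel _ _
  have ev2 (n : ℕ) : z • (Y n).u₂ - (F n).u₂ = (Y n).v₂ := sub_sub_cancel _ _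
  have eu1 (n : ℕ) : (p.α₁ : ℂ)⁻¹ • (z • (Y n).v₁ - (F n).v₁) = weakDeriv2 (Y n).u₁ := by
    rw [show (F n).v₁ = z • (Y n).v₁ - (p.α₁ : ℂ) • weakDeriv2 (Y n).u₁ from rfl, sub_sub_cancel,
      smul_smul, inv_mul_cancel₀ a1', one_smul]
  have eM (n : ℕ) : z • (Y n).v₂ - (F n).v₂ = weakDeriv2 (p.moment (Y n)) := sub_sub_cancel _ _
  have eθ (n : ℕ) : (F n).θ₂ - z • (Y n).θ₂
      = (p.δ₂ : ℂ) • weakDeriv2 (Y n).v₂ + (p.γ₂ : ℂ) • weakDeriv (Y n).q₂ := by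
    rw [show (F n).θ₂ = z • (Y n).θ₂ - ((-(p.δ₂ : ℂ)) • weakDeriv2 (Y n).v₂
      - (p.γ₂ : ℂ) • weakDeriv (Y n).q₂) from rfl]
    module
  -- it remains to control the displacements
  suffices h : Tendsto (fun n => weakDeriv (Y n).u₁) atTop (𝓝 0) ∧
      Tendsto (fun n => weakDeriv2 (Y n).u₂) atTop (𝓝 0) by
    obtain ⟨k1, -, k2⟩ := poincare_V h.1 h.2
    refine p.tendsto_zero_of_components h.1 h.2 ?_ ?_ θ0 q0
    · refine Tendsto.congr ev1 ?_
      simpa using (k1.const_smul z).sub fu1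
    · refine Tendsto.congr ev2 ?_
      simpa using (k2.const_smul z).sub fu2
  by_cases hr : r = 0
  · -- the static case: pair the momentum equations with the displacement
    have hz0 : z = 0 := by simp [hz, hr]
    have w1 : Tendsto (fun n => weakDeriv2 (Y n).u₁) atTop (𝓝 0) := by
      refine Tendsto.congr eu1 ?_
      simpa [hz0] using f3.neg.const_smul (p.α₁ : ℂ)⁻¹
    have w2 : Tendsto (fun n => weakDeriv2 (p.moment (Y n))) atTop (𝓝 0) := by
      refine Tendsto.congr eM ?_
      simpa [hz0] using f4.neg
    obtain ⟨C₁, hC₁, hP₁⟩ := exists_poincare_right l1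
    obtain ⟨C₂, hC₂, hP₂⟩ := exists_poincare_right l2
    have c1 (n : ℕ) : ‖(Y n).u₁‖ ≤ C₁ * C :=
      (hP₁ (isWeakDeriv_weakDeriv (Y n).u₁_mem) (Y n).mem_V.2.2.1).trans (by gcongr; exact bu1 n)
    have c2 (n : ℕ) : ‖(Y n).u₂‖ ≤ C₂ * (‖volterra p.ℓ₂‖ * C) :=
      (hP₂ (isWeakDeriv_weakDeriv (Y n).u₂_mem.1) (Y n).mem_V.2.2.2.1).trans (by
        gcongr
        exact ((isWeakDeriv_weakDeriv2 (Y n).u₂_mem).norm_le_of_hasTrace_left l2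
          (Y n).mem_V.2.2.2.2.2).trans (by gcongr; exact bu2 n))
    have t1 := tendsto_inner_zero w1 ⟨_, c1⟩
    have t2 := tendsto_inner_zero w2 ⟨_, c2⟩
    have t3 := tendsto_inner_zero θ0 ⟨_, bu2⟩
    have tot : Tendsto (fun n => p.α₁ * ‖weakDeriv (Y n).u₁‖ ^ 2
        + p.δ₂ / p.β₂ * p.α₂ * ‖weakDeriv2 (Y n).u₂‖ ^ 2) atTop (𝓝 0) := by
      have t4 := (Complex.continuous_re.tendsto 0).comp (by
        simpa using (((t1.const_mul (p.α₁ : ℂ)).add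
          (t2.const_mul ((p.δ₂ / p.β₂ : ℝ) : ℂ))).neg).add
          (t3.const_mul ((p.δ₂ / p.β₂ * p.β₂ : ℝ) : ℂ)))
      simp only [Function.comp_def, Complex.zero_re] at t4
      refine t4.congr fun n => ?_
      have hi := inner_momentum (hdom n) (Y n).mem_V
      simp only at hi
      have sq {ℓ : ℝ} (f : L2 ℓ) : inner ℂ f f = ((‖f‖ ^ 2 : ℝ) : ℂ) := by
        rw [inner_self_eq_norm_sq_to_K]; norm_cast
      rw [show inner ℂ (p.moment (Y n)) (weakDeriv2 (Y n).u₂) = inner ℂ ((-(p.α₂ : ℂ)) •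
        weakDeriv2 (Y n).u₂ + (p.β₂ : ℂ) • (Y n).θ₂) (weakDeriv2 (Y n).u₂) from rfl,
        inner_add_left, inner_smul_left, inner_smul_left, sq, sq, map_neg,
        Complex.conj_ofReal, Complex.conj_ofReal] at hi
      rw [← Complex.ofReal_re (p.α₁ * ‖weakDeriv (Y n).u₁‖ ^ 2
        + p.δ₂ / p.β₂ * p.α₂ * ‖weakDeriv2 (Y n).u₂‖ ^ 2)]
      congr 1
      push_cast at hi ⊢
      linear_combination -hi
    have k1 : Tendsto (fun n => p.α₁ * ‖weakDeriv (Y n).u₁‖ ^ 2) atTop (𝓝 0) :=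
      squeeze_zero (fun n => by positivity) (fun n => le_add_of_nonneg_right (by positivity)) tot
    have k2 : Tendsto (fun n => p.δ₂ / p.β₂ * p.α₂ * ‖weakDeriv2 (Y n).u₂‖ ^ 2) atTop (𝓝 0) :=
      squeeze_zero (fun n => by positivity) (fun n => le_add_of_nonneg_left (by positivity)) tot
    constructor
    · refine tendsto_zero_of_norm_sq ?_
      simpa [← mul_assoc, a1.ne'] using k1.const_mul p.α₁⁻¹
    · refine tendsto_zero_of_norm_sq ?_
      have hne : p.δ₂ / p.β₂ * p.α₂ ≠ 0 := by positivity
      simpa only [← mul_assoc, inv_mul_cancel₀ hne, one_mul, mul_zero] using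
        k2.const_mul (p.δ₂ / p.β₂ * p.α₂)⁻¹
  · have hz0 : z ≠ 0 := by simp [hz, hr]
    -- the temperature equation ties the curvature to the flux
    have s0 : Tendsto (fun n => (z * p.δ₂) • weakDeriv2 (Y n).u₂
        + (p.γ₂ : ℂ) • weakDeriv (Y n).q₂) atTop (𝓝 0) := by
      have := (f5.sub (θ0.const_smul z)).add (f2'.const_smul (p.δ₂ : ℂ))
      simp only [smul_zero, sub_zero, add_zero] at this
      refine this.congr fun n => ?_
      rw [eθ]
      module
    have bq : ∃ B, ∀ n, ‖weakDeriv (Y n).q₂‖ ≤ B := by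
      obtain ⟨B, hB⟩ := exists_norm_le_of_tendsto s0
      refine ⟨‖(p.γ₂ : ℂ)⁻¹‖ * (B + ‖z * p.δ₂‖ * C), fun n => ?_⟩
      have e : weakDeriv (Y n).q₂ = (p.γ₂ : ℂ)⁻¹ • (((z * p.δ₂) • weakDeriv2 (Y n).u₂
        + (p.γ₂ : ℂ) • weakDeriv (Y n).q₂) - (z * p.δ₂) • weakDeriv2 (Y n).u₂) := by
        rw [add_sub_cancel_left, smul_smul, inv_mul_cancel₀ hg', one_smul]
      rw [e, norm_smul]
      gcongr
      refine (norm_sub_le _ _).trans (add_le_add (hB n) ?_)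
      rw [norm_smul]
      gcongr
      exact bu2 n
    obtain ⟨K, hK, hKd⟩ := exists_norm_deriv_le l2
    have hM (n : ℕ) := isWeakDeriv_weakDeriv (hdom n).2.2.2.2.1.1
    have hM2 (n : ℕ) := isWeakDeriv_weakDeriv2 (hdom n).2.2.2.2.1
    have bM' : ∃ B, ∀ n, ‖weakDeriv (p.moment (Y n))‖ ≤ B := by
      obtain ⟨B1, hB1⟩ := exists_norm_le_of_tendsto θ0
      obtain ⟨B2, hB2⟩ := exists_norm_le_of_tendsto f4
      refine ⟨K * ((‖(-(p.α₂ : ℂ))‖ * C + ‖(p.β₂ : ℂ)‖ * B1) + (‖z‖ * C + B2)), fun n => ?_⟩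
      refine (hKd (hM n) (hM2 n)).trans ?_
      gcongr
      · rw [moment]
        refine (norm_add_le _ _).trans (add_le_add ?_ ?_)
        · rw [norm_smul]; gcongr; exact bu2 n
        · rw [norm_smul]; gcongr; exact hB1 n
      · rw [← eM]
        refine (norm_sub_le _ _).trans (add_le_add ?_ (hB2 n))
        rw [norm_smul]; gcongr; exact bv2 n
    have eu2 (n : ℕ) : (p.α₂ : ℂ)⁻¹ • ((p.β₂ : ℂ) • (Y n).θ₂ + (-1 : ℂ) • p.moment (Y n))
        = weakDeriv2 (Y n).u₂ := by
      rw [moment]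
      match_scalars
      · ring
      · field_simp
    have hu3 (n : ℕ) : IsWeakDeriv (weakDeriv2 (Y n).u₂) ((p.α₂ : ℂ)⁻¹ •
        ((p.β₂ : ℂ) • weakDeriv (Y n).θ₂ + (-1 : ℂ) • weakDeriv (p.moment (Y n)))) := by
      have := (((isWeakDeriv_weakDeriv (hdom n).2.2.1.1).smul (p.β₂ : ℂ)).add
        ((hM n).smul (-1))).smul (p.α₂ : ℂ)⁻¹
      rwa [eu2] at this
    have bu3 : ∃ B, ∀ n, ‖(p.α₂ : ℂ)⁻¹ • ((p.β₂ : ℂ) • weakDeriv (Y n).θ₂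
        + (-1 : ℂ) • weakDeriv (p.moment (Y n)))‖ ≤ B := by
      obtain ⟨B1, hB1⟩ := exists_norm_le_of_tendsto dθ0
      obtain ⟨B2, hB2⟩ := bM'
      refine ⟨‖(p.α₂ : ℂ)⁻¹‖ * (‖(p.β₂ : ℂ)‖ * B1 + ‖(-1 : ℂ)‖ * B2), fun n => ?_⟩
      rw [norm_smul]
      gcongr
      refine (norm_add_le _ _).trans (add_le_add ?_ ?_)
      · rw [norm_smul]; gcongr; exact hB1 n
      · rw [norm_smul]; gcongr; exact hB2 n
    have hq (n : ℕ) := isWeakDeriv_weakDeriv (hdom n).2.2.2.1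
    choose q₀ hq₀ using fun n => (hq n).exists_hasTrace l2 0
    choose q₁ hq₁ using fun n => (hq n).exists_hasTrace l2 p.ℓ₂
    choose b₀ hb₀ using fun n => (hu3 n).exists_hasTrace l2 0
    have q00 : Tendsto q₀ atTop (𝓝 0) := tendsto_trace_zero l2 hq hq₀ q0 bq
    have bb : ∃ B, ∀ n, ‖b₀ n‖ ≤ B := by
      obtain ⟨B, hB⟩ := bu3
      refine ⟨(√p.ℓ₂)⁻¹ * (C + ‖volterra p.ℓ₂‖ * B), fun n => ?_⟩
      rw [inv_mul_eq_div, le_div_iff₀ (Real.sqrt_pos.2 l2), mul_comm]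
      refine ((hu3 n).norm_trace_le l2 (hb₀ n)).trans ?_
      gcongr
      · exact bu2 n
      · exact hB n
    -- integration by parts; at the far end the boundary term vanishes since `u₂''(ℓ₂) = 0`
    have i0 : Tendsto (fun n => inner ℂ (weakDeriv (Y n).q₂) (weakDeriv2 (Y n).u₂)) atTop
        (𝓝 0) := by
      obtain ⟨B, hB⟩ := bb
      have k1 := tendsto_inner_zero q0 bu3
      have k2 : Tendsto (fun n => star (q₀ n) * b₀ n) atTop (𝓝 0) := by
        refine squeeze_zero_norm (fun n => ?_) (by simpa using q00.norm.mul_const B)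
        rw [norm_mul, norm_star]
        gcongr
        exact hB n
      have k3 : Tendsto (fun n => -(star (q₀ n) * b₀ n) - inner ℂ (Y n).q₂ ((p.α₂ : ℂ)⁻¹ •
          ((p.β₂ : ℂ) • weakDeriv (Y n).θ₂ + (-1 : ℂ) • weakDeriv (p.moment (Y n))))) atTop
          (𝓝 0) := by
        simpa using k2.neg.sub k1
      refine k3.congr fun n => ?_
      have := (hq n).inner_add_inner l2 (hu3 n) (hq₀ n) (hq₁ n) (hb₀ n) (hdom n).2.2.2.2.2.1
      linear_combination -this
    have u2 : Tendsto (fun n => weakDeriv2 (Y n).u₂) atTop (𝓝 0) := by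
      refine tendsto_zero_of_norm_sq ?_
      have k1 := tendsto_inner_zero s0 ⟨C, bu2⟩
      have hc : (starRingEnd ℂ) (z * p.δ₂) ≠ 0 := by
        simp [hz0, hd.ne']
      have k2 : Tendsto (fun n => ((starRingEnd ℂ) (z * p.δ₂))⁻¹ * (inner ℂ ((z * p.δ₂) •
          weakDeriv2 (Y n).u₂ + (p.γ₂ : ℂ) • weakDeriv (Y n).q₂) (weakDeriv2 (Y n).u₂)
          - (starRingEnd ℂ) (p.γ₂ : ℂ) * inner ℂ (weakDeriv (Y n).q₂) (weakDeriv2 (Y n).u₂)))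
          atTop (𝓝 0) := by
        simpa using (k1.sub (i0.const_mul ((starRingEnd ℂ) (p.γ₂ : ℂ)))).const_mul
          ((starRingEnd ℂ) (z * p.δ₂))⁻¹
      have k3 := k2.norm
      rw [norm_zero] at k3
      refine k3.congr fun n => ?_
      rw [inner_add_left, inner_smul_left, inner_smul_left, add_sub_cancel_right,
        inv_mul_cancel_left₀ hc, inner_self_eq_norm_sq_to_K]
      simp
    refine ⟨?_, u2⟩
    -- the string inherits vanishing Cauchy data at the junction
    have hd0 : Tendsto (fun n => weakDeriv (Y n).u₂) atTop (𝓝 0) :=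
      tendsto_zero_of_norm_le _ (fun n => (isWeakDeriv_weakDeriv2
        (Y n).u₂_mem).norm_le_of_hasTrace_left l2 (Y n).mem_V.2.2.2.2.2) u2
    obtain ⟨C₂, -, hP₂⟩ := exists_poincare_right l2
    have uu2 : Tendsto (fun n => (Y n).u₂) atTop (𝓝 0) :=
      tendsto_zero_of_norm_le C₂ (fun n => hP₂ (isWeakDeriv_weakDeriv (Y n).u₂_mem.1)
        (Y n).mem_V.2.2.2.1) hd0
    have v2 : Tendsto (fun n => (Y n).v₂) atTop (𝓝 0) := by
      refine Tendsto.congr ev2 ?_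
      simpa using (uu2.const_smul z).sub fu2
    have M0 : Tendsto (fun n => p.moment (Y n)) atTop (𝓝 0) := by
      simpa [moment] using (u2.const_smul (-(p.α₂ : ℂ))).add (θ0.const_smul (p.β₂ : ℂ))
    have M2 : Tendsto (fun n => weakDeriv2 (p.moment (Y n))) atTop (𝓝 0) := by
      refine Tendsto.congr eM ?_
      simpa using (v2.const_smul z).sub f4
    have M1 : Tendsto (fun n => weakDeriv (p.moment (Y n))) atTop (𝓝 0) := by
      refine squeeze_zero_norm (fun n => hKd (hM n) (hM2 n)) ?_
      simpa using (M0.norm.add M2.norm).const_mul K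
    choose cc dd hcc hdd hcd using fun n => (hdom n).2.2.2.2.2.2
    have cc0 : Tendsto cc atTop (𝓝 0) := by
      have := tendsto_trace_zero l2 hM2 hcc M1 (exists_norm_le_of_tendsto M2)
      simpa using this.neg
    have dd0 : Tendsto dd atTop (𝓝 0) := by
      have e (n : ℕ) : (p.α₁ : ℂ)⁻¹ * (((p.δ₂ / p.β₂ : ℝ) : ℂ) * cc n) = dd n := by
        rw [hcd, inv_mul_cancel_left₀ a1']
      refine Tendsto.congr e ?_
      simpa using (cc0.const_mul ((p.δ₂ / p.β₂ : ℝ) : ℂ)).const_mul (p.α₁ : ℂ)⁻¹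
    choose w₀ hw₁ hw₂ using fun n => (Y n).mem_V.2.2.2.2.1
    have w0 : Tendsto w₀ atTop (𝓝 0) :=
      tendsto_trace_zero l2 (fun n => isWeakDeriv_weakDeriv (Y n).u₂_mem.1) hw₂ uu2
        (exists_norm_le_of_tendsto hd0)
    have hb1 : 0 < r ^ 2 / p.α₁ := by positivity
    refine tendsto_deriv_zero_of_cauchy l1 hb1 (fun n => isWeakDeriv_weakDeriv (Y n).u₁_mem)
      (fun n => isWeakDeriv_weakDeriv2 (hdom n).2.1) hw₁ hdd ⟨C, bu1⟩ w0 dd0 ?_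
    have k := ((fu1.const_smul z).add f3).const_smul (-(p.α₁ : ℂ)⁻¹)
    simp only [smul_zero, add_zero] at k
    refine k.congr fun n => ?_
    have hz2 : z * z = -((r ^ 2 : ℝ) : ℂ) := by
      rw [hz]; push_cast; linear_combination (r : ℂ) ^ 2 * Complex.I_sq
    rw [← eu1, ← ev1, Complex.ofReal_div, ← neg_neg ((r ^ 2 : ℝ) : ℂ), ← hz2]
    match_scalars
    · ring
    · ring
    · ring

end StringBeam

namespace StringBeam

variable {p : StringBeam}

lemma exists_bound_imaginary (r : ℝ) : ∃ C, 0 ≤ C ∧ ∀ y : p.A₂.domain,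
    ‖(y : p.EnergySpace)‖ ≤ C * ‖(Complex.I * r) • (y : p.EnergySpace) - p.A₂ y‖ :=
  exists_bound_of_seq fun y hy hF => tendsto_zero_of_residual r y hy hF

lemma exists_isResolventAt_zero : ∃ R, IsResolventAt p.A₂ 0 R := by
  obtain ⟨C, hC0, hC⟩ := exists_bound_imaginary (p := p) 0
  obtain ⟨R, hR, -⟩ := exists_isResolventAt (A := p.A₂) (z := 0) hC0
    (fun x => by simpa using hC x) (fun f => by
      obtain ⟨y, hy⟩ := exists_A₂_eq (-f)
      exact ⟨y, by rw [hy, zero_smul, zero_sub, neg_neg]⟩)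
  exact ⟨R, hR⟩

lemma exists_isResolventAt_I_mul (r : ℝ) : ∃ R, IsResolventAt p.A₂ (Complex.I * r) R := by
  obtain ⟨C, -, hC⟩ := exists_bound_imaginary (p := p) r
  exact exists_isResolventAt_imaginary re_inner_A₂_nonpos exists_isResolventAt_zero (by simp) hC

end StringBeam

/-! ### Trigonometric and hyperbolic profiles -/

lemma IsWeakDeriv.sum {ℓ : ℝ} {ι : Type*} {f g : ι → L2 ℓ} (s : Finset ι)
    (h : ∀ j, IsWeakDeriv (f j) (g j)) : IsWeakDeriv (∑ j ∈ s, f j) (∑ j ∈ s, g j) := by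
  classical
  induction s using Finset.induction_on with
  | empty => simpa using IsWeakDeriv.zero
  | insert j s hj ih => simpa [Finset.sum_insert hj] using (h j).add ih

lemma HasTrace.sum {ℓ x : ℝ} {ι : Type*} {f : ι → L2 ℓ} {c : ι → ℂ} (s : Finset ι)
    (h : ∀ j, HasTrace (f j) x (c j)) : HasTrace (∑ j ∈ s, f j) x (∑ j ∈ s, c j) := by
  classical
  induction s using Finset.induction_on with
  | empty => simpa using HasTrace.zero
  | insert j s hj ih => simpa [Finset.sum_insert hj] using (h j).add ih

/-- The solution of `w'' = ζ²w` on `[0,ℓ]` with `w(0) = 1` and `w(ℓ) = 0`. -/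
def modeFun (ℓ : ℝ) (ζ : ℂ) (x : ℝ) : ℂ :=
  Complex.sinh (ζ * ((ℓ - x : ℝ) : ℂ)) / Complex.sinh (ζ * ℓ)

/-- The derivative of `modeFun`. -/
def modeFunDeriv (ℓ : ℝ) (ζ : ℂ) (x : ℝ) : ℂ :=
  -(ζ * Complex.cosh (ζ * ((ℓ - x : ℝ) : ℂ)) / Complex.sinh (ζ * ℓ))

lemma continuous_modeFun (ℓ : ℝ) (ζ : ℂ) : Continuous (modeFun ℓ ζ) := by
  unfold modeFun; fun_prop

lemma continuous_modeFunDeriv (ℓ : ℝ) (ζ : ℂ) : Continuous (modeFunDeriv ℓ ζ) := by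
  unfold modeFunDeriv; fun_prop

lemma hasDerivAt_mul_dist (ℓ : ℝ) (ζ : ℂ) (x : ℝ) :
    HasDerivAt (fun x : ℝ => ζ * ((ℓ - x : ℝ) : ℂ)) (-ζ) x := by
  have h := (((hasDerivAt_id x).const_sub ℓ).ofReal_comp).const_mul ζ
  simpa using h

lemma hasDerivAt_modeFun (ℓ : ℝ) (ζ : ℂ) (x : ℝ) :
    HasDerivAt (modeFun ℓ ζ) (modeFunDeriv ℓ ζ x) x := by
  refine (((Complex.hasDerivAt_sinh _).comp x
    (hasDerivAt_mul_dist ℓ ζ x)).div_const _).congr_deriv ?_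
  rw [modeFunDeriv]; ring

lemma hasDerivAt_modeFunDeriv (ℓ : ℝ) (ζ : ℂ) (x : ℝ) :
    HasDerivAt (modeFunDeriv ℓ ζ) (ζ ^ 2 * modeFun ℓ ζ x) x := by
  refine (((((Complex.hasDerivAt_cosh _).comp x
    (hasDerivAt_mul_dist ℓ ζ x)).const_mul ζ).div_const _).neg).congr_deriv ?_
  rw [modeFun]; ring

/-- `modeFun` as an element of `L²(0,ℓ)`. -/
def mode (ℓ : ℝ) (ζ : ℂ) : L2 ℓ := ofCont (modeFun ℓ ζ) (continuous_modeFun ℓ ζ)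

/-- `modeFunDeriv` as an element of `L²(0,ℓ)`. -/
def modeDeriv (ℓ : ℝ) (ζ : ℂ) : L2 ℓ := ofCont (modeFunDeriv ℓ ζ) (continuous_modeFunDeriv ℓ ζ)

/-- The logarithmic derivative `ζ coth(ζℓ)` of `modeFun` at `0`, with the opposite sign. -/
def modeSlope (ℓ : ℝ) (ζ : ℂ) : ℂ := ζ * Complex.cosh (ζ * ℓ) / Complex.sinh (ζ * ℓ)

section ModeSum

variable {ι : Type*} [Fintype ι] (ℓ : ℝ) (ζ : ι → ℂ)

/-- The superposition of the profiles `modeFun ℓ (ζ j)` with amplitudes `A j`. -/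
def modeSum (A : ι → ℂ) : L2 ℓ := ∑ j, A j • mode ℓ (ζ j)

/-- The derivative of `modeSum`. -/
def modeSumDeriv (A : ι → ℂ) : L2 ℓ := ∑ j, A j • modeDeriv ℓ (ζ j)

variable {ℓ ζ}

lemma modeSum_smul (c : ℂ) (A : ι → ℂ) : c • modeSum ℓ ζ A = modeSum ℓ ζ fun j => c * A j := by
  simp only [modeSum, Finset.smul_sum, smul_smul]

lemma modeSum_add (A B : ι → ℂ) :
    modeSum ℓ ζ A + modeSum ℓ ζ B = modeSum ℓ ζ fun j => A j + B j := by
  simp only [modeSum, ← Finset.sum_add_distrib, add_smul]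

lemma isWeakDeriv_modeSum (A : ι → ℂ) : IsWeakDeriv (modeSum ℓ ζ A) (modeSumDeriv ℓ ζ A) :=
  IsWeakDeriv.sum _ fun j => (isWeakDeriv_ofCont (continuous_modeFun ℓ (ζ j))
    (continuous_modeFunDeriv ℓ (ζ j)) (hasDerivAt_modeFun ℓ (ζ j))).smul _

lemma isWeakDeriv_modeSumDeriv (A : ι → ℂ) :
    IsWeakDeriv (modeSumDeriv ℓ ζ A) (modeSum ℓ ζ fun j => ζ j ^ 2 * A j) := by
  have h := IsWeakDeriv.sum Finset.univ fun j => (isWeakDeriv_ofCont (ℓ := ℓ)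
    (continuous_modeFunDeriv ℓ (ζ j)) (continuous_const.mul (continuous_modeFun ℓ (ζ j)))
    (hasDerivAt_modeFunDeriv ℓ (ζ j))).smul (A j)
  have e : (modeSum ℓ ζ fun j => ζ j ^ 2 * A j)
      = ∑ j, A j • (ζ j ^ 2 • (ofCont _ (continuous_modeFun ℓ (ζ j)) : L2 ℓ)) :=
    Finset.sum_congr rfl fun j _ => by rw [smul_smul, mul_comm (A j)]; rfl
  rw [e]
  exact h

lemma hasTrace_modeSum_length (A : ι → ℂ) : HasTrace (modeSum ℓ ζ A) ℓ 0 := by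
  have h := HasTrace.sum Finset.univ fun j =>
    (hasTrace_ofCont (ℓ := ℓ) ℓ (continuous_modeFun ℓ (ζ j))).smul (A j)
  simpa [modeFun, modeSum, mode] using h

lemma hasTrace_modeSum_zero (hs : ∀ j, Complex.sinh (ζ j * ℓ) ≠ 0) (A : ι → ℂ) :
    HasTrace (modeSum ℓ ζ A) 0 (∑ j, A j) := by
  have h := HasTrace.sum Finset.univ fun j =>
    (hasTrace_ofCont (ℓ := ℓ) 0 (continuous_modeFun ℓ (ζ j))).smul (A j)
  simpa [modeFun, modeSum, mode, hs] using h

lemma hasTrace_modeSumDeriv_zero (A : ι → ℂ) :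
    HasTrace (modeSumDeriv ℓ ζ A) 0 (-∑ j, modeSlope ℓ (ζ j) * A j) := by
  have h := HasTrace.sum Finset.univ fun j =>
    (hasTrace_ofCont (ℓ := ℓ) 0 (continuous_modeFunDeriv ℓ (ζ j))).smul (A j)
  have e : -∑ j, modeSlope ℓ (ζ j) * A j = ∑ j, A j * modeFunDeriv ℓ (ζ j) 0 := by
    rw [← Finset.sum_neg_distrib]
    refine Finset.sum_congr rfl fun j _ => ?_
    rw [modeFunDeriv, modeSlope, sub_zero]
    ring
  rw [e]
  exact h

lemma norm_modeSum_le {B : ℝ} (hB0 : 0 ≤ B)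
    (hB : ∀ j, ∀ x ∈ Icc 0 ℓ, ‖modeFun ℓ (ζ j) x‖ ≤ B) (A : ι → ℂ) :
    ‖modeSum ℓ ζ A‖ ≤ √ℓ * B * ∑ j, ‖A j‖ := by
  rw [modeSum, Finset.mul_sum]
  refine norm_sum_le_of_le _ fun j _ => ?_
  rw [norm_smul, mul_comm]
  gcongr
  exact norm_ofCont_le _ hB0 (hB j)

end ModeSum

/-- `E sin(ν(ℓ-x)) + G (ℓ-x) cos(ν(ℓ-x))`, a solution of `w'' + ν²w = -2νG sin(ν(ℓ-x))` that
vanishes at `ℓ`. -/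
def stringFun (ℓ ν : ℝ) (E G : ℂ) (x : ℝ) : ℂ :=
  E * ((Real.sin (ν * (ℓ - x)) : ℝ) : ℂ) + G * (((ℓ - x) * Real.cos (ν * (ℓ - x)) : ℝ) : ℂ)

/-- The derivative of `stringFun`. -/
def stringFunDeriv (ℓ ν : ℝ) (E G : ℂ) (x : ℝ) : ℂ :=
  -(E * ((ν * Real.cos (ν * (ℓ - x)) : ℝ) : ℂ)) + G * ((-Real.cos (ν * (ℓ - x))
    + (ℓ - x) * (ν * Real.sin (ν * (ℓ - x))) : ℝ) : ℂ)

lemma continuous_stringFun (ℓ ν : ℝ) (E G : ℂ) : Continuous (stringFun ℓ ν E G) := by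
  unfold stringFun; fun_prop

lemma continuous_stringFunDeriv (ℓ ν : ℝ) (E G : ℂ) : Continuous (stringFunDeriv ℓ ν E G) := by
  unfold stringFunDeriv; fun_prop

lemma hasDerivAt_stringFun (ℓ ν : ℝ) (E G : ℂ) (x : ℝ) :
    HasDerivAt (stringFun ℓ ν E G) (stringFunDeriv ℓ ν E G x) x := by
  have h0 : HasDerivAt (fun x : ℝ => ℓ - x) (-1) x := by
    simpa using (hasDerivAt_id x).const_sub ℓ
  have h1 := h0.const_mul ν
  refine ((h1.sin.ofReal_comp.const_mul E).add
    ((h0.mul h1.cos).ofReal_comp.const_mul G)).congr_deriv ?_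
  rw [stringFunDeriv]; push_cast; ring

lemma hasDerivAt_stringFunDeriv (ℓ ν : ℝ) (E G : ℂ) (x : ℝ) :
    HasDerivAt (stringFunDeriv ℓ ν E G)
      (-((ν ^ 2 : ℝ) : ℂ) * stringFun ℓ ν E G x
        + -(2 * ν * G) * ((Real.sin (ν * (ℓ - x)) : ℝ) : ℂ)) x := by
  have h0 : HasDerivAt (fun x : ℝ => ℓ - x) (-1) x := by
    simpa using (hasDerivAt_id x).const_sub ℓ
  have h1 := h0.const_mul ν
  refine (((h1.cos.const_mul ν).ofReal_comp.const_mul E).neg.add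
    ((h1.cos.neg.add (h0.mul (h1.sin.const_mul ν))).ofReal_comp.const_mul G)).congr_deriv ?_
  rw [stringFun]; push_cast; ring

/-- Approximate solution of `w'' + ν²w = 0`, `w(ℓ) = 0` with prescribed Cauchy data `U, D` at `0`.
The data are admissible for the exact equation if and only if
`U ν cos(νℓ) + D sin(νℓ) = 0`, and this expression measures the residual. -/
lemma exists_string_profile {ℓ ν : ℝ} (hν : ν * ℓ - Real.cos (ν * ℓ) * Real.sin (ν * ℓ) ≠ 0)
    (hν0 : ν ≠ 0) (U D : ℂ) :
    ∃ f g h : L2 ℓ, IsWeakDeriv f g ∧ IsWeakDeriv g h ∧ HasTrace f ℓ 0 ∧ HasTrace f 0 U ∧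
      HasTrace g 0 D ∧ ‖h + ((ν ^ 2 : ℝ) : ℂ) • f‖ ≤ √ℓ * (2 * |ν| *
        (‖U * ν * Real.cos (ν * ℓ) + D * Real.sin (ν * ℓ)‖ /
          |ν * ℓ - Real.cos (ν * ℓ) * Real.sin (ν * ℓ)|)) := by
  set c := Real.cos (ν * ℓ) with hc
  set s := Real.sin (ν * ℓ) with hs
  have hcs : (c : ℂ) ^ 2 + (s : ℂ) ^ 2 = 1 := by
    rw [hc, hs]; exact_mod_cast Real.cos_sq_add_sin_sq _
  have hν' : ((ν : ℂ) * ℓ - c * s) ≠ 0 := by exact_mod_cast hν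
  have hν0' : (ν : ℂ) ≠ 0 := by exact_mod_cast hν0
  set G : ℂ := (U * ν * c + D * s) / (ν * ℓ - c * s) with hG
  set E : ℂ := (U * ν * s - D * c - G * c ^ 2) / ν with hE
  have hG' : G * (ν * ℓ - c * s) = U * ν * c + D * s := div_mul_cancel₀ _ hν'
  have hE' : E * ν = U * ν * s - D * c - G * c ^ 2 := div_mul_cancel₀ _ hν0'
  have w0 := isWeakDeriv_ofCont (ℓ := ℓ) (continuous_stringFun ℓ ν E G)
    (continuous_stringFunDeriv ℓ ν E G) (hasDerivAt_stringFun ℓ ν E G)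
  have cc : Continuous fun x => (-((ν ^ 2 : ℝ) : ℂ) * stringFun ℓ ν E G x
        + -(2 * ν * G) * ((Real.sin (ν * (ℓ - x)) : ℝ) : ℂ)) := by
    have := continuous_stringFun ℓ ν E G
    fun_prop
  have w1 := isWeakDeriv_ofCont (ℓ := ℓ) (continuous_stringFunDeriv ℓ ν E G) cc
    (hasDerivAt_stringFunDeriv ℓ ν E G)
  refine ⟨_, _, _, w0, w1, ?_, ?_, ?_, ?_⟩
  · simpa [stringFun] using hasTrace_ofCont (ℓ := ℓ) ℓ (continuous_stringFun ℓ ν E G)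
  · have e : stringFun ℓ ν E G 0 = U := by
      simp only [stringFun, sub_zero, ← hc, ← hs]
      refine mul_left_cancel₀ hν0' ?_
      push_cast
      linear_combination (s : ℂ) * hE' + (c : ℂ) * hG' + U * ν * hcs
    simpa only [e] using hasTrace_ofCont (ℓ := ℓ) 0 (continuous_stringFun ℓ ν E G)
  · have e : stringFunDeriv ℓ ν E G 0 = D := by
      simp only [stringFunDeriv, sub_zero, ← hc, ← hs]
      push_cast
      linear_combination (-(c : ℂ)) * hE' + (s : ℂ) * hG' + (D + G * c) * hcs
    simpa only [e] using hasTrace_ofCont (ℓ := ℓ) 0 (continuous_stringFunDeriv ℓ ν E G)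
  · rw [ofCont_smul, ofCont_add]
    refine norm_ofCont_le _ (by positivity) fun x _ => ?_
    have hGn : ‖U * ν * c + D * s‖ / |ν * ℓ - c * s| = ‖G‖ := by
      rw [hG, norm_div]
      congr 1
      rw [← Real.norm_eq_abs, ← Complex.norm_real]
      push_cast
      rfl
    rw [hGn, add_right_comm, neg_mul, neg_add_cancel, zero_add, norm_mul, norm_neg, norm_mul,
      norm_mul, Complex.norm_real, Complex.norm_real, Real.norm_eq_abs, Real.norm_eq_abs,
      RCLike.norm_ofNat]
    exact mul_le_of_le_one_right (by positivity) (Real.abs_sin_le_one _)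


namespace StringBeam

variable (p : StringBeam)

/-- The amplitude of `θ₂` in a mode `u₂ = exp(ζx)`, as a multiple of the amplitude of `u₂`, obtained
from the momentum equation of the beam at frequency `l`. -/
def heatRatio (l : ℝ) (ζ : ℂ) : ℂ := (p.α₂ * (ζ ^ 2) ^ 2 - l ^ 2) / (p.β₂ * ζ ^ 2)

/-- The symbol `iλ(1 + iλτ₂)/(γ₂κ₂)` of the Cattaneo law: for `β₂ = δ₂ = 0` the temperature waves
at frequency `λ` satisfy `θ'' = heatSymbol · θ`. -/
def heatSymbol (l : ℝ) : ℂ := Complex.I * l * (1 + Complex.I * l * p.τ₂) / (p.γ₂ * p.κ₂)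

/-- The residual of the temperature equation for a mode `exp(ζx)`. -/
def heatResidual (l : ℝ) (ζ : ℂ) : ℂ :=
  Complex.I * l * (p.heatRatio l ζ * (1 - ζ ^ 2 / p.heatSymbol l) + p.δ₂ * ζ ^ 2)

/-- The slope `u₁'(0)` forced by the shear force of the beam modes. -/
def junctionSlope {ι : Type*} [Fintype ι] (l : ℝ) (ζ A : ι → ℂ) : ℂ :=
  -((p.δ₂ / (p.β₂ * p.α₁) : ℝ) : ℂ) *
    ∑ j, l ^ 2 / ζ j ^ 2 * (modeSlope p.ℓ₂ (ζ j) * A j)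

variable {p}

/-- If `u₁'` has trace `D` at the junction and `v₁ = iλu₁`, the energy norm controls `D` up to the
residual of the wave equation. -/
lemma exists_norm_junction_le (p : StringBeam) :
    ∃ C : ℝ, 0 < C ∧ ∀ (l : ℝ) (y : p.A₂.domain) (D : ℂ),
    (y : p.EnergySpace).v₁ = (Complex.I * l) • (y : p.EnergySpace).u₁ →
    HasTrace (weakDeriv (y : p.EnergySpace).u₁) 0 D →
    ‖D‖ ^ 2 ≤ C * (‖(y : p.EnergySpace)‖ ^ 2
      + ‖(y : p.EnergySpace)‖ * ‖(Complex.I * l) • (y : p.EnergySpace) - p.A₂ y‖) := by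
  have ha := p.α₁_pos; have hl := p.ℓ₁_pos
  obtain ⟨C, hC, hcomp⟩ := p.exists_component_bound
  set X := ‖mulDist p.ℓ₁‖ with hX
  have hX0 : 0 ≤ X := norm_nonneg _
  refine ⟨p.ℓ₁⁻¹ * (C ^ 2 * (1 + p.α₁⁻¹ + 2 * p.α₁⁻¹ * X)), by positivity, fun l y D hv hD => ?_⟩
  obtain ⟨y, hy⟩ := y
  simp only at hv hD
  set F : p.EnergySpace := (Complex.I * l) • y - p.A₂ ⟨y, hy⟩ with hF
  have w0 := isWeakDeriv_weakDeriv y.u₁_mem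
  have w1 := isWeakDeriv_weakDeriv2 hy.2.1
  obtain ⟨U, hU⟩ := w0.exists_hasTrace hl 0
  have i1 := w1.mulDist_identity hl hD
  have i2 := w0.mulDist_identity hl hU
  have hz2 : (Complex.I * l) * (Complex.I * l) = -((l ^ 2 : ℝ) : ℂ) := by
    push_cast; linear_combination (l : ℂ) ^ 2 * Complex.I_sq
  have eF : (p.α₁ : ℂ) • weakDeriv2 y.u₁ = (-((l ^ 2 : ℝ) : ℂ)) • y.u₁ - F.v₁ := by
    rw [show F.v₁ = (Complex.I * l) • y.v₁ - (p.α₁ : ℂ) • weakDeriv2 y.u₁ from rfl, hv, smul_smul,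
      hz2, sub_sub_cancel]
  have e1 : p.α₁ * (inner ℂ (mulDist p.ℓ₁ (weakDeriv y.u₁)) (weakDeriv2 y.u₁)).re
      = -(l ^ 2 * (inner ℂ (mulDist p.ℓ₁ y.u₁) (weakDeriv y.u₁)).re)
        - (inner ℂ (mulDist p.ℓ₁ (weakDeriv y.u₁)) F.v₁).re := by
    rw [← Complex.re_ofReal_mul, ← inner_smul_right, eF, inner_sub_right, inner_smul_right,
      Complex.sub_re, ← Complex.ofReal_neg, Complex.re_ofReal_mul, inner_mulDist_left y.u₁,
      ← inner_conj_symm y.u₁, Complex.conj_re]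
    ring
  have e2 : ‖y.v₁‖ ^ 2 = l ^ 2 * ‖y.u₁‖ ^ 2 := by
    rw [hv, norm_smul, norm_mul, Complex.norm_I, one_mul, Complex.norm_real, mul_pow,
      Real.norm_eq_abs, sq_abs]
  obtain ⟨b1, -, b3, -⟩ := hcomp y
  have b3' := (hcomp F).2.2.1
  have e3 : -(inner ℂ (mulDist p.ℓ₁ (weakDeriv y.u₁)) F.v₁).re ≤ X * (C * ‖y‖) * (C * ‖F‖) := by
    refine (neg_le_abs _).trans ((Complex.abs_re_le_norm _).trans
      ((norm_inner_le_norm _ _).trans ?_))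
    gcongr
    exact ((mulDist p.ℓ₁).le_opNorm _).trans (by gcongr)
  have e3' : (inner ℂ (mulDist p.ℓ₁ (weakDeriv y.u₁)) F.v₁).re ≤ X * (C * ‖y‖) * (C * ‖F‖) := by
    refine (Complex.re_le_norm _).trans ((norm_inner_le_norm _ _).trans ?_)
    gcongr
    exact ((mulDist p.ℓ₁).le_opNorm _).trans (by gcongr)
  have s1 : ‖weakDeriv y.u₁‖ ^ 2 ≤ (C * ‖y‖) ^ 2 := by gcongr
  have s3 : ‖y.v₁‖ ^ 2 ≤ (C * ‖y‖) ^ 2 := by gcongr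
  have tot : p.α₁ * (p.ℓ₁ * ‖D‖ ^ 2) ≤ p.α₁ * (C * ‖y‖) ^ 2 + (C * ‖y‖) ^ 2
      + 2 * (X * (C * ‖y‖) * (C * ‖F‖)) := by
    have h1 : 0 ≤ l ^ 2 * (p.ℓ₁ * ‖U‖ ^ 2) := by positivity
    have h2 : p.α₁ * ‖weakDeriv y.u₁‖ ^ 2 ≤ p.α₁ * (C * ‖y‖) ^ 2 := by gcongr
    have h4 : l ^ 2 * ‖y.u₁‖ ^ 2 = l ^ 2 * (2 * (inner ℂ (mulDist p.ℓ₁ y.u₁)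
      (weakDeriv y.u₁)).re + p.ℓ₁ * ‖U‖ ^ 2) := by rw [← i2]
    have h5 : p.α₁ * ‖weakDeriv y.u₁‖ ^ 2 = p.α₁ * (2 * (inner ℂ (mulDist p.ℓ₁ (weakDeriv y.u₁))
      (weakDeriv2 y.u₁)).re + p.ℓ₁ * ‖D‖ ^ 2) := by rw [← i1]
    linarith
  have hfin : p.α₁ * (p.ℓ₁ * ‖D‖ ^ 2) ≤ p.α₁ * (p.ℓ₁ * (p.ℓ₁⁻¹ * (C ^ 2 *
      (1 + p.α₁⁻¹ + 2 * p.α₁⁻¹ * X)) * (‖y‖ ^ 2 + ‖y‖ * ‖F‖))) := by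
    refine tot.trans ?_
    have h6 : 0 ≤ 2 * X * C ^ 2 * ‖y‖ ^ 2 + (p.α₁ + 1) * C ^ 2 * (‖y‖ * ‖F‖) := by positivity
    have h7 : p.α₁ * (p.ℓ₁ * (p.ℓ₁⁻¹ * (C ^ 2 *
      (1 + p.α₁⁻¹ + 2 * p.α₁⁻¹ * X)) * (‖y‖ ^ 2 + ‖y‖ * ‖F‖)))
      = C ^ 2 * (p.α₁ + 1 + 2 * X) * (‖y‖ ^ 2 + ‖y‖ * ‖F‖) := by
      field_simp
    rw [h7]
    linarith
  exact le_of_mul_le_mul_left (le_of_mul_le_mul_left hfin ha) hl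

/-- Superposing modes of the beam that satisfy the boundary conditions `u₂'(0) = θ₂(0) = 0` and
attaching the string, one obtains an element of the domain with residual only in the equations
for `v₁` and `θ₂`. The conditions at `ℓ₂` hold mode by mode, and the string is given the Cauchy
data that the transmission conditions require. -/
lemma exists_state {ι : Type*} [Fintype ι] (l ν B : ℝ) (ζ A : ι → ℂ)
    (hl : l ≠ 0) (hlν : l ^ 2 = p.α₁ * ν ^ 2)
    (hν : ν * p.ℓ₁ - Real.cos (ν * p.ℓ₁) * Real.sin (ν * p.ℓ₁) ≠ 0)
    (hζ : ∀ j, ζ j ≠ 0) (hs : ∀ j, Complex.sinh (ζ j * p.ℓ₂) ≠ 0)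
    (hslope : ∑ j, modeSlope p.ℓ₂ (ζ j) * A j = 0) (hheat : ∑ j, p.heatRatio l (ζ j) * A j = 0)
    (hB0 : 0 ≤ B) (hB : ∀ j, ∀ x ∈ Icc 0 p.ℓ₂, ‖modeFun p.ℓ₂ (ζ j) x‖ ≤ B) :
    ∃ y : p.A₂.domain,
      (y : p.EnergySpace).v₁ = (Complex.I * l) • (y : p.EnergySpace).u₁ ∧
      HasTrace (weakDeriv (y : p.EnergySpace).u₁) 0 (p.junctionSlope l ζ A) ∧
      ‖(Complex.I * l) • (y : p.EnergySpace) - p.A₂ y‖ ≤ p.α₁ * (√p.ℓ₁ * (2 * |ν| *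
        (‖(∑ j, A j) * ν * Real.cos (ν * p.ℓ₁) + p.junctionSlope l ζ A * Real.sin (ν * p.ℓ₁)‖ /
          |ν * p.ℓ₁ - Real.cos (ν * p.ℓ₁) * Real.sin (ν * p.ℓ₁)|)))
        + √p.ℓ₂ * B * ∑ j, ‖p.heatResidual l (ζ j) * A j‖ := by
  have hb := p.β₂_pos; have hd := p.δ₂_pos; have ha := p.α₁_pos
  have hg' : (p.γ₂ : ℂ) ≠ 0 := by exact_mod_cast p.γ₂_pos.ne'
  have hk' : (p.κ₂ : ℂ) ≠ 0 := by exact_mod_cast p.κ₂_pos.ne'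
  have ht' : (p.τ₂ : ℂ) ≠ 0 := by exact_mod_cast p.τ₂_pos.ne'
  have hb' : (p.β₂ : ℂ) ≠ 0 := by exact_mod_cast hb.ne'
  have ha' : (p.α₁ : ℂ) ≠ 0 := by exact_mod_cast ha.ne'
  have hl' : (l : ℂ) ≠ 0 := by exact_mod_cast hl
  have hν0 : ν ≠ 0 := by
    rintro rfl
    have : l ^ 2 = 0 := by simpa using hlν
    exact hl (by simpa using this)
  have hc : (1 + Complex.I * l * p.τ₂ : ℂ) ≠ 0 := by
    intro h
    have := congrArg Complex.re h
    simp at this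
  set z : ℂ := Complex.I * l with hz
  set D := p.junctionSlope l ζ A with hD
  obtain ⟨f, g, h, wf, wg, t1, t2, t3, hres⟩ := exists_string_profile hν hν0 (∑ j, A j) D
  set u : L2 p.ℓ₂ := modeSum p.ℓ₂ ζ A with hu
  set T : ι → ℂ := fun j => p.heatRatio l (ζ j) * A j with hT
  set r : ℂ := -(p.κ₂ : ℂ) / (1 + Complex.I * l * p.τ₂) with hr
  have wu : IsWeakDeriv u _ := isWeakDeriv_modeSum A
  have wu' := isWeakDeriv_modeSumDeriv (ℓ := p.ℓ₂) (ζ := ζ) A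
  have wT : IsWeakDeriv (modeSum p.ℓ₂ ζ T) _ := isWeakDeriv_modeSum T
  have wq := (isWeakDeriv_modeSumDeriv (ℓ := p.ℓ₂) (ζ := ζ) T).smul r
  have hV : (f, u) ∈ p.V := by
    refine ⟨wf.mem_H1, mem_H2_of_isWeakDeriv wu wu', t1, hasTrace_modeSum_length A, ⟨_, t2,
      hasTrace_modeSum_zero hs A⟩, ?_⟩
    change HasTrace (weakDeriv u) 0 0
    rw [wu.weakDeriv_eq]
    simpa [hslope] using hasTrace_modeSumDeriv_zero (ℓ := p.ℓ₂) (ζ := ζ) A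
  set y : p.EnergySpace := mkState hV (z • f) (z • u) (modeSum p.ℓ₂ ζ T)
    (r • modeSumDeriv p.ℓ₂ ζ T) with hy
  have hM : p.moment y = modeSum p.ℓ₂ ζ fun j => -(l ^ 2 / ζ j ^ 2) * A j := by
    rw [moment, show y.u₂ = u from rfl, weakDeriv2_eq wu wu', show y.θ₂ = modeSum p.ℓ₂ ζ T from rfl,
      modeSum_smul, modeSum_smul, modeSum_add]
    congr 1
    ext j
    have := hζ j
    rw [hT]
    simp only [heatRatio]
    field_simp
    ring
  have wM : IsWeakDeriv (p.moment y) (modeSumDeriv p.ℓ₂ ζ fun j => -(l ^ 2 / ζ j ^ 2) * A j) := by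
    rw [hM]; exact isWeakDeriv_modeSum _
  have wM' := isWeakDeriv_modeSumDeriv (ℓ := p.ℓ₂) (ζ := ζ) fun j => -(l ^ 2 / ζ j ^ 2) * A j
  have hdom : y ∈ p.domain := by
    refine ⟨p.V.smul_mem z hV, mem_H2_of_isWeakDeriv wf wg, ⟨wT.mem_H1, ?_,
      hasTrace_modeSum_length T⟩, wq.mem_H1, mem_H2_of_isWeakDeriv wM wM', ?_,
      -∑ j, l ^ 2 / ζ j ^ 2 * (modeSlope p.ℓ₂ (ζ j) * A j), D, ?_, ?_, ?_⟩
    · have := hasTrace_modeSum_zero hs T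
      rwa [show ∑ j, T j = 0 from hheat] at this
    · rw [show y.u₂ = u from rfl, weakDeriv2_eq wu wu']
      exact hasTrace_modeSum_length _
    · rw [wM.weakDeriv_eq]
      convert hasTrace_modeSumDeriv_zero (ℓ := p.ℓ₂) (ζ := ζ)
        (fun j => -(l ^ 2 / ζ j ^ 2) * A j) using 2
      rw [← Finset.sum_neg_distrib]
      exact Finset.sum_congr rfl fun j _ => by ring
    · rw [show y.u₁ = f from rfl, wf.weakDeriv_eq]
      exact t3
    · rw [hD, junctionSlope]
      push_cast
      field_simp
  refine ⟨⟨y, hdom⟩, rfl, ?_, ?_⟩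
  · change HasTrace (weakDeriv f) 0 D
    rw [wf.weakDeriv_eq]
    exact t3
  set F : p.EnergySpace := z • y - p.A₂ ⟨y, hdom⟩ with hF
  have F1 : F.u₁ = 0 := sub_self (z • f)
  have F2 : F.u₂ = 0 := sub_self (z • u)
  have hz2 : z * z = -((l ^ 2 : ℝ) : ℂ) := by
    rw [hz]; push_cast; linear_combination (l : ℂ) ^ 2 * Complex.I_sq
  have F3 : F.v₁ = (-(p.α₁ : ℂ)) • (h + ((ν ^ 2 : ℝ) : ℂ) • f) := by
    rw [show F.v₁ = z • z • f - (p.α₁ : ℂ) • weakDeriv2 f from rfl, weakDeriv2_eq wf wg, smul_smul,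
      hz2, hlν]
    push_cast
    module
  have F4 : F.v₂ = 0 := by
    rw [show F.v₂ = z • z • u - weakDeriv2 (p.moment y) from rfl, weakDeriv2_eq wM wM', smul_smul,
      hz2, hu, modeSum_smul, sub_eq_zero]
    congr 1
    ext j
    have := hζ j
    push_cast
    field_simp
  have F5 : F.θ₂ = modeSum p.ℓ₂ ζ fun j => p.heatResidual l (ζ j) * A j := by
    rw [show F.θ₂ = z • modeSum p.ℓ₂ ζ T - ((-(p.δ₂ : ℂ)) • weakDeriv2 (z • u)
      - (p.γ₂ : ℂ) • weakDeriv (r • modeSumDeriv p.ℓ₂ ζ T)) from rfl, wq.weakDeriv_eq,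
      weakDeriv2_eq (wu.smul z) (wu'.smul z)]
    have e (a b c : L2 p.ℓ₂) : a - ((-(p.δ₂ : ℂ)) • b - (p.γ₂ : ℂ) • c)
      = a + ((p.δ₂ : ℂ) • b + (p.γ₂ : ℂ) • c) := by module
    rw [e]
    simp only [modeSum_smul, modeSum_add]
    congr 1
    ext j
    have := hζ j
    rw [heatResidual, heatSymbol, hr, hT]
    simp only
    field_simp
    ring
  have F6 : F.q₂ = 0 := by
    rw [show F.q₂ = z • r • modeSumDeriv p.ℓ₂ ζ T - ((-((1 / p.τ₂ : ℝ) : ℂ)) • r •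
      modeSumDeriv p.ℓ₂ ζ T - ((p.κ₂ / p.τ₂ : ℝ) : ℂ) • weakDeriv (modeSum p.ℓ₂ ζ T)) from rfl,
      wT.weakDeriv_eq]
    have e : z * r + (1 / p.τ₂ : ℝ) * r + (p.κ₂ / p.τ₂ : ℝ) = 0 := by
      have hc' : (1 + Complex.I * l * p.τ₂ : ℂ) ≠ 0 := hc
      rw [hr, hz]
      push_cast
      field_simp
      ring
    rw [show z • r • modeSumDeriv p.ℓ₂ ζ T - ((-((1 / p.τ₂ : ℝ) : ℂ)) • r •
      modeSumDeriv p.ℓ₂ ζ T - ((p.κ₂ / p.τ₂ : ℝ) : ℂ) • modeSumDeriv p.ℓ₂ ζ T)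
      = (z * r + (1 / p.τ₂ : ℝ) * r + (p.κ₂ / p.τ₂ : ℝ)) • modeSumDeriv p.ℓ₂ ζ T by module, e,
      zero_smul]
  have hn : ‖F‖ ≤ ‖F.v₁‖ + ‖F.θ₂‖ := by
    refine abs_le_of_sq_le_sq' ?_ (by positivity) |>.2
    rw [p.norm_sq, F1, F2, F4, F6, weakDeriv_zero, weakDeriv2_zero]
    simp only [norm_zero]
    nlinarith [mul_nonneg (norm_nonneg F.v₁) (norm_nonneg F.θ₂)]
  refine hn.trans (add_le_add ?_ ?_)
  · rw [F3, norm_smul, norm_neg, Complex.norm_real, Real.norm_of_nonneg ha.le]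
    gcongr
  · rw [F5]
    exact norm_modeSum_le hB0 hB _

end StringBeam

/-! ### Orders of growth -/

/-- `f(k) = O(kⁿ)` along the filter `L`. -/
def HasOrder (L : Filter ℝ) (f : ℝ → ℂ) (n : ℤ) : Prop := f =O[L] fun k : ℝ => k ^ n

/-- `|f(k)|` is bounded below by a multiple of `kⁿ` along the filter `L`. -/
def HasLowerOrder (L : Filter ℝ) (f : ℝ → ℂ) (n : ℤ) : Prop := (fun k : ℝ => k ^ n) =O[L] f

section Order

variable {L : Filter ℝ} {f g : ℝ → ℂ} {m n : ℤ}

lemma eventually_one_le (hL : L ≤ atTop) : ∀ᶠ k in L, (1 : ℝ) ≤ k := hL (eventually_ge_atTop 1)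

lemma HasOrder.mono (hL : L ≤ atTop) (h : HasOrder L f m) (hmn : m ≤ n) : HasOrder L f n := by
  refine h.trans (Asymptotics.IsBigO.of_bound 1 ?_)
  filter_upwards [eventually_one_le hL] with k hk
  rw [one_mul, Real.norm_of_nonneg (by positivity), Real.norm_of_nonneg (by positivity)]
  exact zpow_le_zpow_right₀ hk hmn

lemma HasOrder.add (hf : HasOrder L f n) (hg : HasOrder L g n) :
    HasOrder L (fun k => f k + g k) n := Asymptotics.IsBigO.add hf hg

lemma HasOrder.sub (hf : HasOrder L f n) (hg : HasOrder L g n) :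
    HasOrder L (fun k => f k - g k) n := Asymptotics.IsBigO.sub hf hg

lemma HasOrder.neg (hf : HasOrder L f n) : HasOrder L (fun k => -f k) n :=
  Asymptotics.IsBigO.neg_left hf

lemma HasOrder.mul (hL : L ≤ atTop) (hf : HasOrder L f m) (hg : HasOrder L g n) :
    HasOrder L (fun k => f k * g k) (m + n) := by
  refine (Asymptotics.IsBigO.mul hf hg).congr' EventuallyEq.rfl ?_
  filter_upwards [eventually_one_le hL] with k hk
  rw [zpow_add₀ (by positivity)]

lemma HasOrder.div (hL : L ≤ atTop) (hf : HasOrder L f m) (hg : HasLowerOrder L g n) :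
    HasOrder L (fun k => f k / g k) (m - n) := by
  have h : (fun k => (g k)⁻¹) =O[L] fun k : ℝ => (k ^ n)⁻¹ := by
    refine Asymptotics.IsBigO.inv_rev hg ?_
    filter_upwards [eventually_one_le hL] with k hk h0
    exact absurd h0 (by positivity)
  refine (Asymptotics.IsBigO.mul hf h).congr' (Eventually.of_forall fun k => ?_) ?_
  · exact (div_eq_mul_inv _ _).symm
  filter_upwards [eventually_one_le hL] with k hk
  rw [zpow_sub₀ (by positivity), div_eq_mul_inv]

lemma HasOrder.congr (hf : HasOrder L f n) (h : ∀ᶠ k in L, f k = g k) : HasOrder L g n :=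
  Asymptotics.IsBigO.congr' hf h EventuallyEq.rfl

lemma hasOrder_const (c : ℂ) : HasOrder L (fun _ => c) 0 := by
  simpa [HasOrder] using Asymptotics.isBigO_const_const c (one_ne_zero (α := ℝ)) L

lemma HasOrder.const_mul (c : ℂ) (hf : HasOrder L f n) : HasOrder L (fun k => c * f k) n :=
  Asymptotics.IsBigO.const_mul_left hf c

lemma hasOrder_pow (n : ℕ) : HasOrder L (fun k => (k : ℂ) ^ n) n := by
  refine Asymptotics.IsBigO.of_bound 1 (Eventually.of_forall fun k => ?_)
  rw [norm_pow, Complex.norm_real, zpow_natCast, norm_pow, one_mul]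

lemma hasOrder_monomial (hL : L ≤ atTop) (c : ℂ) {i : ℕ} (hi : (i : ℤ) ≤ n) :
    HasOrder L (fun k => c * (k : ℂ) ^ i) n := ((hasOrder_pow i).mono hL hi).const_mul c

lemma HasOrder.of_norm_le {C : ℝ} (h : ∀ᶠ k in L, ‖f k‖ ≤ C) : HasOrder L f 0 :=
  Asymptotics.IsBigO.of_bound C (by filter_upwards [h] with k hk; simpa using hk)

lemma HasOrder.of_norm_le_norm (hg : HasOrder L g n) {C : ℝ} (h : ∀ᶠ k in L, ‖f k‖ ≤ C * ‖g k‖) :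
    HasOrder L f n := (Asymptotics.IsBigO.of_bound C h).trans hg

lemma HasOrder.exists_bound (hL : L ≤ atTop) (hf : HasOrder L f n) :
    ∃ C, 0 < C ∧ ∀ᶠ k in L, ‖f k‖ ≤ C * k ^ n := by
  obtain ⟨C, hC, h⟩ := Asymptotics.IsBigO.exists_pos hf
  refine ⟨C, hC, ?_⟩
  filter_upwards [h.bound, eventually_one_le hL] with k hk h1
  rwa [Real.norm_of_nonneg (by positivity)] at hk

lemma HasLowerOrder.of_le {C : ℝ} (hC : 0 < C) (hL : L ≤ atTop)
    (h : ∀ᶠ k in L, C * k ^ n ≤ ‖f k‖) : HasLowerOrder L f n := by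
  refine Asymptotics.IsBigO.of_bound C⁻¹ ?_
  filter_upwards [h, eventually_one_le hL] with k hk h1
  rw [Real.norm_of_nonneg (by positivity), ← div_eq_inv_mul, le_div_iff₀ hC, mul_comm]
  exact hk

lemma HasLowerOrder.exists_bound (hL : L ≤ atTop) (hf : HasLowerOrder L f n) :
    ∃ C, 0 < C ∧ ∀ᶠ k in L, C * k ^ n ≤ ‖f k‖ := by
  obtain ⟨C, hC, h⟩ := Asymptotics.IsBigO.exists_pos hf
  refine ⟨C⁻¹, inv_pos.2 hC, ?_⟩
  filter_upwards [h.bound, eventually_one_le hL] with k hk h1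
  rw [Real.norm_of_nonneg (by positivity)] at hk
  rwa [← div_eq_inv_mul, div_le_iff₀ hC, mul_comm]

lemma HasLowerOrder.mul (hL : L ≤ atTop) (hf : HasLowerOrder L f m) (hg : HasLowerOrder L g n) :
    HasLowerOrder L (fun k => f k * g k) (m + n) := by
  refine (Asymptotics.IsBigO.mul hf hg).congr' ?_ EventuallyEq.rfl
  filter_upwards [eventually_one_le hL] with k hk
  rw [zpow_add₀ (by positivity)]

lemma HasLowerOrder.const_mul {c : ℂ} (hc : c ≠ 0) (hf : HasLowerOrder L f n) :
    HasLowerOrder L (fun k => c * f k) n :=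
  (Asymptotics.isBigO_const_mul_right_iff hc).2 hf

lemma HasLowerOrder.div (hL : L ≤ atTop) (hf : HasLowerOrder L f m) (hg : HasOrder L g n)
    (h0 : ∀ᶠ k in L, g k ≠ 0) : HasLowerOrder L (fun k => f k / g k) (m - n) := by
  have h : (fun k : ℝ => (k ^ n)⁻¹) =O[L] fun k => (g k)⁻¹ :=
    Asymptotics.IsBigO.inv_rev hg (by filter_upwards [h0] with k hk h0' using absurd h0' hk)
  refine (Asymptotics.IsBigO.mul hf h).congr' ?_ (Eventually.of_forall fun k => ?_)
  · filter_upwards [eventually_one_le hL] with k hk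
    rw [zpow_sub₀ (by positivity), div_eq_mul_inv]
  · exact (div_eq_mul_inv _ _).symm

/-- A term of lower order does not affect a lower bound. -/
lemma HasLowerOrder.add (hL : L ≤ atTop) (hf : HasLowerOrder L f n) (hg : HasOrder L g m)
    (hmn : m < n) : HasLowerOrder L (fun k => f k + g k) n := by
  obtain ⟨c, hc, h1⟩ := hf.exists_bound hL
  obtain ⟨C, hC, h2⟩ := hg.exists_bound hL
  refine HasLowerOrder.of_le (C := c / 2) (by positivity) hL ?_
  filter_upwards [h1, h2, eventually_one_le hL, hL (eventually_ge_atTop (2 * C / c))]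
    with k k1 k2 k3 k4
  have e : C * k ^ m ≤ c / 2 * k ^ n := by
    have : k ^ (m + 1) ≤ k ^ n := zpow_le_zpow_right₀ k3 (by lia)
    calc C * k ^ m = c / 2 * (k ^ m * (2 * C / c)) := by field_simp
      _ ≤ c / 2 * (k ^ m * k) := by gcongr
      _ = c / 2 * k ^ (m + 1) := by rw [zpow_add_one₀ (by positivity)]
      _ ≤ _ := by gcongr
  have := norm_sub_norm_le (f k) (-g k)
  rw [norm_neg, sub_neg_eq_add] at this
  linarith

end Order

/-! ### Bounds for the profiles -/

lemma norm_sinh_le_cosh_re (z : ℂ) : ‖Complex.sinh z‖ ≤ Real.cosh z.re := by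
  rw [Complex.sinh, norm_div, RCLike.norm_ofNat, Real.cosh_eq]
  gcongr
  refine (norm_sub_le _ _).trans (le_of_eq ?_)
  rw [Complex.norm_exp, Complex.norm_exp, Complex.neg_re]

lemma norm_cosh_le_cosh_re (z : ℂ) : ‖Complex.cosh z‖ ≤ Real.cosh z.re := by
  rw [Complex.cosh, norm_div, RCLike.norm_ofNat, Real.cosh_eq]
  gcongr
  refine (norm_add_le _ _).trans (le_of_eq ?_)
  rw [Complex.norm_exp, Complex.norm_exp, Complex.neg_re]

lemma sinh_re_le_norm_sinh (z : ℂ) : Real.sinh z.re ≤ ‖Complex.sinh z‖ := by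
  rw [Complex.sinh, norm_div, RCLike.norm_ofNat, Real.sinh_eq]
  gcongr
  have := norm_sub_norm_le (Complex.exp z) (Complex.exp (-z))
  rwa [Complex.norm_exp, Complex.norm_exp, Complex.neg_re] at this

section Profiles

variable {ℓ : ℝ}

lemma sinh_ne_zero_of_re_pos {ζ : ℂ} (hℓ : 0 < ℓ) (h : 0 < ζ.re) : Complex.sinh (ζ * ℓ) ≠ 0 := by
  rw [← norm_pos_iff]
  refine lt_of_lt_of_le ?_ (sinh_re_le_norm_sinh _)
  rw [Complex.re_mul_ofReal, Real.sinh_pos_iff]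
  positivity

lemma norm_modeFun_le_of_re_pos {ζ : ℂ} (hℓ : 0 < ℓ) (h : 0 < ζ.re) {x : ℝ} (hx : x ∈ Icc 0 ℓ) :
    ‖modeFun ℓ ζ x‖ ≤ Real.cosh (ζ.re * ℓ) / Real.sinh (ζ.re * ℓ) := by
  have hs : 0 < Real.sinh (ζ.re * ℓ) := by rw [Real.sinh_pos_iff]; positivity
  rw [modeFun, norm_div]
  have h1 := norm_sinh_le_cosh_re (ζ * ((ℓ - x : ℝ) : ℂ))
  have h2 := sinh_re_le_norm_sinh (ζ * ℓ)
  rw [Complex.re_mul_ofReal] at h1 h2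
  have h3 : Real.cosh (ζ.re * (ℓ - x)) ≤ Real.cosh (ζ.re * ℓ) := by
    rw [Real.cosh_le_cosh, abs_of_nonneg (mul_nonneg h.le (sub_nonneg.2 hx.2)),
      abs_of_nonneg (by positivity)]
    gcongr
    linarith [hx.1]
  gcongr
  exact h1.trans h3

lemma norm_modeSlope_le_of_re_pos {ζ : ℂ} (hℓ : 0 < ℓ) (h : 0 < ζ.re) :
    ‖modeSlope ℓ ζ‖ ≤ Real.cosh (ζ.re * ℓ) / Real.sinh (ζ.re * ℓ) * ‖ζ‖ := by
  have hs : 0 < Real.sinh (ζ.re * ℓ) := by rw [Real.sinh_pos_iff]; positivity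
  have h1 := norm_cosh_le_cosh_re (ζ * ℓ)
  have h2 := sinh_re_le_norm_sinh (ζ * ℓ)
  rw [Complex.re_mul_ofReal] at h1 h2
  rw [modeSlope, mul_div_assoc, norm_mul, mul_comm, norm_div]
  gcongr

lemma coth_le {x : ℝ} (hx : 0 < x) : Real.cosh x / Real.sinh x ≤ 1 + 1 / x := by
  have hs : 0 < Real.sinh x := Real.sinh_pos_iff.2 hx
  have h1 : Real.cosh x - Real.sinh x = Real.exp (-x) := Real.cosh_sub_sinh x
  have h2 : x ≤ Real.sinh x := Real.self_le_sinh_iff.2 hx.le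
  have h3 : Real.exp (-x) ≤ 1 := Real.exp_le_one_iff.2 (by linarith)
  rw [div_le_iff₀ hs, add_mul, one_mul, one_div, ← div_eq_inv_mul]
  have h4 : 1 ≤ Real.sinh x / x := by rwa [one_le_div hx]
  linarith

/-- `r coth(rℓ) = r + O(1)`. -/
lemma norm_modeSlope_ofReal_sub_le (hℓ : 0 < ℓ) {r : ℝ} (hr : 0 < r) :
    ‖modeSlope ℓ r - r‖ ≤ 1 / ℓ := by
  have hs : 0 < Real.sinh (r * ℓ) := by rw [Real.sinh_pos_iff]; positivity
  have e : modeSlope ℓ r - r = ((r * (Real.cosh (r * ℓ) / Real.sinh (r * ℓ) - 1) : ℝ) : ℂ) := by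
    rw [modeSlope]
    push_cast
    ring
  have h1 := coth_le (x := r * ℓ) (by positivity)
  have h2 : 1 ≤ Real.cosh (r * ℓ) / Real.sinh (r * ℓ) := by
    rw [one_le_div hs]; exact (Real.sinh_lt_cosh _).le
  rw [e, Complex.norm_real, Real.norm_of_nonneg (mul_nonneg hr.le (by linarith))]
  calc r * (Real.cosh (r * ℓ) / Real.sinh (r * ℓ) - 1) ≤ r * (1 / (r * ℓ)) := by
        gcongr; linarith
    _ = 1 / ℓ := by field_simp

lemma norm_modeFun_ofReal_le (hℓ : 0 < ℓ) {r : ℝ} (hr : 0 < r) {x : ℝ} (hx : x ∈ Icc 0 ℓ) :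
    ‖modeFun ℓ r x‖ ≤ 1 := by
  have hs : 0 < Real.sinh (r * ℓ) := by rw [Real.sinh_pos_iff]; positivity
  have e : modeFun ℓ r x = ((Real.sinh (r * (ℓ - x)) / Real.sinh (r * ℓ) : ℝ) : ℂ) := by
    rw [modeFun]; push_cast; rfl
  have h0 : 0 ≤ Real.sinh (r * (ℓ - x)) :=
    Real.sinh_nonneg_iff.2 (mul_nonneg hr.le (sub_nonneg.2 hx.2))
  rw [e, Complex.norm_real, Real.norm_of_nonneg (by positivity), div_le_one hs, Real.sinh_le_sinh]
  gcongr
  linarith [hx.1]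

lemma sinh_I_mul (k : ℝ) (x : ℝ) :
    Complex.sinh (Complex.I * k * x) = Complex.I * (Real.sin (k * x) : ℝ) := by
  rw [mul_assoc, mul_comm, Complex.sinh_mul_I, mul_comm, Complex.ofReal_sin, Complex.ofReal_mul]

lemma modeSlope_I_mul (k : ℝ) :
    modeSlope ℓ (Complex.I * k) = ((k * Real.cos (k * ℓ) / Real.sin (k * ℓ) : ℝ) : ℂ) := by
  rw [modeSlope, sinh_I_mul, mul_assoc Complex.I k ℓ, mul_comm Complex.I (k * ℓ : ℂ),
    Complex.cosh_mul_I, mul_assoc, mul_div_mul_left _ _ Complex.I_ne_zero]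
  push_cast
  rfl

lemma norm_modeFun_I_mul_le {k : ℝ} (hk : 1 / 2 ≤ Real.sin (k * ℓ)) (x : ℝ) :
    ‖modeFun ℓ (Complex.I * k) x‖ ≤ 2 := by
  rw [modeFun, sinh_I_mul, sinh_I_mul, mul_div_mul_left _ _ Complex.I_ne_zero, norm_div,
    Complex.norm_real, Complex.norm_real, Real.norm_eq_abs, Real.norm_of_nonneg (by linarith),
    div_le_iff₀ (by linarith)]
  linarith [Real.abs_sin_le_one (k * (ℓ - x))]

end Profiles

/-! ### The approximate eigenvectors -/

namespace StringBeam

variable (p : StringBeam)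

/-- The stiffness `a = α₂ + β₂δ₂` of the beam in the adiabatic limit of high frequencies. -/
def stiffness : ℝ := p.α₂ + p.β₂ * p.δ₂

/-- The correction `c` in the dispersion relation `λ = √a (k² + c) + O(k⁻¹)`. -/
def shift : ℝ := p.β₂ * p.δ₂ * p.γ₂ * p.κ₂ / (2 * p.stiffness ^ 2 * p.τ₂)

/-- The frequency `λ = √a (k² + c)`. -/
def freq (k : ℝ) : ℝ := √p.stiffness * (k ^ 2 + p.shift)

/-- The ratio of the wave number of the temperature waves to the frequency. -/
def heatSpeed : ℝ := √(p.τ₂ * p.stiffness / (p.α₂ * p.γ₂ * p.κ₂))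

/-- The limiting spatial decay rate of the temperature waves. -/
def heatDecay : ℝ := p.stiffness / (2 * p.heatSpeed * p.α₂ * p.γ₂ * p.κ₂)

/-- The oscillating root `ik` of the characteristic equation, up to lower order terms. -/
def root₁ (k : ℝ) : ℂ := Complex.I * k

/-- The real root `k + c/k` of the characteristic equation, up to lower order terms. -/
def root₂ (k : ℝ) : ℂ := ((k + p.shift / k : ℝ) : ℂ)

/-- The root belonging to the temperature waves, up to lower order terms. -/
def root₃ (k : ℝ) : ℂ := p.heatDecay + Complex.I * (p.heatSpeed * p.freq k : ℝ)

/-- The three roots that enter the approximate eigenvector. -/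
def roots (k : ℝ) : Fin 3 → ℂ := ![root₁ k, p.root₂ k, p.root₃ k]

/-- The value of `u₂'(0)` for the multiple of the temperature wave that cancels the temperature of
the mode `ζ` at the junction. -/
def compensation (k : ℝ) (ζ : ℂ) : ℂ :=
  modeSlope p.ℓ₂ (p.root₃ k) * p.heatRatio (p.freq k) ζ / p.heatRatio (p.freq k) (p.root₃ k)

/-- The amplitude of the oscillating mode. -/
def amp₁ (k : ℝ) : ℂ := modeSlope p.ℓ₂ (p.root₂ k) - p.compensation k (p.root₂ k)

/-- The amplitude of the exponential mode. -/
def amp₂ (k : ℝ) : ℂ := -(modeSlope p.ℓ₂ (root₁ k) - p.compensation k (root₁ k))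

/-- The amplitude of the temperature wave. -/
def amp₃ (k : ℝ) : ℂ := -((p.heatRatio (p.freq k) (root₁ k) * p.amp₁ k
  + p.heatRatio (p.freq k) (p.root₂ k) * p.amp₂ k) / p.heatRatio (p.freq k) (p.root₃ k))

/-- Amplitudes for which slope and temperature vanish at the junction. -/
def amps (k : ℝ) : Fin 3 → ℂ := ![p.amp₁ k, p.amp₂ k, p.amp₃ k]

lemma stiffness_pos : 0 < p.stiffness := by
  have := p.α₂_pos; have := p.β₂_pos; have := p.δ₂_pos
  unfold stiffness; positivity

lemma shift_pos : 0 < p.shift := by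
  have := p.stiffness_pos; have := p.β₂_pos; have := p.δ₂_pos; have := p.γ₂_pos
  have := p.κ₂_pos; have := p.τ₂_pos
  unfold shift; positivity

lemma heatSpeed_pos : 0 < p.heatSpeed := by
  have := p.stiffness_pos; have := p.α₂_pos; have := p.γ₂_pos
  have := p.κ₂_pos; have := p.τ₂_pos
  unfold heatSpeed; positivity

lemma heatDecay_pos : 0 < p.heatDecay := by
  have := p.stiffness_pos; have := p.α₂_pos; have := p.γ₂_pos
  have := p.κ₂_pos; have := p.heatSpeed_pos
  unfold heatDecay; positivity

lemma freq_pos (k : ℝ) : 0 < p.freq k := by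
  have := p.stiffness_pos; have := p.shift_pos
  unfold freq; positivity

lemma freq_sq (k : ℝ) : p.freq k ^ 2 = p.stiffness * (k ^ 2 + p.shift) ^ 2 := by
  rw [freq, mul_pow, Real.sq_sqrt p.stiffness_pos.le]

lemma root₃_re (k : ℝ) : (p.root₃ k).re = p.heatDecay := by
  simp [root₃]

/-- With this choice of the parameters, the third root satisfies
`ζ² = (a/α₂) N + η²` exactly, `N` being the symbol of the Cattaneo law. -/
lemma heatSymbol_eq (k : ℝ) : p.heatSymbol (p.freq k)
    = p.α₂ / p.stiffness * (p.root₃ k ^ 2 - p.heatDecay ^ 2) := by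
  have ha := p.stiffness_pos; have h1 := p.α₂_pos; have h2 := p.γ₂_pos
  have h3 := p.κ₂_pos; have h4 := p.τ₂_pos; have h5 := p.heatSpeed_pos
  have e1 : p.heatSpeed ^ 2 = p.τ₂ * p.stiffness / (p.α₂ * p.γ₂ * p.κ₂) := by
    rw [heatSpeed, Real.sq_sqrt (by positivity)]
  have e2 : p.heatSpeed * p.heatDecay = p.stiffness / (2 * p.α₂ * p.γ₂ * p.κ₂) := by
    rw [heatDecay]; field_simp
  have ha' : (p.stiffness : ℂ) ≠ 0 := by exact_mod_cast ha.ne'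
  have h1' : (p.α₂ : ℂ) ≠ 0 := by exact_mod_cast h1.ne'
  have h2' : (p.γ₂ : ℂ) ≠ 0 := by exact_mod_cast h2.ne'
  have h3' : (p.κ₂ : ℂ) ≠ 0 := by exact_mod_cast h3.ne'
  have c1 : (p.heatSpeed : ℂ) ^ 2 = p.τ₂ * p.stiffness / (p.α₂ * p.γ₂ * p.κ₂) := by
    exact_mod_cast congrArg (fun x : ℝ => (x : ℂ)) e1
  have c2 : (p.heatSpeed : ℂ) * p.heatDecay = p.stiffness / (2 * p.α₂ * p.γ₂ * p.κ₂) := by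
    exact_mod_cast congrArg (fun x : ℝ => (x : ℂ)) e2
  have e : p.root₃ k ^ 2 - (p.heatDecay : ℂ) ^ 2
      = 2 * Complex.I * p.freq k * (p.heatSpeed * p.heatDecay)
        - p.freq k ^ 2 * (p.heatSpeed : ℂ) ^ 2 := by
    rw [root₃]
    push_cast
    linear_combination (p.heatSpeed : ℂ) ^ 2 * p.freq k ^ 2 * Complex.I_sq
  rw [e, c1, c2, heatSymbol]
  field_simp
  linear_combination (p.freq k : ℂ) ^ 2 * p.τ₂ * Complex.I_sq

/-- The defining property of `shift`: it makes the leading terms of the characteristic polynomial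
cancel at the first two roots. -/
lemma shift_eq : 2 * (p.stiffness : ℂ) ^ 2 * p.shift * ((p.τ₂ / (p.γ₂ * p.κ₂) : ℝ) : ℂ)
    = p.stiffness - p.α₂ := by
  have := p.stiffness_pos; have := p.γ₂_pos; have := p.κ₂_pos; have := p.τ₂_pos
  have h : 2 * p.stiffness ^ 2 * p.shift * (p.τ₂ / (p.γ₂ * p.κ₂)) = p.stiffness - p.α₂ := by
    rw [show p.stiffness - p.α₂ = p.β₂ * p.δ₂ by rw [stiffness]; ring, shift]
    field_simp
  exact_mod_cast congrArg (fun x : ℝ => (x : ℂ)) h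

section Asymptotics

variable {p} {L : Filter ℝ}

lemma hasOrder_id : HasOrder L (fun k => (k : ℂ)) 1 := by simpa using hasOrder_pow (L := L) 1

lemma hasLowerOrder_pow (hL : L ≤ atTop) (n : ℕ) : HasLowerOrder L (fun k => (k : ℂ) ^ n) n :=
  HasLowerOrder.of_le one_pos hL (Eventually.of_forall fun k => by
    rw [norm_pow, Complex.norm_real, zpow_natCast, one_mul, Real.norm_eq_abs, ← abs_pow]
    exact le_abs_self _)

lemma hasOrder_freq (hL : L ≤ atTop) : HasOrder L (fun k => (p.freq k : ℂ)) 2 := by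
  have h := (hasOrder_monomial (n := 2) hL (√p.stiffness : ℂ) (i := 2) le_rfl).add
    (hasOrder_monomial (n := 2) hL (√p.stiffness * p.shift : ℂ) (i := 0) (by norm_num))
  refine h.congr (Eventually.of_forall fun k => ?_)
  rw [freq]; push_cast; ring

lemma hasLowerOrder_freq (hL : L ≤ atTop) : HasLowerOrder L (fun k => (p.freq k : ℂ)) 2 := by
  have ha := p.stiffness_pos; have hs := p.shift_pos
  refine HasLowerOrder.of_le (C := √p.stiffness) (by positivity) hL
    (Eventually.of_forall fun k => ?_)
  rw [Complex.norm_real, Real.norm_of_nonneg (p.freq_pos k).le, freq]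
  gcongr
  rw [zpow_ofNat]
  linarith

lemma hasOrder_freq_sq (hL : L ≤ atTop) : HasOrder L (fun k => (p.freq k : ℂ) ^ 2) 4 :=
  ((hasOrder_freq hL).mul hL (hasOrder_freq hL)).congr (Eventually.of_forall fun k => by ring)

lemma freq_sq_complex (k : ℝ) :
    (p.freq k : ℂ) ^ 2 = p.stiffness * ((k : ℂ) ^ 2 + p.shift) ^ 2 := by
  exact_mod_cast congrArg (fun x : ℝ => (x : ℂ)) (p.freq_sq k)

lemma root₁_sq (k : ℝ) : root₁ k ^ 2 = -(k : ℂ) ^ 2 := by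
  rw [root₁, mul_pow, Complex.I_sq]; ring

lemma stiffness_ne_zero : (p.stiffness : ℂ) ≠ 0 := by exact_mod_cast p.stiffness_pos.ne'

/-- The first two roots are related through the dispersion relation `λ² = -a ζ₁²ζ₂²`. -/
lemma root₂_sq {k : ℝ} (hk : k ≠ 0) :
    p.root₂ k ^ 2 = (p.freq k : ℂ) ^ 2 / (p.stiffness * (k : ℂ) ^ 2) := by
  have hk' : (k : ℂ) ≠ 0 := by exact_mod_cast hk
  have := stiffness_ne_zero (p := p)
  rw [freq_sq_complex, root₂]
  push_cast
  field_simp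

lemma hasOrder_root₁_sq : HasOrder L (fun k => root₁ k ^ 2) 2 :=
  (hasOrder_pow (L := L) 2).neg.congr (Eventually.of_forall fun k => (root₁_sq k).symm)

lemma hasLowerOrder_root₁_sq (hL : L ≤ atTop) : HasLowerOrder L (fun k => root₁ k ^ 2) 2 := by
  have h : HasLowerOrder L (fun k => -1 * (k : ℂ) ^ 2) 2 :=
    (hasLowerOrder_pow hL 2).const_mul (by norm_num)
  simpa only [neg_one_mul, ← root₁_sq] using h

lemma hasOrder_root₂_sub (hL : L ≤ atTop) : HasOrder L (fun k => p.root₂ k - k) 0 := by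
  refine HasOrder.of_norm_le (C := p.shift) ?_
  filter_upwards [eventually_one_le hL] with k hk
  have hs := p.shift_pos
  have e : p.root₂ k - k = ((p.shift / k : ℝ) : ℂ) := by rw [root₂]; push_cast; ring
  rw [e, Complex.norm_real, Real.norm_of_nonneg (by positivity)]
  exact div_le_self hs.le hk

lemma hasOrder_root₂_sq (hL : L ≤ atTop) : HasOrder L (fun k => p.root₂ k ^ 2) 2 := by
  have h : HasOrder L (fun k => p.root₂ k) 1 :=
    (((hasOrder_root₂_sub hL).mono hL (by norm_num)).add hasOrder_id).congr
      (Eventually.of_forall fun k => by ring)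
  exact (h.mul hL h).congr (Eventually.of_forall fun k => by ring)

lemma hasLowerOrder_root₂_sq (hL : L ≤ atTop) : HasLowerOrder L (fun k => p.root₂ k ^ 2) 2 := by
  refine HasLowerOrder.of_le one_pos hL ?_
  filter_upwards [eventually_one_le hL] with k hk
  have hs := p.shift_pos
  rw [root₂, norm_pow, Complex.norm_real, Real.norm_of_nonneg (by positivity), zpow_ofNat, one_mul]
  gcongr
  exact le_add_of_nonneg_right (by positivity)

lemma hasOrder_root₃ (hL : L ≤ atTop) : HasOrder L (fun k => p.root₃ k) 2 := by
  refine (((hasOrder_const (p.heatDecay : ℂ)).mono hL (by norm_num)).add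
    ((hasOrder_freq (p := p) hL).const_mul (Complex.I * p.heatSpeed))).congr
    (Eventually.of_forall fun k => ?_)
  rw [root₃]; push_cast; ring

lemma hasLowerOrder_root₃ (hL : L ≤ atTop) : HasLowerOrder L (fun k => p.root₃ k) 2 := by
  have hb : (Complex.I * p.heatSpeed : ℂ) ≠ 0 :=
    mul_ne_zero Complex.I_ne_zero (by exact_mod_cast p.heatSpeed_pos.ne')
  have h := ((hasLowerOrder_freq (p := p) hL).const_mul hb).add hL
    (hasOrder_const (p.heatDecay : ℂ)) (by norm_num)
  refine h.trans (Asymptotics.IsBigO.of_bound 1 (Eventually.of_forall fun k => ?_))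
  rw [one_mul, root₃]
  refine le_of_eq ?_
  congr 1
  push_cast; ring

lemma root₃_ne_zero (k : ℝ) : p.root₃ k ≠ 0 := by
  intro h
  have := congrArg Complex.re h
  rw [root₃_re, Complex.zero_re] at this
  exact p.heatDecay_pos.ne' this

lemma hasOrder_root₃_sq (hL : L ≤ atTop) : HasOrder L (fun k => p.root₃ k ^ 2) 4 :=
  ((hasOrder_root₃ hL).mul hL (hasOrder_root₃ hL)).congr (Eventually.of_forall fun k => by ring)

lemma hasLowerOrder_root₃_sq (hL : L ≤ atTop) : HasLowerOrder L (fun k => p.root₃ k ^ 2) 4 := by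
  have h : HasLowerOrder L (fun k => p.root₃ k * p.root₃ k) 4 :=
    (hasLowerOrder_root₃ hL).mul hL (hasLowerOrder_root₃ hL)
  simpa only [← sq] using h

lemma hasOrder_heatRatio (hL : L ≤ atTop) {ζ : ℝ → ℂ} (h : HasOrder L (fun k => ζ k ^ 2) 2)
    (h' : HasLowerOrder L (fun k => ζ k ^ 2) 2) :
    HasOrder L (fun k => p.heatRatio (p.freq k) (ζ k)) 2 := by
  have hb : (p.β₂ : ℂ) ≠ 0 := by exact_mod_cast p.β₂_pos.ne'
  have h1 : HasOrder L (fun k => p.α₂ * (ζ k ^ 2) ^ 2 - (p.freq k : ℂ) ^ 2) 4 :=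
    (((h.mul hL h).congr (Eventually.of_forall fun k => by ring)).const_mul (p.α₂ : ℂ)).sub
      (hasOrder_freq_sq hL)
  exact h1.div hL (h'.const_mul hb)

lemma hasLowerOrder_heatRatio_root₃ (hL : L ≤ atTop) :
    HasLowerOrder L (fun k => p.heatRatio (p.freq k) (p.root₃ k)) 4 := by
  have hb : (p.β₂ : ℂ) ≠ 0 := by exact_mod_cast p.β₂_pos.ne'
  have ha : (p.α₂ : ℂ) ≠ 0 := by exact_mod_cast p.α₂_pos.ne'
  have h3 := hasLowerOrder_root₃_sq (p := p) hL
  have h1 := ((h3.mul hL h3).const_mul ha).add hL (hasOrder_freq_sq (p := p) hL).neg (by norm_num)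
  have h2 := (hasOrder_root₃_sq (p := p) hL).const_mul (p.β₂ : ℂ)
  refine (h1.div hL h2 (Eventually.of_forall fun k => mul_ne_zero hb
    (pow_ne_zero 2 (root₃_ne_zero k)))).trans (Asymptotics.IsBigO.of_bound 1
    (Eventually.of_forall fun k => ?_))
  rw [one_mul, heatRatio]
  refine le_of_eq ?_
  congr 2
  ring

lemma eventually_heatRatio_root₃_ne_zero (hL : L ≤ atTop) :
    ∀ᶠ k in L, p.heatRatio (p.freq k) (p.root₃ k) ≠ 0 := by
  obtain ⟨C, hC, h⟩ := (hasLowerOrder_heatRatio_root₃ (p := p) hL).exists_bound hL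
  filter_upwards [h, eventually_one_le hL] with k hk h1
  rw [← norm_pos_iff]
  exact lt_of_lt_of_le (by positivity) hk

lemma hasOrder_modeSlope_root₁ (hS : ∀ᶠ k in L, 1 / 2 ≤ Real.sin (k * p.ℓ₂)) :
    HasOrder L (fun k => modeSlope p.ℓ₂ (root₁ k)) 1 := by
  refine hasOrder_id.of_norm_le_norm (C := 2) ?_
  filter_upwards [hS] with k hk
  rw [root₁, modeSlope_I_mul, Complex.norm_real, Complex.norm_real, norm_div, norm_mul,
    Real.norm_eq_abs (Real.cos _), Real.norm_of_nonneg (by linarith : 0 ≤ Real.sin (k * p.ℓ₂)),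
    div_le_iff₀ (by linarith)]
  nlinarith [Real.abs_cos_le_one (k * p.ℓ₂), norm_nonneg k, abs_nonneg (Real.cos (k * p.ℓ₂))]

lemma hasOrder_modeSlope_root₂_sub (hL : L ≤ atTop) :
    HasOrder L (fun k => modeSlope p.ℓ₂ (p.root₂ k) - k) 0 := by
  have h : HasOrder L (fun k => modeSlope p.ℓ₂ (p.root₂ k) - p.root₂ k) 0 := by
    refine HasOrder.of_norm_le (C := 1 / p.ℓ₂) ?_
    filter_upwards [eventually_one_le hL] with k hk
    have hs := p.shift_pos
    exact norm_modeSlope_ofReal_sub_le p.ℓ₂_pos (by positivity)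
  exact (h.add (hasOrder_root₂_sub hL)).congr (Eventually.of_forall fun k => by ring)

lemma hasOrder_modeSlope_root₂ (hL : L ≤ atTop) :
    HasOrder L (fun k => modeSlope p.ℓ₂ (p.root₂ k)) 1 :=
  (((hasOrder_modeSlope_root₂_sub hL).mono hL (by norm_num)).add hasOrder_id).congr
    (Eventually.of_forall fun k => by ring)

lemma hasOrder_modeSlope_root₃ (hL : L ≤ atTop) :
    HasOrder L (fun k => modeSlope p.ℓ₂ (p.root₃ k)) 2 := by
  refine (hasOrder_root₃ (p := p) hL).of_norm_le_norm
    (C := Real.cosh (p.heatDecay * p.ℓ₂) / Real.sinh (p.heatDecay * p.ℓ₂))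
    (Eventually.of_forall fun k => ?_)
  have := norm_modeSlope_le_of_re_pos (ζ := p.root₃ k) p.ℓ₂_pos
    (by rw [root₃_re]; exact p.heatDecay_pos)
  rwa [root₃_re] at this

lemma hasOrder_compensation (hL : L ≤ atTop) {ζ : ℝ → ℂ} (h : HasOrder L (fun k => ζ k ^ 2) 2)
    (h' : HasLowerOrder L (fun k => ζ k ^ 2) 2) :
    HasOrder L (fun k => p.compensation k (ζ k)) 0 :=
  ((hasOrder_modeSlope_root₃ hL).mul hL (hasOrder_heatRatio hL h h')).div hL
    (hasLowerOrder_heatRatio_root₃ hL)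

lemma hasOrder_compensation₁ (hL : L ≤ atTop) :
    HasOrder L (fun k => p.compensation k (root₁ k)) 0 :=
  hasOrder_compensation hL hasOrder_root₁_sq (hasLowerOrder_root₁_sq hL)

lemma hasOrder_compensation₂ (hL : L ≤ atTop) :
    HasOrder L (fun k => p.compensation k (p.root₂ k)) 0 :=
  hasOrder_compensation hL (hasOrder_root₂_sq hL) (hasLowerOrder_root₂_sq hL)

lemma hasOrder_amp₁ (hL : L ≤ atTop) : HasOrder L p.amp₁ 1 :=
  (hasOrder_modeSlope_root₂ hL).sub ((hasOrder_compensation₂ hL).mono hL (by norm_num))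

lemma hasOrder_amp₂ (hL : L ≤ atTop) (hS : ∀ᶠ k in L, 1 / 2 ≤ Real.sin (k * p.ℓ₂)) :
    HasOrder L p.amp₂ 1 :=
  ((hasOrder_modeSlope_root₁ hS).sub ((hasOrder_compensation₁ hL).mono hL (by norm_num))).neg

lemma hasOrder_amp₃ (hL : L ≤ atTop) (hS : ∀ᶠ k in L, 1 / 2 ≤ Real.sin (k * p.ℓ₂)) :
    HasOrder L p.amp₃ (-1) :=
  ((((hasOrder_heatRatio hL hasOrder_root₁_sq (hasLowerOrder_root₁_sq hL)).mul hL
    (hasOrder_amp₁ hL)).add ((hasOrder_heatRatio hL (hasOrder_root₂_sq hL)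
    (hasLowerOrder_root₂_sq hL)).mul hL (hasOrder_amp₂ hL hS))).div hL
    (hasLowerOrder_heatRatio_root₃ hL)).neg

lemma sum_heatRatio_amps {k : ℝ} (h : p.heatRatio (p.freq k) (p.root₃ k) ≠ 0) :
    ∑ j, p.heatRatio (p.freq k) (p.roots k j) * p.amps k j = 0 := by
  simp only [Fin.sum_univ_three, roots, amps, Matrix.cons_val, amp₃]
  field_simp
  ring

lemma sum_modeSlope_amps {k : ℝ} (h : p.heatRatio (p.freq k) (p.root₃ k) ≠ 0) :
    ∑ j, modeSlope p.ℓ₂ (p.roots k j) * p.amps k j = 0 := by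
  simp only [Fin.sum_univ_three, roots, amps, Matrix.cons_val, amp₃, amp₁, amp₂, compensation]
  field_simp
  ring

/-- The displacement of the junction is `k - k cot(kℓ₂) + O(1)`. -/
lemma hasOrder_sum_amps_sub (hL : L ≤ atTop) (hS : ∀ᶠ k in L, 1 / 2 ≤ Real.sin (k * p.ℓ₂)) :
    HasOrder L (fun k => ∑ j, p.amps k j - (k - modeSlope p.ℓ₂ (root₁ k))) 0 := by
  refine ((((hasOrder_modeSlope_root₂_sub (p := p) hL).sub (hasOrder_compensation₂ (p := p) hL)).add
    (hasOrder_compensation₁ (p := p) hL)).add ((hasOrder_amp₃ hL hS).mono hL (by norm_num))).congr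
    (Eventually.of_forall fun k => ?_)
  simp only [Fin.sum_univ_three, amps, Matrix.cons_val, amp₁, amp₂]
  ring

/-- The slope of the string at the junction is a multiple of `k⁴ cot(kℓ₂)`, up to `O(k³)`. The
leading part comes in equal shares from the oscillating and the exponential mode. -/
lemma hasOrder_junctionSlope_sub (hL : L ≤ atTop)
    (hS : ∀ᶠ k in L, 1 / 2 ≤ Real.sin (k * p.ℓ₂)) :
    HasOrder L (fun k => p.junctionSlope (p.freq k) (p.roots k) (p.amps k)
      - ((2 * p.stiffness * p.δ₂ / (p.β₂ * p.α₁) : ℝ) : ℂ) * (k : ℂ) ^ 3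
        * modeSlope p.ℓ₂ (root₁ k)) 3 := by
  have hR := hasOrder_modeSlope_root₁ (p := p) hS
  have hQ := hasOrder_modeSlope_root₂ (p := p) hL
  have hQ' := hasOrder_modeSlope_root₂_sub (p := p) hL
  have he₁ := hasOrder_compensation₁ (p := p) hL
  have he₂ := hasOrder_compensation₂ (p := p) hL
  -- contributions of the three modes to the shear force, without the common leading part
  have t1 : HasOrder L (fun k => (p.freq k : ℂ) ^ 2 / root₁ k ^ 2
      * (modeSlope p.ℓ₂ (root₁ k) * p.amp₁ k)
      + p.stiffness * (k : ℂ) ^ 3 * modeSlope p.ℓ₂ (root₁ k)) 3 := by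
    have x1 : HasOrder L
        (fun k => -(p.stiffness * (2 * p.shift * (k : ℂ) ^ 2 + p.shift ^ 2))) 2 := by
      refine ((hasOrder_monomial (n := 2) hL (p.stiffness * 2 * p.shift : ℂ) (i := 2) le_rfl).add
        (hasOrder_monomial (n := 2) hL (p.stiffness * p.shift ^ 2 : ℂ) (i := 0)
          (by norm_num))).neg.congr (Eventually.of_forall fun k => by ring)
    have x2 := (x1.div hL (hasLowerOrder_pow hL 2)).mul hL (hR.mul hL (hasOrder_amp₁ (p := p) hL))
    have x3 := (((hasOrder_pow (L := L) 2).const_mul (p.stiffness : ℂ)).mul hL hR).mul hL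
      (he₂.sub hQ')
    refine ((x2.mono hL (by norm_num)).add (x3.mono hL (by norm_num))).congr ?_
    filter_upwards [eventually_one_le hL] with k hk
    have hk' : (k : ℂ) ≠ 0 := by exact_mod_cast (by positivity : k ≠ 0)
    rw [root₁_sq, freq_sq_complex, amp₁]
    field_simp
    ring
  have t2 : HasOrder L (fun k => (p.freq k : ℂ) ^ 2 / p.root₂ k ^ 2
      * (modeSlope p.ℓ₂ (p.root₂ k) * p.amp₂ k)
      + p.stiffness * (k : ℂ) ^ 3 * modeSlope p.ℓ₂ (root₁ k)) 3 := by
    have x1 := ((hasOrder_pow (L := L) 2).const_mul (p.stiffness : ℂ)).mul hL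
      ((hQ.mul hL he₁).sub ((hQ'.mul hL hR).mono hL (by norm_num)))
    refine (x1.mono hL (by norm_num)).congr ?_
    filter_upwards [eventually_one_le hL] with k hk
    have hk' : (k : ℂ) ≠ 0 := by exact_mod_cast (by positivity : k ≠ 0)
    have hf : (p.freq k : ℂ) ≠ 0 := by exact_mod_cast (p.freq_pos k).ne'
    have hs := stiffness_ne_zero (p := p)
    rw [root₂_sq (by positivity), amp₂]
    field_simp
    ring
  have t3 : HasOrder L (fun k => (p.freq k : ℂ) ^ 2 / p.root₃ k ^ 2
      * (modeSlope p.ℓ₂ (p.root₃ k) * p.amp₃ k)) 3 :=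
    (((hasOrder_freq_sq hL).div hL (hasLowerOrder_root₃_sq hL)).mul hL
      ((hasOrder_modeSlope_root₃ hL).mul hL (hasOrder_amp₃ hL hS))).mono hL (by norm_num)
  refine (((t1.add t2).add t3).const_mul (-((p.δ₂ / (p.β₂ * p.α₁) : ℝ) : ℂ))).congr
    (Eventually.of_forall fun k => ?_)
  simp only [junctionSlope, Fin.sum_univ_three, roots, amps, Matrix.cons_val]
  push_cast
  ring

lemma heatSymbol_eq_sub (l : ℝ) : p.heatSymbol l = -((p.τ₂ / (p.γ₂ * p.κ₂) : ℝ) : ℂ) * (l : ℂ) ^ 2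
    + Complex.I * l / (p.γ₂ * p.κ₂) := by
  rw [heatSymbol]
  push_cast
  linear_combination (l : ℂ) ^ 2 * p.τ₂ / (p.γ₂ * p.κ₂) * Complex.I_sq

lemma hasLowerOrder_heatSymbol (hL : L ≤ atTop) :
    HasLowerOrder L (fun k => p.heatSymbol (p.freq k)) 4 := by
  have hc : (p.α₂ / p.stiffness : ℂ) ≠ 0 :=
    div_ne_zero (by exact_mod_cast p.α₂_pos.ne') stiffness_ne_zero
  have h : HasLowerOrder L (fun k => p.α₂ / p.stiffness
      * (p.root₃ k ^ 2 + -(p.heatDecay : ℂ) ^ 2)) 4 :=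
    ((hasLowerOrder_root₃_sq hL).add hL (hasOrder_const (-(p.heatDecay : ℂ) ^ 2))
      (by norm_num)).const_mul hc
  simpa only [← sub_eq_add_neg, ← heatSymbol_eq] using h

lemma hasOrder_heatSymbol (hL : L ≤ atTop) :
    HasOrder L (fun k => p.heatSymbol (p.freq k)) 4 := by
  have h : HasOrder L (fun k => p.α₂ / p.stiffness * (p.root₃ k ^ 2 - (p.heatDecay : ℂ) ^ 2)) 4 :=
    ((hasOrder_root₃_sq hL).sub ((hasOrder_const _).mono hL (by norm_num))).const_mul _
  simpa only [← heatSymbol_eq] using h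

lemma heatSymbol_ne_zero {l : ℝ} (hl : l ≠ 0) : p.heatSymbol l ≠ 0 := by
  have hg' : (p.γ₂ : ℂ) ≠ 0 := by exact_mod_cast p.γ₂_pos.ne'
  have hk' : (p.κ₂ : ℂ) ≠ 0 := by exact_mod_cast p.κ₂_pos.ne'
  have hl' : (l : ℂ) ≠ 0 := by exact_mod_cast hl
  have hc : (1 + Complex.I * l * p.τ₂ : ℂ) ≠ 0 := by
    intro h
    have := congrArg Complex.re h
    simp at this
  exact div_ne_zero (mul_ne_zero (mul_ne_zero Complex.I_ne_zero hl') hc) (mul_ne_zero hg' hk')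

variable (p) in
/-- The characteristic polynomial of the thermoelastic beam at frequency `l`, evaluated at a
root candidate `ζ`. -/
def charPoly (l : ℝ) (ζ : ℂ) : ℂ :=
  (p.stiffness * (ζ ^ 2) ^ 2 - (l : ℂ) ^ 2) * p.heatSymbol l
    - ζ ^ 2 * (p.α₂ * (ζ ^ 2) ^ 2 - (l : ℂ) ^ 2)

lemma heatResidual_eq {l : ℝ} (hl : l ≠ 0) {ζ : ℂ} (hζ : ζ ≠ 0) :
    p.heatResidual l ζ
      = Complex.I * l * p.charPoly l ζ / (p.β₂ * (ζ ^ 2 * p.heatSymbol l)) := by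
  have hb : (p.β₂ : ℂ) ≠ 0 := by exact_mod_cast p.β₂_pos.ne'
  have hN := heatSymbol_ne_zero (p := p) hl
  rw [heatResidual, charPoly, heatRatio, stiffness]
  push_cast
  field_simp
  ring

/-- The correction `c` in the frequency cancels the leading term of the characteristic polynomial
at `ik`. -/
lemma hasOrder_charPoly_root₁ (hL : L ≤ atTop) :
    HasOrder L (fun k => p.charPoly (p.freq k) (root₁ k)) 4 := by
  set g : ℂ := ((p.τ₂ / (p.γ₂ * p.κ₂) : ℝ) : ℂ) with hg
  set a : ℂ := (p.stiffness : ℂ) with ha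
  set c : ℂ := (p.shift : ℂ) with hc
  have hs : 2 * a ^ 2 * c * g = a - p.α₂ := p.shift_eq
  have h1 := ((hasOrder_monomial (n := 4) hL (5 * a ^ 2 * g * c ^ 2 - 2 * a * c) (i := 4)
    (by norm_num)).add (hasOrder_monomial (n := 4) hL (4 * a ^ 2 * g * c ^ 3 - a * c ^ 2) (i := 2)
    (by norm_num))).add (hasOrder_monomial (n := 4) hL (a ^ 2 * g * c ^ 4) (i := 0) (by norm_num))
  have h2 : HasOrder L (fun k => a * (2 * c * (k : ℂ) ^ 2 + c ^ 2 * (k : ℂ) ^ 0)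
      * (Complex.I / (p.γ₂ * p.κ₂) * p.freq k)) 4 :=
    (((hasOrder_monomial (n := 2) hL (2 * c) (i := 2) le_rfl).add
    (hasOrder_monomial (n := 2) hL (c ^ 2) (i := 0) (by norm_num))).const_mul a).mul hL
    ((hasOrder_freq (p := p) hL).const_mul (Complex.I / (p.γ₂ * p.κ₂)))
  refine (h1.sub h2).congr (Eventually.of_forall fun k => ?_)
  rw [charPoly, root₁_sq, heatSymbol_eq_sub, ← hg, freq_sq_complex, ← ha, ← hc]
  linear_combination (-(k : ℂ) ^ 6) * hs

lemma hasOrder_charPoly_root₂ (hL : L ≤ atTop) :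
    HasOrder L (fun k => p.charPoly (p.freq k) (p.root₂ k)) 4 := by
  set g : ℂ := ((p.τ₂ / (p.γ₂ * p.κ₂) : ℝ) : ℂ) with hg
  set a : ℂ := (p.stiffness : ℂ) with ha
  set c : ℂ := (p.shift : ℂ) with hc
  have ha0 : a ≠ 0 := stiffness_ne_zero
  have hs : 2 * a ^ 2 * c * g = a - p.α₂ := p.shift_eq
  set W : ℝ → ℂ := fun k => 2 * c * (k : ℂ) ^ 2 + c ^ 2 * (k : ℂ) ^ 0 with hW
  have oW : HasOrder L W 2 := (hasOrder_monomial (n := 2) hL (2 * c) (i := 2) le_rfl).add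
    (hasOrder_monomial (n := 2) hL (c ^ 2) (i := 0) (by norm_num))
  have o2 := hasOrder_pow (L := L) 2
  have o4 := hasOrder_pow (L := L) 4
  have oZ : HasOrder L (fun k => (k : ℂ) ^ 4 + W k) 4 := o4.add (oW.mono hL (by norm_num))
  -- the characteristic polynomial is `λ²/k⁶` times `B`, whose terms of order `k⁸` cancel
  have B : HasOrder L (fun k => (2 * c * (k : ℂ) ^ 4 + c ^ 2 * (k : ℂ) ^ 2)
      * (Complex.I / (p.γ₂ * p.κ₂) * p.freq k)
      - g * a * (2 * c * ((k : ℂ) ^ 4 * W k) + c ^ 2 * ((k : ℂ) ^ 2 * ((k : ℂ) ^ 4 + W k)))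
      - p.α₂ / a * (2 * ((k : ℂ) ^ 4 * W k) + W k * W k) + (k : ℂ) ^ 4 * W k) 6 := by
    have b1 : HasOrder L (fun k => (k : ℂ) ^ 4 * W k) 6 := o4.mul hL oW
    have b2 : HasOrder L (fun k => (k : ℂ) ^ 2 * ((k : ℂ) ^ 4 + W k)) 6 := o2.mul hL oZ
    have b3 : HasOrder L (fun k => W k * W k) 6 := (oW.mul hL oW).mono hL (by norm_num)
    have b4 : HasOrder L (fun k => (2 * c * (k : ℂ) ^ 4 + c ^ 2 * (k : ℂ) ^ 2)
      * (Complex.I / (p.γ₂ * p.κ₂) * p.freq k)) 6 :=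
      ((hasOrder_monomial (n := 4) hL (2 * c) (i := 4) le_rfl).add
        (hasOrder_monomial (n := 4) hL (c ^ 2) (i := 2) (by norm_num))).mul hL
        ((hasOrder_freq (p := p) hL).const_mul (Complex.I / (p.γ₂ * p.κ₂)))
    exact ((b4.sub (((b1.const_mul (2 * c)).add (b2.const_mul (c ^ 2))).const_mul (g * a))).sub
      (((b1.const_mul 2).add b3).const_mul (p.α₂ / a))).add b1
  have tot := ((hasOrder_freq_sq (p := p) hL).div hL (hasLowerOrder_pow hL 6)).mul hL B
  refine (tot.mono hL (by norm_num)).congr ?_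
  filter_upwards [eventually_one_le hL] with k hk
  have hk' : (k : ℂ) ≠ 0 := by exact_mod_cast (by positivity : k ≠ 0)
  rw [charPoly, root₂_sq (by positivity), heatSymbol_eq_sub, ← hg, freq_sq_complex, ← ha, ← hc, hW]
  field_simp
  linear_combination ((k ^ 2 + c) ^ 2 * (k : ℂ) ^ 8) * hs

/-- At the third root the terms of highest order cancel by the choice of `heatSpeed` and
`heatDecay`. -/
lemma hasOrder_charPoly_root₃ (hL : L ≤ atTop) :
    HasOrder L (fun k => p.charPoly (p.freq k) (p.root₃ k)) 8 := by
  have o3 := hasOrder_root₃_sq (p := p) hL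
  have h : HasOrder L (fun k => -(p.α₂ * p.heatDecay ^ 2 * (p.root₃ k ^ 2 * p.root₃ k ^ 2))
      - (p.freq k : ℂ) ^ 2 * (p.heatSymbol (p.freq k) - p.root₃ k ^ 2)) 8 :=
    ((o3.mul hL o3).const_mul _).neg.sub
      ((hasOrder_freq_sq hL).mul hL ((hasOrder_heatSymbol hL).sub o3))
  refine h.congr (Eventually.of_forall fun k => ?_)
  have ha0 := stiffness_ne_zero (p := p)
  rw [charPoly, heatSymbol_eq]
  field_simp
  ring

lemma root₁_ne_zero {k : ℝ} (hk : k ≠ 0) : root₁ k ≠ 0 :=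
  mul_ne_zero Complex.I_ne_zero (by exact_mod_cast hk)

lemma root₂_ne_zero {k : ℝ} (hk : 0 < k) : p.root₂ k ≠ 0 := by
  have := p.shift_pos
  rw [root₂, Complex.ofReal_ne_zero]
  positivity

lemma hasOrder_heatResidual (hL : L ≤ atTop) {ζ : ℝ → ℂ} {m n : ℤ}
    (h0 : ∀ᶠ k in L, ζ k ≠ 0) (hn : HasLowerOrder L (fun k => ζ k ^ 2) n)
    (hm : HasOrder L (fun k => p.charPoly (p.freq k) (ζ k)) m) :
    HasOrder L (fun k => p.heatResidual (p.freq k) (ζ k)) (2 + m - (n + 4)) := by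
  have hb : (p.β₂ : ℂ) ≠ 0 := by exact_mod_cast p.β₂_pos.ne'
  refine ((((hasOrder_freq (p := p) hL).const_mul Complex.I).mul hL hm).div hL
    ((hn.mul hL (hasLowerOrder_heatSymbol (p := p) hL)).const_mul hb)).congr ?_
  filter_upwards [h0] with k hk
  rw [heatResidual_eq (p.freq_pos k).ne' hk]

lemma hasOrder_sum_heatResidual (hL : L ≤ atTop) (hS : ∀ᶠ k in L, 1 / 2 ≤ Real.sin (k * p.ℓ₂)) :
    HasOrder L (fun k => ((∑ j, ‖p.heatResidual (p.freq k) (p.roots k j) * p.amps k j‖ : ℝ) : ℂ))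
      2 := by
  have hpos : ∀ᶠ k in L, 0 < k := by
    filter_upwards [eventually_one_le hL] with k hk using by linarith
  have norm {f : ℝ → ℂ} {n : ℤ} (h : HasOrder L f n) : HasOrder L (fun k => (‖f k‖ : ℂ)) n :=
    h.of_norm_le_norm (C := 1) (Eventually.of_forall fun k => by simp)
  have r1 := ((hasOrder_heatResidual (p := p) hL (hpos.mono fun k hk => root₁_ne_zero hk.ne')
    (hasLowerOrder_root₁_sq hL) (hasOrder_charPoly_root₁ hL)).mul hL
      (hasOrder_amp₁ (p := p) hL)).mono
    (n := 2) hL (by norm_num)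
  have r2 := ((hasOrder_heatResidual (p := p) hL (hpos.mono fun k hk => root₂_ne_zero hk)
    (hasLowerOrder_root₂_sq hL) (hasOrder_charPoly_root₂ hL)).mul hL
      (hasOrder_amp₂ (p := p) hL hS)).mono
    (n := 2) hL (by norm_num)
  have r3 := ((hasOrder_heatResidual (p := p) hL (Eventually.of_forall root₃_ne_zero)
    (hasLowerOrder_root₃_sq hL) (hasOrder_charPoly_root₃ hL)).mul hL
      (hasOrder_amp₃ (p := p) hL hS)).mono
    (n := 2) hL (by norm_num)
  refine (((norm r1).add (norm r2)).add (norm r3)).congr (Eventually.of_forall fun k => ?_)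
  simp only [Fin.sum_univ_three, roots, amps, Matrix.cons_val]
  push_cast
  rfl

end Asymptotics

end StringBeam

/-! ### Tuning the frequency -/

namespace StringBeam

variable (p : StringBeam)

/-- The wave number of the string at the frequency `freq k`. -/
def waveNumber (k : ℝ) : ℝ := p.freq k / √p.α₁

/-- The leading coefficient of the junction slope. -/
def slopeCoeff : ℝ := 2 * p.stiffness * p.δ₂ / (p.β₂ * p.α₁)

/-- The leading part of the compatibility condition `U ν cos(νℓ₁) + D sin(νℓ₁) = 0` between the
string and the beam, normalised by `k cot(kℓ₂) = k cos(kℓ₂) / sin(kℓ₂)`. -/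
def secular (k : ℝ) : ℝ :=
  p.waveNumber k * Real.cos (p.waveNumber k * p.ℓ₁) * (Real.sin (k * p.ℓ₂) - Real.cos (k * p.ℓ₂))
    + p.slopeCoeff * k ^ 3 * Real.sin (p.waveNumber k * p.ℓ₁) * Real.cos (k * p.ℓ₂)

/-- The wave numbers `k` used for the approximate eigenvectors. The bounds keep `cot(kℓ₂)` away
from `0` and `∞`, so that the beam is not near resonance but still exerts a force on the string. -/
def tuned : Set ℝ :=
  {k | 1 / 2 ≤ Real.sin (k * p.ℓ₂) ∧ 1 / 2 ≤ Real.cos (k * p.ℓ₂) ∧ p.secular k = 0}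

lemma waveNumber_pos (k : ℝ) : 0 < p.waveNumber k := by
  have := p.freq_pos k; have := p.α₁_pos
  unfold waveNumber; positivity

lemma slopeCoeff_pos : 0 < p.slopeCoeff := by
  have := p.stiffness_pos; have := p.α₁_pos; have := p.δ₂_pos; have := p.β₂_pos
  unfold slopeCoeff; positivity

lemma freq_sq_eq (k : ℝ) : p.freq k ^ 2 = p.α₁ * p.waveNumber k ^ 2 := by
  have := p.α₁_pos
  rw [waveNumber, div_pow, Real.sq_sqrt p.α₁_pos.le]
  field_simp

lemma continuous_waveNumber : Continuous p.waveNumber := by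
  unfold waveNumber freq; fun_prop

lemma continuous_secular : Continuous p.secular := by
  have := p.continuous_waveNumber
  unfold secular; fun_prop

/-- While `kℓ₂` runs through `[2πm + π/6, 2πm + π/3]` with `m` large, the phase of the string runs
through many periods, so that `secular` changes sign. -/
lemma frequently_tuned : ∃ᶠ k in atTop, k ∈ p.tuned := by
  have l1 := p.ℓ₁_pos; have l2 := p.ℓ₂_pos; have ha := p.stiffness_pos; have ha1 := p.α₁_pos
  have hs := p.shift_pos
  have hpi := Real.pi_pos
  rw [frequently_atTop]
  intro N
  set B : ℝ := √p.stiffness / √p.α₁ * p.ℓ₁ with hB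
  have hB0 : 0 < B := by positivity
  have hw (k : ℝ) : p.waveNumber k * p.ℓ₁ = B * (k ^ 2 + p.shift) := by
    rw [waveNumber, freq, hB]; ring
  obtain ⟨m, hm⟩ := exists_nat_ge (max (N * p.ℓ₂) (6 * p.ℓ₂ ^ 2 / (B * Real.pi)))
  set kL : ℝ := (m * (2 * Real.pi) + Real.pi / 6) / p.ℓ₂ with hkL
  set kR : ℝ := (m * (2 * Real.pi) + Real.pi / 3) / p.ℓ₂ with hkR
  have hm0 : (0 : ℝ) ≤ m := m.cast_nonneg
  have hle : kL ≤ kR := by rw [hkL, hkR]; gcongr; norm_num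
  have hN : N ≤ kL := by
    rw [hkL, le_div_iff₀ l2]
    have : N * p.ℓ₂ ≤ m := (le_max_left _ _).trans hm
    have : (m : ℝ) * 1 ≤ m * (2 * Real.pi) := by gcongr; linarith [Real.pi_gt_three]
    linarith
  have hgap : p.waveNumber kL * p.ℓ₁ + 4 * Real.pi ≤ p.waveNumber kR * p.ℓ₁ := by
    have h1 : 6 * p.ℓ₂ ^ 2 / (B * Real.pi) ≤ m := (le_max_right _ _).trans hm
    rw [div_le_iff₀ (by positivity)] at h1
    have h2 : p.waveNumber kR * p.ℓ₁ - p.waveNumber kL * p.ℓ₁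
        = (B * Real.pi ^ 2 * (4 * m + 1 / 2)) / (6 * p.ℓ₂ ^ 2) := by
      rw [hw, hw, hkL, hkR]; field_simp; ring
    have h3 : 4 * Real.pi ≤ (B * Real.pi ^ 2 * (4 * m + 1 / 2)) / (6 * p.ℓ₂ ^ 2) := by
      rw [le_div_iff₀ (by positivity)]
      have h4 : 0 ≤ B * Real.pi ^ 2 * (1 / 2) := by positivity
      have h5 := mul_le_mul_of_nonneg_left h1 (by positivity : (0 : ℝ) ≤ 4 * Real.pi)
      linarith
    linarith
  set n : ℕ := ⌈p.waveNumber kL * p.ℓ₁ / (2 * Real.pi)⌉₊ with hn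
  have hn1 : p.waveNumber kL * p.ℓ₁ ≤ n * (2 * Real.pi) := by
    rw [← div_le_iff₀ (by positivity)]; exact Nat.le_ceil _
  have hn2 : n * (2 * Real.pi) ≤ p.waveNumber kL * p.ℓ₁ + 2 * Real.pi := by
    have h1 := (Nat.ceil_lt_add_one (a := p.waveNumber kL * p.ℓ₁ / (2 * Real.pi))
      (div_nonneg (mul_nonneg (p.waveNumber_pos _).le l1.le) (by positivity))).le
    rw [← hn, ← sub_le_iff_le_add, le_div_iff₀ (by positivity)] at h1
    linarith
  have hcont : ContinuousOn (fun k => p.waveNumber k * p.ℓ₁) (Icc kL kR) :=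
    (p.continuous_waveNumber.mul continuous_const).continuousOn
  -- points at which the string contributes only its sine, with value `1` and `-1`
  obtain ⟨k₁, hk₁, e₁⟩ := intermediate_value_Icc hle hcont
    (show Real.pi / 2 + n * (2 * Real.pi) ∈ Icc _ _ from ⟨by linarith, by linarith⟩)
  obtain ⟨k₂, hk₂, e₂⟩ := intermediate_value_Icc hle hcont
    (show Real.pi / 2 + Real.pi + n * (2 * Real.pi) ∈ Icc _ _ from ⟨by linarith, by linarith⟩)
  simp only at e₁ e₂
  have hx {k : ℝ} (hk : k ∈ Icc kL kR) :
      1 / 2 ≤ Real.sin (k * p.ℓ₂) ∧ 1 / 2 ≤ Real.cos (k * p.ℓ₂) := by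
    have h1 : Real.pi / 6 ≤ k * p.ℓ₂ - m * (2 * Real.pi) := by
      have := hk.1; rw [hkL, div_le_iff₀ l2] at this; linarith
    have h2 : k * p.ℓ₂ - m * (2 * Real.pi) ≤ Real.pi / 3 := by
      have := hk.2; rw [hkR, le_div_iff₀ l2] at this; linarith
    rw [← Real.sin_sub_nat_mul_two_pi _ m, ← Real.cos_sub_nat_mul_two_pi _ m,
      ← Real.sin_pi_div_six]
    nth_rewrite 2 [Real.sin_pi_div_six]
    rw [← Real.cos_pi_div_three]
    exact ⟨Real.sin_le_sin_of_le_of_le_pi_div_two (by linarith) (by linarith) h1,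
      Real.cos_le_cos_of_nonneg_of_le_pi (by linarith) (by linarith) h2⟩
  have hpos {k : ℝ} (hk : k ∈ Icc kL kR) : 0 ≤ p.slopeCoeff * k ^ 3 * Real.cos (k * p.ℓ₂) := by
    have h1 := p.slopeCoeff_pos
    have h2 := (hx hk).2
    have h3 : 0 ≤ kL := by positivity
    have h4 := h3.trans hk.1
    have h5 : 0 ≤ Real.cos (k * p.ℓ₂) := by linarith
    positivity
  have s₁ : 0 ≤ p.secular k₁ := by
    have h1 := hpos hk₁
    rw [secular, e₁, Real.cos_add_nat_mul_two_pi, Real.sin_add_nat_mul_two_pi, Real.cos_pi_div_two,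
      Real.sin_pi_div_two]
    linarith
  have s₂ : p.secular k₂ ≤ 0 := by
    have h1 := hpos hk₂
    rw [secular, e₂, Real.cos_add_nat_mul_two_pi, Real.sin_add_nat_mul_two_pi, Real.cos_add_pi,
      Real.sin_add_pi, Real.cos_pi_div_two, Real.sin_pi_div_two]
    linarith
  obtain ⟨k, hk, e⟩ := isPreconnected_Icc.intermediate_value hk₂ hk₁
    p.continuous_secular.continuousOn ⟨s₂, s₁⟩
  exact ⟨k, hN.trans hk.1, (hx hk).1, (hx hk).2, e⟩

section Tuned

variable {p} {L : Filter ℝ}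

lemma hasOrder_waveNumber (hL : L ≤ atTop) : HasOrder L (fun k => (p.waveNumber k : ℂ)) 2 :=
  ((hasOrder_freq (p := p) hL).const_mul ((√p.α₁ : ℂ)⁻¹)).congr (Eventually.of_forall fun k => by
    rw [waveNumber]; push_cast; rw [div_eq_inv_mul])

lemma hasLowerOrder_waveNumber (hL : L ≤ atTop) :
    HasLowerOrder L (fun k => (p.waveNumber k : ℂ)) 2 := by
  have hc : ((√p.α₁ : ℂ)⁻¹) ≠ 0 := by
    have := p.α₁_pos
    exact inv_ne_zero (by exact_mod_cast (by positivity : √p.α₁ ≠ 0))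
  have h := (hasLowerOrder_freq (p := p) hL).const_mul hc
  refine h.trans (Asymptotics.IsBigO.of_bound 1 (Eventually.of_forall fun k => le_of_eq ?_))
  rw [waveNumber, one_mul]; push_cast; rw [div_eq_inv_mul]

lemma hasOrder_sin_ofReal (f : ℝ → ℝ) : HasOrder L (fun k => (Real.sin (f k) : ℂ)) 0 :=
  HasOrder.of_norm_le (C := 1) (Eventually.of_forall fun k => by
    rw [Complex.norm_real]; exact Real.abs_sin_le_one _)

lemma hasOrder_cos_ofReal (f : ℝ → ℝ) : HasOrder L (fun k => (Real.cos (f k) : ℂ)) 0 :=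
  HasOrder.of_norm_le (C := 1) (Eventually.of_forall fun k => by
    rw [Complex.norm_real]; exact Real.abs_cos_le_one _)

/-- For tuned `k` the string is close to a resonance. -/
lemma hasOrder_sin_waveNumber (hL : L ≤ atTop) (hS : ∀ᶠ k in L, k ∈ p.tuned) :
    HasOrder L (fun k => (Real.sin (p.waveNumber k * p.ℓ₁) : ℂ)) (-1) := by
  have h := (hasOrder_waveNumber (p := p) hL).div hL (hasLowerOrder_pow hL 3)
  refine (h.mono (n := -1) hL (by norm_num)).of_norm_le_norm (C := 4 / p.slopeCoeff) ?_
  filter_upwards [hS, eventually_one_le hL] with k hk h1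
  obtain ⟨k1, k2, k3⟩ := hk
  have hK := p.slopeCoeff_pos
  have hν := p.waveNumber_pos k
  set s := Real.sin (p.waveNumber k * p.ℓ₁) with hs
  have e : p.slopeCoeff * k ^ 3 * Real.cos (k * p.ℓ₂) * s = -(p.waveNumber k
      * Real.cos (p.waveNumber k * p.ℓ₁) * (Real.sin (k * p.ℓ₂) - Real.cos (k * p.ℓ₂))) := by
    rw [secular, ← hs] at k3
    linarith
  have e' := congrArg (fun x : ℝ => |x|) e
  simp only [abs_neg, abs_mul] at e'
  have b1 : |Real.sin (k * p.ℓ₂) - Real.cos (k * p.ℓ₂)| ≤ 2 := by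
    refine (abs_sub _ _).trans ?_
    linarith [Real.abs_sin_le_one (k * p.ℓ₂), Real.abs_cos_le_one (k * p.ℓ₂)]
  have b2 : |p.waveNumber k| * |Real.cos (p.waveNumber k * p.ℓ₁)|
      * |Real.sin (k * p.ℓ₂) - Real.cos (k * p.ℓ₂)| ≤ p.waveNumber k * 1 * 2 := by
    rw [abs_of_pos hν]
    gcongr
    exact Real.abs_cos_le_one _
  have b3 : p.slopeCoeff * k ^ 3 * (1 / 2) * |s|
      ≤ |p.slopeCoeff| * |k ^ 3| * |Real.cos (k * p.ℓ₂)| * |s| := by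
    rw [abs_of_pos hK, abs_of_pos (by positivity : 0 < k ^ 3)]
    gcongr
    exact k2.trans (le_abs_self _)
  rw [norm_div, norm_pow, Complex.norm_real, Complex.norm_real, Complex.norm_real,
    Real.norm_of_nonneg hν.le, Real.norm_of_nonneg (by linarith : 0 ≤ k), Real.norm_eq_abs,
    div_mul_div_comm, le_div_iff₀ (by positivity)]
  linarith

/-- The residual of the string is controlled by a quantity that stays small for tuned `k`. -/
lemma hasOrder_compatibility (hL : L ≤ atTop) (hS : ∀ᶠ k in L, k ∈ p.tuned) :
    HasOrder L (fun k => (∑ j, p.amps k j) * p.waveNumber k * Real.cos (p.waveNumber k * p.ℓ₁)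
      + p.junctionSlope (p.freq k) (p.roots k) (p.amps k)
        * Real.sin (p.waveNumber k * p.ℓ₁)) 2 := by
  have hS' : ∀ᶠ k in L, 1 / 2 ≤ Real.sin (k * p.ℓ₂) := hS.mono fun k hk => hk.1
  have h1 := ((hasOrder_sum_amps_sub hL hS').mul hL (hasOrder_waveNumber (p := p) hL)).mul hL
    (hasOrder_cos_ofReal fun k => p.waveNumber k * p.ℓ₁)
  have h2 := (hasOrder_junctionSlope_sub hL hS').mul hL (hasOrder_sin_waveNumber (p := p) hL hS)
  refine (h1.add h2).congr ?_
  filter_upwards [hS] with k hk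
  obtain ⟨k1, k2, k3⟩ := hk
  have hs : Real.sin (k * p.ℓ₂) ≠ 0 := by
    intro h; rw [h] at k1; norm_num at k1
  have key : (k - k * Real.cos (k * p.ℓ₂) / Real.sin (k * p.ℓ₂)) * p.waveNumber k
      * Real.cos (p.waveNumber k * p.ℓ₁) + p.slopeCoeff * k ^ 3
      * (k * Real.cos (k * p.ℓ₂) / Real.sin (k * p.ℓ₂)) * Real.sin (p.waveNumber k * p.ℓ₁) = 0 := by
    rw [secular] at k3
    field_simp
    linear_combination k * k3
  have key' := congrArg (fun x : ℝ => (x : ℂ)) key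
  simp only [Complex.ofReal_add, Complex.ofReal_mul, Complex.ofReal_sub, Complex.ofReal_pow,
    Complex.ofReal_zero] at key'
  rw [root₁, modeSlope_I_mul]
  rw [slopeCoeff] at key'
  linear_combination -key'

lemma hasLowerOrder_junctionSlope (hL : L ≤ atTop) (hS : ∀ᶠ k in L, k ∈ p.tuned) :
    HasLowerOrder L (fun k => p.junctionSlope (p.freq k) (p.roots k) (p.amps k)) 4 := by
  have hS' : ∀ᶠ k in L, 1 / 2 ≤ Real.sin (k * p.ℓ₂) := hS.mono fun k hk => hk.1
  have hK := p.slopeCoeff_pos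
  have hK' : (p.slopeCoeff : ℂ) ≠ 0 := by exact_mod_cast hK.ne'
  have hR : HasLowerOrder L (fun k => modeSlope p.ℓ₂ (root₁ k)) 1 := by
    refine HasLowerOrder.of_le (C := 1 / 2) (by norm_num) hL ?_
    filter_upwards [hS, eventually_one_le hL] with k hk h1
    obtain ⟨k1, k2, -⟩ := hk
    rw [root₁, modeSlope_I_mul, Complex.norm_real, zpow_one]
    refine le_trans ?_ (le_abs_self _)
    rw [le_div_iff₀ (by linarith)]
    nlinarith [Real.sin_le_one (k * p.ℓ₂)]
  have h := (((hasLowerOrder_pow hL 3).const_mul hK').mul hL hR).add hL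
    (hasOrder_junctionSlope_sub hL hS') (by norm_num)
  refine h.trans (Asymptotics.IsBigO.of_bound 1 (Eventually.of_forall fun k => le_of_eq ?_))
  rw [one_mul, slopeCoeff]
  congr 1
  ring

end Tuned

/-- Along a sequence of frequencies `l → ∞` there are approximate eigenvectors with residual
`O(1/l)`. -/
lemma exists_quasimode : ∃ C : ℝ, 0 < C ∧ ∀ N : ℝ, ∃ l : ℝ, N ≤ l ∧ ∃ y : p.A₂.domain,
    (y : p.EnergySpace) ≠ 0 ∧
      l * ‖(Complex.I * l) • (y : p.EnergySpace) - p.A₂ y‖ ≤ C * ‖(y : p.EnergySpace)‖ := by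
  have l1 := p.ℓ₁_pos; have l2 := p.ℓ₂_pos; have ha := p.α₁_pos; have hη := p.heatDecay_pos
  set L : Filter ℝ := atTop ⊓ 𝓟 p.tuned with hLdef
  have hL : L ≤ atTop := inf_le_left
  have : L.NeBot := frequently_mem_iff_neBot.1 p.frequently_tuned
  have hS : ∀ᶠ k in L, k ∈ p.tuned := mem_inf_of_right (mem_principal_self _)
  have hS' : ∀ᶠ k in L, 1 / 2 ≤ Real.sin (k * p.ℓ₂) := hS.mono fun k hk => hk.1
  set ν := p.waveNumber with hν
  set B : ℝ := 2 + Real.cosh (p.heatDecay * p.ℓ₂) / Real.sinh (p.heatDecay * p.ℓ₂) with hB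
  have hsinh : 0 < Real.sinh (p.heatDecay * p.ℓ₂) := by rw [Real.sinh_pos_iff]; positivity
  have hquot : 0 ≤ Real.cosh (p.heatDecay * p.ℓ₂) / Real.sinh (p.heatDecay * p.ℓ₂) :=
    div_nonneg (Real.cosh_pos _).le hsinh.le
  -- the denominator in the residual of the string
  have hden : HasLowerOrder L (fun k => (p.ℓ₁ : ℂ) * ν k
      + -((Real.cos (ν k * p.ℓ₁) : ℂ) * Real.sin (ν k * p.ℓ₁))) 2 :=
    ((hasLowerOrder_waveNumber (p := p) hL).const_mul (by exact_mod_cast l1.ne')).add hL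
      ((hasOrder_cos_ofReal fun k => ν k * p.ℓ₁).mul hL
        (hasOrder_sin_ofReal fun k => ν k * p.ℓ₁)).neg (by norm_num)
  have hstring := ((hasOrder_waveNumber (p := p) hL).mul hL
    (hasOrder_compatibility (p := p) hL hS)).div hL hden
  obtain ⟨C₁, hC₁, b₁⟩ := hstring.exists_bound hL
  obtain ⟨C₂, hC₂, b₂⟩ := (hasOrder_sum_heatResidual (p := p) hL hS').exists_bound hL
  obtain ⟨C₃, hC₃, b₃⟩ := (hasOrder_freq (p := p) hL).exists_bound hL
  obtain ⟨c, hc, b₄⟩ := (hasLowerOrder_junctionSlope (p := p) hL hS).exists_bound hL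
  obtain ⟨C₅, hC₅, b₅⟩ := p.exists_norm_junction_le
  obtain ⟨c₆, hc₆, b₆⟩ := hden.exists_bound hL
  obtain ⟨c₇, hc₇, b₇⟩ := (hasLowerOrder_freq (p := p) hL).exists_bound hL
  set R : ℝ := p.α₁ * (√p.ℓ₁ * (2 * C₁)) + √p.ℓ₂ * B * C₂ with hR
  have hR0 : 0 < R := by positivity
  refine ⟨C₃ * R * (2 * √C₅ / c), by positivity, fun N => ?_⟩
  have hev : ∀ᶠ k in L, N ≤ p.freq k := by
    filter_upwards [b₇, eventually_one_le hL, hL (eventually_ge_atTop (N / c₇))] with k k1 k2 k3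
    rw [Complex.norm_real, Real.norm_of_nonneg (p.freq_pos k).le, zpow_ofNat] at k1
    rw [div_le_iff₀ hc₇] at k3
    have k4 : c₇ * k ≤ c₇ * k ^ 2 := by gcongr; exact le_self_pow₀ k2 (by norm_num)
    linarith
  have hbig : ∀ᶠ k in L, 2 * C₅ * R ^ 2 / c ^ 2 ≤ k :=
    hL (eventually_ge_atTop (2 * C₅ * R ^ 2 / c ^ 2))
  obtain ⟨k, hN, hk1, hkt, hkb, e₁, e₂, e₃, e₄, e₆, hne⟩ := (hev.and ((eventually_one_le hL).and
    (hS.and (hbig.and (b₁.and (b₂.and (b₃.and (b₄.and (b₆.and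
      (eventually_heatRatio_root₃_ne_zero (p := p) hL)))))))))).exists
  have hk0 : 0 < k := by linarith
  have hden0 : ν k * p.ℓ₁ - Real.cos (ν k * p.ℓ₁) * Real.sin (ν k * p.ℓ₁) ≠ 0 := by
    intro h
    have h' := congrArg (fun x : ℝ => (x : ℂ)) h
    simp only [Complex.ofReal_sub, Complex.ofReal_mul, Complex.ofReal_zero] at h'
    rw [← sub_eq_add_neg, mul_comm (p.ℓ₁ : ℂ), h', norm_zero] at e₆
    have : 0 < c₆ * k ^ (2 : ℤ) := by positivity
    linarith
  have hsin : Real.sin (k * p.ℓ₂) ≠ 0 := by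
    intro h; have := hkt.1; rw [h] at this; norm_num at this
  have hshift := p.shift_pos
  have hroot₂ : 0 < k + p.shift / k := by positivity
  obtain ⟨y, y1, y2, y3⟩ := exists_state (p := p) (p.freq k) (ν k) B (p.roots k) (p.amps k)
    (p.freq_pos k).ne' (p.freq_sq_eq k) hden0
    (by
      intro j
      fin_cases j
      exacts [root₁_ne_zero hk0.ne', root₂_ne_zero hk0, root₃_ne_zero k])
    (by
      intro j
      fin_cases j
      · change Complex.sinh (Complex.I * k * p.ℓ₂) ≠ 0
        rw [sinh_I_mul]
        exact mul_ne_zero Complex.I_ne_zero (by exact_mod_cast hsin)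
      · exact sinh_ne_zero_of_re_pos l2 (by simpa [roots, root₂] using hroot₂)
      · exact sinh_ne_zero_of_re_pos l2 (by change 0 < (p.root₃ k).re; rwa [root₃_re]))
    (sum_modeSlope_amps hne) (sum_heatRatio_amps hne) (by positivity)
    (by
      intro j x hx
      fin_cases j
      · exact (norm_modeFun_I_mul_le hkt.1 x).trans (by linarith)
      · exact (norm_modeFun_ofReal_le l2 hroot₂ hx).trans (by linarith)
      · have h := norm_modeFun_le_of_re_pos (ζ := p.root₃ k) l2 (by rwa [root₃_re]) hx
        rw [root₃_re] at h
        exact h.trans (by linarith))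
  set F := (Complex.I * p.freq k) • (y : p.EnergySpace) - p.A₂ y with hF
  have hFb : ‖F‖ ≤ R * k ^ 2 := by
    refine y3.trans ?_
    rw [hR, add_mul]
    have n1 : |ν k| * (‖(∑ j, p.amps k j) * ν k * Real.cos (ν k * p.ℓ₁)
        + p.junctionSlope (p.freq k) (p.roots k) (p.amps k) * Real.sin (ν k * p.ℓ₁)‖ /
          |ν k * p.ℓ₁ - Real.cos (ν k * p.ℓ₁) * Real.sin (ν k * p.ℓ₁)|) ≤ C₁ * k ^ 2 := by
      refine le_trans (le_of_eq ?_) (e₁.trans (le_of_eq ?_))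
      · rw [norm_div, norm_mul, Complex.norm_real, Real.norm_eq_abs, mul_div_assoc]
        congr 2
        rw [← Real.norm_eq_abs, ← Complex.norm_real]
        push_cast
        congr 1
        ring
      · norm_num
    have n2 : ∑ j, ‖p.heatResidual (p.freq k) (p.roots k j) * p.amps k j‖ ≤ C₂ * k ^ 2 := by
      rw [Complex.norm_real, zpow_ofNat] at e₂
      exact (le_abs_self _).trans e₂
    refine add_le_add ?_ ?_
    · calc _ = p.α₁ * (√p.ℓ₁ * (2 * (|ν k| * (‖(∑ j, p.amps k j) * ν k * Real.cos (ν k * p.ℓ₁)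
            + p.junctionSlope (p.freq k) (p.roots k) (p.amps k) * Real.sin (ν k * p.ℓ₁)‖ /
            |ν k * p.ℓ₁ - Real.cos (ν k * p.ℓ₁) * Real.sin (ν k * p.ℓ₁)|)))) := by ring
        _ ≤ p.α₁ * (√p.ℓ₁ * (2 * (C₁ * k ^ 2))) := by gcongr
        _ = _ := by ring
    · calc _ ≤ √p.ℓ₂ * B * (C₂ * k ^ 2) := by gcongr
        _ = _ := by ring
  -- the energy norm is at least of order `k⁴`; the residual is absorbed for large `k`
  have hlow : c ^ 2 * k ^ 8 ≤ 4 * C₅ * ‖(y : p.EnergySpace)‖ ^ 2 := by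
    have h1 := b₅ (p.freq k) y _ y1 y2
    have h2 : (c * k ^ 4) ^ 2 ≤ ‖p.junctionSlope (p.freq k) (p.roots k) (p.amps k)‖ ^ 2 := by
      rw [zpow_ofNat] at e₄
      gcongr
    have h3 : ‖(y : p.EnergySpace)‖ * ‖F‖ ≤ ‖(y : p.EnergySpace)‖ ^ 2 + (R * k ^ 2) ^ 2 := by
      have h4 : ‖(y : p.EnergySpace)‖ * ‖F‖ ≤ ‖(y : p.EnergySpace)‖ * (R * k ^ 2) := by gcongr
      nlinarith [sq_nonneg (‖(y : p.EnergySpace)‖ - R * k ^ 2),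
        norm_nonneg (y : p.EnergySpace), mul_nonneg hR0.le (sq_nonneg k)]
    have h5 : C₅ * (R * k ^ 2) ^ 2 ≤ c ^ 2 * k ^ 8 / 2 := by
      rw [div_le_iff₀ (by positivity)] at hkb
      have h6 : k ≤ k ^ 4 := le_self_pow₀ hk1 (by norm_num)
      have h9 := mul_le_mul_of_nonneg_right
        (hkb.trans (mul_le_mul_of_nonneg_right h6 (sq_nonneg c))) (by positivity : 0 ≤ k ^ 4)
      linarith
    have h7 : C₅ * (‖(y : p.EnergySpace)‖ ^ 2 + ‖(y : p.EnergySpace)‖ * ‖F‖)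
        ≤ C₅ * (‖(y : p.EnergySpace)‖ ^ 2 + (‖(y : p.EnergySpace)‖ ^ 2 + (R * k ^ 2) ^ 2)) := by
      gcongr
    have h8 : (c * k ^ 4) ^ 2 = c ^ 2 * k ^ 8 := by ring
    linarith
  have hlow' : c * k ^ 4 ≤ 2 * √C₅ * ‖(y : p.EnergySpace)‖ := by
    refine abs_le_of_sq_le_sq' ?_ (by positivity) |>.2
    rw [mul_pow, mul_pow, mul_pow, Real.sq_sqrt hC₅.le]
    linarith
  refine ⟨p.freq k, hN, y, fun h0 => ?_, ?_⟩
  · rw [h0, norm_zero, mul_zero] at hlow'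
    have : 0 < c * k ^ 4 := by positivity
    linarith
  · rw [Complex.norm_real, Real.norm_of_nonneg (p.freq_pos k).le, zpow_ofNat] at e₃
    calc p.freq k * ‖F‖ ≤ (C₃ * k ^ 2) * (R * k ^ 2) :=
          mul_le_mul e₃ hFb (norm_nonneg _) (by positivity)
      _ = C₃ * R * ((c * k ^ 4) / c) := by field_simp
      _ ≤ C₃ * R * ((2 * √C₅ * ‖(y : p.EnergySpace)‖) / c) := by gcongr
      _ = _ := by ring

end StringBeam

/-! ### Lack of exponential stability and growth of the resolvent -/

namespace StringBeam

variable {p : StringBeam}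

lemma not_isExponentiallyStable {S : C0Semigroup p.EnergySpace} (hS : S.IsGeneratedBy p.A₂) :
    ¬ S.IsExponentiallyStable := by
  intro hst
  obtain ⟨D, hD⟩ := exists_bound_of_isExponentiallyStable hS hst
  obtain ⟨C, hC, h⟩ := exists_quasimode p
  obtain ⟨l, hl, y, hy0, hy⟩ := h (1 + C * |D|)
  have hpos : 0 < ‖(y : p.EnergySpace)‖ := norm_pos_iff.2 hy0
  have hl0 : 0 ≤ l := le_trans (by positivity) hl
  have h1 : ‖(y : p.EnergySpace)‖ ≤ |D| * ‖(Complex.I * l) • (y : p.EnergySpace) - p.A₂ y‖ :=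
    (hD l y).trans (by gcongr; exact le_abs_self D)
  have h2 : l * ‖(y : p.EnergySpace)‖ ≤ |D| * (C * ‖(y : p.EnergySpace)‖) := by
    calc l * ‖(y : p.EnergySpace)‖
        ≤ l * (|D| * ‖(Complex.I * l) • (y : p.EnergySpace) - p.A₂ y‖) := by gcongr
      _ = |D| * (l * ‖(Complex.I * l) • (y : p.EnergySpace) - p.A₂ y‖) := by ring
      _ ≤ _ := by gcongr
  have h3 : (1 + C * |D|) * ‖(y : p.EnergySpace)‖ ≤ l * ‖(y : p.EnergySpace)‖ := by gcongr
  linarith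

/-- The resolvent grows at least linearly along a sequence of frequencies. -/
lemma exists_le_norm_resolventOf (p : StringBeam) : ∃ C : ℝ, 0 < C ∧ ∀ N : ℝ, ∃ l : ℝ, N ≤ l ∧
    l ≤ C * ‖resolventOf p.A₂ (Complex.I * l)‖ := by
  obtain ⟨C, hC, h⟩ := exists_quasimode p
  refine ⟨C, hC, fun N => ?_⟩
  obtain ⟨l, hl, y, hy0, hy⟩ := h (max N 0)
  have hpos : 0 < ‖(y : p.EnergySpace)‖ := norm_pos_iff.2 hy0
  have hl0 : 0 ≤ l := (le_max_right _ _).trans hl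
  obtain ⟨R, hR⟩ := exists_isResolventAt_I_mul (p := p) l
  refine ⟨l, (le_max_left _ _).trans hl, ?_⟩
  rw [hR.resolventOf_eq]
  have h1 : ‖(y : p.EnergySpace)‖ ≤ ‖R‖ * ‖(Complex.I * l) • (y : p.EnergySpace) - p.A₂ y‖ := by
    have := R.le_opNorm ((Complex.I * l) • (y : p.EnergySpace) - p.A₂ y)
    rwa [hR.2 y] at this
  refine le_of_mul_le_mul_right ?_ hpos
  calc l * ‖(y : p.EnergySpace)‖
      ≤ l * (‖R‖ * ‖(Complex.I * l) • (y : p.EnergySpace) - p.A₂ y‖) := by gcongr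
    _ = ‖R‖ * (l * ‖(Complex.I * l) • (y : p.EnergySpace) - p.A₂ y‖) := by ring
    _ ≤ ‖R‖ * (C * ‖(y : p.EnergySpace)‖) := by gcongr
    _ = _ := by ring

lemma limsup_resolventOf_eq_top {α : ℝ} (hα : α < 1) :
    limsup (fun r : ℝ => ENNReal.ofReal (|r| ^ (-α) * ‖resolventOf p.A₂ (Complex.I * (r : ℂ))‖))
      (comap (fun r : ℝ => |r|) atTop) = ⊤ := by
  obtain ⟨C, hC, h⟩ := exists_le_norm_resolventOf p
  refine ENNReal.eq_top_of_forall_nnreal_le fun M => ?_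
  refine le_limsup_of_frequently_le ?_
  rw [frequently_comap, frequently_atTop]
  intro N
  obtain ⟨T, hT⟩ := eventually_atTop.1
    ((tendsto_rpow_atTop (sub_pos.2 hα)).eventually_ge_atTop (C * M))
  obtain ⟨l, hl, hlR⟩ := h (max (max N T) 1)
  have hl1 : 1 ≤ l := (le_max_right _ _).trans hl
  have hl0 : 0 < l := by linarith
  refine ⟨l, (le_max_left _ _).trans ((le_max_left _ _).trans hl), l, abs_of_pos hl0, ?_⟩
  rw [← ENNReal.ofReal_coe_nnreal]
  refine ENNReal.ofReal_le_ofReal ?_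
  have h1 : C * M ≤ l ^ (1 - α) :=
    hT l ((le_max_right _ _).trans ((le_max_left _ _).trans hl))
  rw [abs_of_pos hl0]
  refine le_of_mul_le_mul_left ?_ hC
  calc C * M ≤ l ^ (1 - α) := h1
    _ = l ^ (-α) * l := by
      rw [sub_eq_neg_add, Real.rpow_add hl0, Real.rpow_one]
    _ ≤ l ^ (-α) * (C * ‖resolventOf p.A₂ (Complex.I * (l : ℂ))‖) := by gcongr
    _ = _ := by ring

end StringBeam

end

theorem mainTheorem3 (p : StringBeam) (hℓ₁ : p.ℓ₁ = Real.pi) (hℓ₂ : p.ℓ₂ = Real.pi) :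
    (∃ S : C0Semigroup p.EnergySpace, S.IsGeneratedBy p.A₂) ∧
    (∀ S : C0Semigroup p.EnergySpace, S.IsGeneratedBy p.A₂ → ¬ S.IsExponentiallyStable) ∧
    (∀ r : ℝ, Complex.I * (r : ℂ) ∈ resolventSetOf p.A₂) ∧
    ∀ α : ℝ, α < 1 →
      limsup (fun r : ℝ =>
          ENNReal.ofReal (|r| ^ (-α) * ‖resolventOf p.A₂ (Complex.I * (r : ℂ))‖))
        (comap (fun r : ℝ => |r|) atTop) = ⊤ :=
  ⟨exists_semigroup_of_dissipative StringBeam.re_inner_A₂_nonpos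
      StringBeam.exists_isResolventAt_zero,
    fun _ hS => StringBeam.not_isExponentiallyStable hS,
    StringBeam.exists_isResolventAt_I_mul,
    fun _ hα => StringBeam.limsup_resolventOf_eq_top hα⟩
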